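/- Let $n\ge 3$. Write $e(t)=e^{2\pi i t}$, let $\xi(w)=\pi^{-w/2}\Gamma(w/2)\zeta(w)$ (meromorphically continued), $\sigma_w(m)=\sum_{d\mid m,\,d>0}d^w$, and let $K_\nu(t)=\frac12\int_0^\infty e^{-\frac t2(r+1/r)}r^{\nu-1}\,dr$ be the $K$-Bessel function. Let $X_n=GL_n(\mathbb R)/(O_n(\mathbb R)\cdot\mathbb R^*)$; every point of $X_n$ is represented by a unique $z=x\cdot y$ with $x=(x_{i,j})$ upper triangular unipotent and $y=\mathrm{diag}(y_1y_2\cdots y_{n-1},\,y_1\cdots y_{n-2},\dots,y_1,1)$, $y_j>0$. For $i\ge2$ let $P_{(i-1,1)}(\mathbb Z)$ be the group of matrices in $SL_i(\mathbb Z)$ with bottom row $(0,\dots,0,1)$. Let $$E_{(n-1,1)}(z,s,1)=\sum_{\gamma\in P_{(n-1,1)}(\mathbb Z)\backslash SL_n(\mathbb Z)} I_s(\gamma z),\qquad I_s(z)=\Big(\prod_{j=1}^{n-1}y_j^{\,n-j}\Big)^{s},$$ for $\mathrm{Re}(s)>1$. For $m=(m_1,\dots,m_{n-1})\in\mathbb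 Z^{n-1}$ put $$\hat\phi_{m}(z,s)=\int_0^1\cdots\int_0^1E_{(n-1,1)}(u z,s,1)\,e(-m_1u_{1,2}-\cdots-m_{n-1}u_{n-1,n})\prod_{1\le i<j\le n}du_{i,j},$$ where $u=(u_{i,j})$ is upper triangular unipotent. **Theorem.** For every $z$, the series defining $E_{(n-1,1)}(z,s,1)$ converges absolutely for $\mathrm{Re}(s)>1$ and has a meromorphic continuation to $s\in\mathbb C$. Let $s\in\mathbb C$ be such that $ns\notin\{0,1,\dots,n\}$ and $\xi(ns)\ne0$ (for instance, any $s$ with $\mathrm{Re}(s)>1$). Then $E_{(n-1,1)}(z,\cdot,1)$ is analytic at $s$, the integrals defining $\hat\phi_m(z,s)$ converge, and the following hold for every $z=x\cdot y$. 1. $\hat\phi_{(m_1,\dots,m_{n-1})}(z,s)=0$ whenever at least two of the $m_i$ are non-zero. 2. With absolutely convergent sums, $$E_{(n-1,1)}(z,s,1)=\sum_{m_1\in\mathbb Z}\hat\phi_{(m_1,0,\dots,0)}(z,s)+\sum_{i=2}^{n-1}\ \sum_{\gamma_i\in P_{(i-1,1)}(\mathbb Z)\backslash SL_i(\mathbb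 Z)}\ \sum_{m_i=1}^\infty\hat\phi_{(0,\dots,0,m_i,0,\dots,0)}\left(\begin{pmatrix}\gamma_i&\\&I_{n-i}\end{pmatrix}z,\,s\right),$$ where $m_i$ stands at the $i$-th place, for any choice of representatives $\gamma_i$ of the cosets. 3. The constant term is $$\hat\phi_{(0,\dots,0)}(z,s)=\sum_{k=0}^{n-1}\frac{2\,\xi(ns-n+k+1)}{\xi(ns)}\left(y_1y_2^2\cdots y_{n-k-1}^{n-k-1}\right)^{1-s}\left(y_{n-k}^{k}y_{n-k+1}^{k-1}\cdots y_{n-1}\right)^{s}.$$ 4. For $1\le k\le n-1$ and $m_k\in\mathbb Z\setminus\{0\}$ at the $k$-th place, $$\hat\phi_{(0,\dots,0,m_k,0,\dots,0)}(z,s)=e(m_kx_{k,k+1})\,\frac{4}{\xi(ns)}\,|m_k|^{\frac{ns}2-\frac{n-k}2}\,\sigma_{-ns+n-k}(|m_k|)\,K_{\frac{ns}2-\frac{n-k}2}(2\pi|m_k|y_{n-k})$$ $$\qquad\times\left(y_1y_2^2\cdots y_{n-k-1}^{n-k-1}\right)^{1-s}\left(y_{n-k}^{k}y_{n-k+1}^{k-1}\cdots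 y_{n-1}\right)^{s}y_{n-k}^{-\frac{ns}2+\frac{n-k}2}.$$ -/

import Mathlib

open scoped Matrix

noncomputable section

namespace DegEis

/-- `e(t) = exp(2 π i t)`. -/
def e (t : ℝ) : ℂ := Complex.exp (2 * Real.pi * Complex.I * t)

/-- The `K`-Bessel function
`K_ν(t) = (1/2) ∫_0^∞ exp(-(t/2)(r + 1/r)) r^(ν-1) dr`, for `t > 0` and any complex order `ν`. -/
def besselK (ν : ℂ) (t : ℝ) : ℂ :=
  (1 / 2) * ∫ r in Set.Ioi (0 : ℝ), (Real.exp (-(t / 2) * (r + r⁻¹)) : ℂ) * (r : ℂ) ^ (ν - 1)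

/-- The divisor sum `σ_w(m) = ∑_{d ∣ m, d > 0} d^w` with complex exponent. -/
def sigma (w : ℂ) (m : ℕ) : ℂ := ∑ d ∈ m.divisors, (d : ℂ) ^ w

/-!
Coordinates are indexed from `1`, as is customary: `x i j` for `1 ≤ i < j ≤ n` and `y j` for
`1 ≤ j ≤ n - 1`.  They are stored as functions on `ℕ`; values outside these ranges are never used.
The rows and columns of a matrix are indexed by `Fin n`, i.e. from `0`.
-/

/-- The upper triangular unipotent `n × n` matrix with entries `x i j` above the diagonal. -/
def unip (n : ℕ) (x : ℕ → ℕ → ℝ) : Matrix (Fin n) (Fin n) ℝ :=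
  Matrix.of fun a b => if a < b then x (a + 1) (b + 1) else if a = b then 1 else 0

/-- `Y_j = y_1 y_2 ⋯ y_{j-1}`; in particular `Y_1 = 1`. -/
def bigY (y : ℕ → ℝ) (j : ℕ) : ℝ := ∏ i ∈ Finset.Icc 1 (j - 1), y i

/-- The diagonal matrix `diag(Y_n, …, Y_2, Y_1) = diag(y_1 ⋯ y_{n-1}, …, y_1, 1)`. -/
def torus (n : ℕ) (y : ℕ → ℝ) : Matrix (Fin n) (Fin n) ℝ :=
  Matrix.diagonal fun a => bigY y (n - a)

/-- `x`, `y` are Iwasawa coordinates of the class of `g` in `GL_n(ℝ) / (O_n(ℝ) · ℝ^*)`. -/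
def IsIwasawa (n : ℕ) (g : Matrix (Fin n) (Fin n) ℝ) (x : ℕ → ℕ → ℝ) (y : ℕ → ℝ) : Prop :=
  (∀ j ∈ Finset.Icc 1 (n - 1), 0 < y j) ∧
    ∃ k ∈ Matrix.orthogonalGroup (Fin n) ℝ, ∃ r : ℝ, r ≠ 0 ∧
      g = r • (unip n x * torus n y * k)

open Classical in
/-- The Iwasawa `y`-coordinates of the class of an invertible matrix `g`. -/
def iwasawaY (n : ℕ) (g : Matrix (Fin n) (Fin n) ℝ) : ℕ → ℝ :=
  if h : ∃ y x, IsIwasawa n g x y then h.choose else 1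

/-- The function `I_s(z, P_{n-1,1}) = (Y_2 Y_3 ⋯ Y_n)^s · Y_1^{-(n-1)s}`, where `Y_1 = 1`,
as a function on invertible matrices. -/
def IFun (n : ℕ) (s : ℂ) (g : Matrix (Fin n) (Fin n) ℝ) : ℂ :=
  ((∏ j ∈ Finset.Icc 2 n, bigY (iwasawaY n g) j : ℝ) : ℂ) ^ s

/-- `P_{i-1,1}(ℤ)`: the matrices in `SL_i(ℤ)` with bottom row `(0, …, 0, 1)`. -/
def P (i : ℕ) : Subgroup (Matrix.SpecialLinearGroup (Fin i) ℤ) where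
  carrier := {γ | ∀ a b : Fin i, (a : ℕ) + 1 = i → γ a b = if a = b then 1 else 0}
  one_mem' := by
    intro a b _
    simp [Matrix.one_apply]
  mul_mem' := by
    intro γ δ hγ hδ a b ha
    simp only [Set.mem_ofPred_eq] at hγ hδ
    rw [Matrix.SpecialLinearGroup.coe_mul, Matrix.mul_apply]
    simp [hγ a _ ha, hδ a b ha]
  inv_mem' := by
    intro γ hγ a b ha
    simp only [Set.mem_ofPred_eq] at hγ
    have h : (γ * γ⁻¹ : Matrix.SpecialLinearGroup (Fin i) ℤ) a b = if a = b then 1 else 0 := by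
      rw [mul_inv_cancel]
      simp [Matrix.one_apply]
    rw [Matrix.SpecialLinearGroup.coe_mul, Matrix.mul_apply] at h
    simpa [hγ a _ ha] using h

/-- The real `n × n` matrix `diag(γ, I_{n-i})`, for an integral `i × i` matrix `γ` and `i ≤ n`. -/
def block (i n : ℕ) (γ : Matrix.SpecialLinearGroup (Fin i) ℤ) : Matrix (Fin n) (Fin n) ℝ :=
  Matrix.of fun a b =>
    if h : (a : ℕ) < i ∧ (b : ℕ) < i then ((γ ⟨a, h.1⟩ ⟨b, h.2⟩ : ℤ) : ℝ)
    else if a = b then 1 else 0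

/-- `E z s` is the degenerate Eisenstein series `E_{(n-1,1)}(z, s, 1)`, for `z ∈ GL_n(ℝ)` and
`s ∈ ℂ`: for `Re s > 1` it is the sum of `I_s(γ z, P_{n-1,1})` over `P_{n-1,1}(ℤ) \ SL_n(ℤ)`
(the sum being the same for every set `T` of representatives of the cosets), and in `s` it is
meromorphic on `ℂ`.  "Normal form" says that `E z` is analytic wherever its singularity is
removable (and has the default value `0` at its poles), so that these conditions determine `E z`. -/
def IsDegenerateEisenstein (n : ℕ) (E : Matrix (Fin n) (Fin n) ℝ → ℂ → ℂ) : Prop :=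
  ∀ z : Matrix (Fin n) (Fin n) ℝ, z.det ≠ 0 →
    MeromorphicNFOn (E z) Set.univ ∧
    ∀ s : ℂ, 1 < s.re → ∀ T : Set (Matrix.SpecialLinearGroup (Fin n) ℤ),
      Subgroup.IsComplement (P n : Set (Matrix.SpecialLinearGroup (Fin n) ℤ)) T →
        HasSum (fun γ : T => IFun n s (block n n γ * z)) (E z s)

/-- The pairs `(i, j)` with `1 ≤ i < j ≤ n`. -/
def upperPairs (n : ℕ) : Finset (ℕ × ℕ) :=
  (Finset.Icc 1 n ×ˢ Finset.Icc 1 n).filter fun p => p.1 < p.2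

/-- The coordinates `u_{i,j}` of a unipotent matrix, extended by `0` to all pairs of indices. -/
def ext (n : ℕ) (u : upperPairs n → ℝ) (i j : ℕ) : ℝ :=
  if h : (i, j) ∈ upperPairs n then u ⟨(i, j), h⟩ else 0

/-- The Fourier coefficient of index `(m_1, …, m_{n-1})` of a function `f` on `GL_n(ℝ)`:
`∫_0^1 ⋯ ∫_0^1 f(u z) e(-m_1 u_{1,2} - ⋯ - m_{n-1} u_{n-1,n}) ∏_{i<j} du_{i,j}`. -/
def fourierCoeff (n : ℕ) (f : Matrix (Fin n) (Fin n) ℝ → ℂ) (m : ℕ → ℤ)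
    (z : Matrix (Fin n) (Fin n) ℝ) : ℂ :=
  ∫ u in Set.Icc (0 : upperPairs n → ℝ) 1,
    f (unip n (ext n u) * z) *
      e (-∑ k ∈ Finset.Icc 1 (n - 1), (m k : ℝ) * ext n u k (k + 1))

/-- The index `(0, …, 0, m, 0, …, 0)` with `m` at place `k`. -/
def single (k : ℕ) (m : ℤ) : ℕ → ℤ := Pi.single k m

/-- `(y_1 y_2^2 ⋯ y_{n-k-1}^{n-k-1})^{1-s} (y_{n-k}^k y_{n-k+1}^{k-1} ⋯ y_{n-1})^s`. -/
def powerFun (n k : ℕ) (s : ℂ) (y : ℕ → ℝ) : ℂ :=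
  ((∏ j ∈ Finset.Icc 1 (n - k - 1), y j ^ j : ℝ) : ℂ) ^ (1 - s) *
    ((∏ j ∈ Finset.Icc (n - k) (n - 1), y j ^ (n - j) : ℝ) : ℂ) ^ s

end DegEis

end

/-! Only the last row of `γ` matters for `I_s(γz)`: it equals `(|det z| / ‖v z‖^n)^s` with `v` the
last row (`IFun_block`). Left multiplication by `P_{(n-1,1)}(ℤ)` preserves this row, and the rows
that occur are exactly the primitive vectors. Multiplication by `ζ(ns)` therefore turns the
Eisenstein series into the Epstein zeta function of the form `v ↦ ‖v z‖²`, evaluated at `w = ns`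
(`hasSum_IFun`).

In coordinates `z ~ u · diag(c_0, …, c_{n-1})` this form is nested: adding a last variable `t` adds
a square `c² (t + shift)²`. The vectors with only `t` nonzero give a completed zeta value. Poisson
summation in `t` over the others (`poisson_epstein`) produces the same Epstein function in one
variable less at `w - 1`, from the zero frequency, and a sum of `K`-Bessel functions, from the rest.
Iteration (`tsum_quadForm_cpow`, `complEpstein_eq`) yields `n` zeta values and one Bessel sum for
each column of `u`. The Bessel sums converge exponentially and are entire in `s`, so the formula
gives the continuation; uniqueness of the continuation identifies it with any `E` as in
`IsDegenerateEisenstein`.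

The Fourier coefficients are read off this formula. The Bessel term of index `(a, m)` in column `k +
1` oscillates in that column with frequency vector `m a ∈ ℤ^k`, whereas the character of index
`(m_1, …, m_{n-1})` has frequency `(0, …, 0, m_k)` there. Only terms with `m a = (0, …, 0, m_k)`
survive integration; then `a` lies on the last axis, the form no longer depends on earlier columns,
and the remaining `m_j` must vanish (`integral_besselTerm_mul_chr`). So at most one `m_i` can be
nonzero. The factorizations `m_k = m d` produce the divisor sum, and the zeta values the constant
term.

For the expansion, the Bessel sum of column `i + 1` is grouped by frequency (`hasSum_fiberSum`). A
nonzero frequency is a positive integer times the last row of some `γ ∈ SL_i(ℤ)`, unique modulo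
`P_{(i-1,1)}(ℤ)`, and acting by `diag(γ, I)` moves `(0, …, 0, m)` to that frequency
(`fourierCoeff_single_block`). For `i = 1` the frequencies are just the nonzero integers. -/

noncomputable section

open MeasureTheory Set Filter Topology
open scoped Matrix

namespace DegEis

/-! ### Bessel integrals and their bounds -/

/-- The Mellin transform at `ν` of `r ↦ exp (-π (p r + q / r))`. -/
def besselInt (p q : ℝ) (ν : ℂ) : ℂ :=
  mellin (fun r : ℝ => (Real.exp (-Real.pi * (p * r + q / r)) : ℂ)) ν

lemma besselKernel_continuousOn (p q : ℝ) :
    ContinuousOn (fun r : ℝ => (Real.exp (-Real.pi * (p * r + q / r)) : ℂ)) (Ioi 0) := by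
  refine Complex.continuous_ofReal.comp_continuousOn (Real.continuous_exp.comp_continuousOn ?_)
  refine continuousOn_const.mul ((continuousOn_const.mul continuousOn_id).add ?_)
  exact continuousOn_const.div continuousOn_id fun r hr => ne_of_gt hr

lemma besselKernel_isBigO_atTop {p q : ℝ} (hq : 0 ≤ q) :
    (fun r : ℝ => (Real.exp (-Real.pi * (p * r + q / r)) : ℂ)) =O[atTop]
      fun r => Real.exp (-(Real.pi * p) * r) := by
  refine Asymptotics.IsBigO.of_bound 1 ?_
  filter_upwards [eventually_gt_atTop 0] with r hr
  rw [Complex.norm_real, Real.norm_eq_abs, Real.norm_eq_abs, abs_of_pos (Real.exp_pos _),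
    abs_of_pos (Real.exp_pos _), one_mul, Real.exp_le_exp]
  have : 0 ≤ Real.pi * (q / r) := by positivity
  nlinarith

/-- The factor `exp(-πq/r)` vanishes to infinite order at `0`: under `r ↦ 1/r` this is the decay of
an exponential at infinity. Hence `b` is arbitrary, and the Mellin transform exists and is
holomorphic for every `ν`. -/
lemma besselKernel_isBigO_zero {p q : ℝ} (hp : 0 ≤ p) (hq : 0 < q) (b : ℝ) :
    (fun r : ℝ => (Real.exp (-Real.pi * (p * r + q / r)) : ℂ)) =O[𝓝[>] 0]
      fun r => r ^ (-b) := by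
  have h := (isLittleO_exp_neg_mul_rpow_atTop (a := Real.pi * q) (by positivity) b).isBigO.comp_tendsto
    (tendsto_inv_nhdsGT_zero (𝕜 := ℝ))
  refine Asymptotics.IsBigO.trans (Asymptotics.IsBigO.of_bound 1 ?_) (h.congr' .rfl ?_)
  · filter_upwards [self_mem_nhdsWithin] with r hr
    have hr : 0 < r := hr
    simp only [Function.comp]
    rw [Complex.norm_real, Real.norm_eq_abs, Real.norm_eq_abs, abs_of_pos (Real.exp_pos _),
      abs_of_pos (Real.exp_pos _), one_mul, Real.exp_le_exp, div_eq_mul_inv]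
    have : 0 ≤ Real.pi * (p * r) := by positivity
    nlinarith
  · filter_upwards [self_mem_nhdsWithin] with r hr
    have hr : 0 < r := hr
    simp only [Function.comp]
    rw [Real.inv_rpow hr.le, Real.rpow_neg hr.le]

lemma besselInt_convergent {p q : ℝ} (hp : 0 < p) (hq : 0 < q) (ν : ℂ) :
    MellinConvergent (fun r : ℝ => (Real.exp (-Real.pi * (p * r + q / r)) : ℂ)) ν :=
  mellinConvergent_of_isBigO_rpow_exp (a := Real.pi * p) (b := ν.re - 1) (by positivity)
    ((besselKernel_continuousOn p q).locallyIntegrableOn measurableSet_Ioi)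
    (besselKernel_isBigO_atTop hq.le) (besselKernel_isBigO_zero hp.le hq _) (by linarith)

lemma besselInt_differentiable {p q : ℝ} (hp : 0 < p) (hq : 0 < q) :
    Differentiable ℂ (besselInt p q) := fun ν =>
  mellin_differentiableAt_of_isBigO_rpow_exp (a := Real.pi * p) (b := ν.re - 1) (by positivity)
    ((besselKernel_continuousOn p q).locallyIntegrableOn measurableSet_Ioi)
    (besselKernel_isBigO_atTop hq.le) (besselKernel_isBigO_zero hp.le hq _) (by linarith)

/-- The integrand of the integral that bounds `besselInt`. -/
def besselMajorant (p q R : ℝ) (r : ℝ) : ℝ :=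
  Real.exp (-Real.pi * (p / 2 * r + q / 2 / r)) * (r ^ (R - 1) + r ^ (-R - 1))

lemma besselMajorant_integrable {p q : ℝ} (hp : 0 < p) (hq : 0 < q) (R : ℝ) :
    IntegrableOn (besselMajorant p q R) (Ioi 0) := by
  have h (σ : ℝ) : IntegrableOn
      (fun r : ℝ => Real.exp (-Real.pi * (p / 2 * r + q / 2 / r)) * r ^ (σ - 1)) (Ioi 0) := by
    have := (besselInt_convergent (half_pos hp) (half_pos hq) (σ : ℂ)).norm
    refine IntegrableOn.congr_fun this (fun r hr => ?_) measurableSet_Ioi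
    have hr : 0 < r := hr
    simp only [norm_smul, Complex.norm_cpow_eq_rpow_re_of_pos hr, Complex.norm_real]
    rw [Real.norm_of_nonneg (Real.exp_pos _).le, mul_comm]
    simp
  refine ((h R).add (h (-R))).congr_fun (fun r _ => ?_) measurableSet_Ioi
  simp [besselMajorant, mul_add]

lemma besselMajorant_nonneg (p q R : ℝ) {r : ℝ} (hr : 0 < r) : 0 ≤ besselMajorant p q R r := by
  unfold besselMajorant; positivity

/-- Half of the exponent `p r + q / r` is bounded below by `√(pq)` (arithmetic-geometric mean) and
gives the decay; the other half, with `p₀, q₀` in place of `p, q`, keeps the majorant integrable.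
The two powers of `r` in the majorant cover `r ≥ 1` and `r ≤ 1`. -/
lemma norm_besselIntegrand_le {p q p₀ q₀ R : ℝ} (hp₀ : 0 < p₀) (hq₀ : 0 < q₀)
    (hp : p₀ ≤ p) (hq : q₀ ≤ q) {ν : ℂ} (hν : |ν.re| ≤ R) {r : ℝ} (hr : 0 < r) :
    ‖(r : ℂ) ^ (ν - 1) • (Real.exp (-Real.pi * (p * r + q / r)) : ℂ)‖ ≤
      Real.exp (-Real.pi * √(p * q)) * besselMajorant p₀ q₀ R r := by
  rw [norm_smul, Complex.norm_cpow_eq_rpow_re_of_pos hr, Complex.norm_real,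
    Real.norm_of_nonneg (Real.exp_pos _).le, besselMajorant, mul_comm, ← mul_assoc,
    ← Real.exp_add]
  have h1 : r ^ (ν - 1).re ≤ r ^ (R - 1) + r ^ (-R - 1) := by
    rw [abs_le] at hν
    simp only [Complex.sub_re, Complex.one_re]
    rcases le_total 1 r with h | h
    · have := Real.rpow_le_rpow_of_exponent_le h (show ν.re - 1 ≤ R - 1 by linarith)
      have := Real.rpow_nonneg hr.le (-R - 1)
      linarith
    · have := Real.rpow_le_rpow_of_exponent_ge hr h (show -R - 1 ≤ ν.re - 1 by linarith)
      have := Real.rpow_nonneg hr.le (R - 1)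
      linarith
  have h2 : √(p * q) ≤ (p * r + q / r) / 2 := by
    have hp' : 0 < p := hp₀.trans_le hp
    have hq' : 0 < q := hq₀.trans_le hq
    rw [Real.sqrt_le_left (by positivity)]
    have : p * q = (p * r) * (q / r) := by field_simp
    rw [this]
    nlinarith [sq_nonneg (p * r - q / r)]
  have h3 : p₀ * r + q₀ / r ≤ p * r + q / r := by gcongr
  refine mul_le_mul (Real.exp_le_exp.mpr ?_) h1 (by positivity) (by positivity)
  have h4 : √(p * q) + (p₀ / 2 * r + q₀ / 2 / r) ≤ p * r + q / r := by
    have : p₀ / 2 * r + q₀ / 2 / r = (p₀ * r + q₀ / r) / 2 := by field_simp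
    linarith
  have := mul_le_mul_of_nonneg_left h4 Real.pi_pos.le
  linarith

/-- The constant in the bound of `besselInt`. -/
def besselBound (p q R : ℝ) : ℝ := ∫ r in Ioi (0 : ℝ), besselMajorant p q R r

lemma besselBound_nonneg (p q R : ℝ) : 0 ≤ besselBound p q R :=
  setIntegral_nonneg measurableSet_Ioi fun _ hr => besselMajorant_nonneg p q R hr

lemma norm_besselInt_le {p q p₀ q₀ R : ℝ} (hp₀ : 0 < p₀) (hq₀ : 0 < q₀)
    (hp : p₀ ≤ p) (hq : q₀ ≤ q) {ν : ℂ} (hν : |ν.re| ≤ R) :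
    ‖besselInt p q ν‖ ≤ Real.exp (-Real.pi * √(p * q)) * besselBound p₀ q₀ R := by
  rw [besselInt, mellin, besselBound, ← integral_const_mul]
  refine norm_integral_le_of_norm_le ((besselMajorant_integrable hp₀ hq₀ R).const_mul _) ?_
  filter_upwards [ae_restrict_mem measurableSet_Ioi] with r hr
  exact norm_besselIntegrand_le hp₀ hq₀ hp hq hν hr

lemma integral_norm_besselIntegrand_le {p q p₀ q₀ R : ℝ} (hp₀ : 0 < p₀) (hq₀ : 0 < q₀)
    (hp : p₀ ≤ p) (hq : q₀ ≤ q) {ν : ℂ} (hν : |ν.re| ≤ R) :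
    ∫ r in Ioi (0 : ℝ), ‖(r : ℂ) ^ (ν - 1) • (Real.exp (-Real.pi * (p * r + q / r)) : ℂ)‖ ≤
      Real.exp (-Real.pi * √(p * q)) * besselBound p₀ q₀ R := by
  rw [besselBound, ← integral_const_mul]
  refine setIntegral_mono_on (besselInt_convergent (hp₀.trans_le hp) (hq₀.trans_le hq) ν).norm
    ((besselMajorant_integrable hp₀ hq₀ R).const_mul _) measurableSet_Ioi fun r hr => ?_
  exact norm_besselIntegrand_le hp₀ hq₀ hp hq hν hr

lemma besselInt_continuousOn {q : ℝ} (hq : 0 < q) (ν : ℂ) :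
    ContinuousOn (fun p => besselInt p q ν) (Ioi 0) := by
  intro p hp
  have hp : 0 < p := hp
  refine ContinuousAt.continuousWithinAt ?_
  refine continuousAt_of_dominated (bound := besselMajorant (p / 2) q |ν.re|) ?_ ?_
    (besselMajorant_integrable (half_pos hp) hq _) ?_
  · filter_upwards [lt_mem_nhds hp] with p' hp'
    exact (besselInt_convergent hp' hq ν).aestronglyMeasurable
  · filter_upwards [lt_mem_nhds (half_lt_self hp)] with p' hp'
    filter_upwards [ae_restrict_mem measurableSet_Ioi] with r hr
    refine (norm_besselIntegrand_le (half_pos hp) hq hp'.le le_rfl le_rfl hr).trans ?_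
    refine mul_le_of_le_one_left (besselMajorant_nonneg _ _ _ hr) ?_
    rw [Real.exp_le_one_iff]
    have := Real.sqrt_nonneg (p' * q)
    nlinarith [Real.pi_pos]
  · filter_upwards with r
    fun_prop

/-- The substitution `r = (Q / P) t` makes the exponent symmetric, namely `-πPQ (t + 1/t)`. -/
lemma besselInt_sq {P Q : ℝ} (hP : 0 < P) (hQ : 0 < Q) (ν : ℂ) :
    besselInt (P ^ 2) (Q ^ 2) ν =
      2 * ((Q / P : ℝ) : ℂ) ^ ν * besselK ν (2 * Real.pi * (P * Q)) := by
  have h := mellin_comp_mul_left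
    (fun r : ℝ => (Real.exp (-Real.pi * (P ^ 2 * r + Q ^ 2 / r)) : ℂ)) ν (div_pos hQ hP)
  have h0 : ((Q / P : ℝ) : ℂ) ≠ 0 := by exact_mod_cast (div_pos hQ hP).ne'
  have h1 : mellin (fun t : ℝ => (Real.exp (-Real.pi * (P ^ 2 * (Q / P * t) +
      Q ^ 2 / (Q / P * t))) : ℂ)) ν = 2 * besselK ν (2 * Real.pi * (P * Q)) := by
    rw [mellin, besselK, ← mul_assoc]
    norm_num
    refine setIntegral_congr_fun measurableSet_Ioi fun r hr => ?_
    have hr : 0 < r := hr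
    have e1 : -Real.pi * (P ^ 2 * (Q / P * r) + Q ^ 2 / (Q / P * r)) =
        -(2 * Real.pi * (P * Q) / 2) * (r + r⁻¹) := by
      field_simp
    have e2 := congrArg Complex.ofReal e1
    push_cast at e2
    simp only [neg_mul] at e2
    rw [e2, mul_comm]
  rw [h1, Complex.cpow_neg, smul_eq_mul, eq_inv_mul_iff_mul_eq₀ (fun hc => h0 (Complex.cpow_eq_zero_iff _ _ |>.mp hc).1)] at h
  rw [besselInt, ← h]
  ring

/-! ### Quadratic forms in unipotent-diagonal coordinates -/

/-- An integral vector, regarded as a real vector. -/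
def toReal {k : ℕ} (a : Fin k → ℤ) : Fin k → ℝ := fun i => (a i : ℝ)

/-- Nonzero integral vectors. -/
abbrev NZ (k : ℕ) := {a : Fin k → ℤ // a ≠ 0}

/-- Nonzero integers. -/
abbrev NZInt := {m : ℤ // m ≠ 0}

/-- The pairing of a vector with the part of the column `k + 1` of `x` above the diagonal. -/
def colDot (x : ℕ → ℕ → ℝ) (k : ℕ) (v : Fin k → ℝ) : ℝ := ∑ i : Fin k, v i * x (i + 1) (k + 1)

/-- The quadratic form `v ↦ ‖v u d‖²` with `u = unip k x` and `d = diag (c 0, …, c (k - 1))`. -/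
def quadForm (x : ℕ → ℕ → ℝ) (c : ℕ → ℝ) (k : ℕ) (v : Fin k → ℝ) : ℝ :=
  ∑ j, ((v ᵥ* unip k x) j * c j) ^ 2

lemma toReal_injective {k : ℕ} : Function.Injective (toReal (k := k)) := fun a b h => by
  funext i
  simpa [toReal] using congrFun h i

@[simp] lemma toReal_zero {k : ℕ} : toReal (0 : Fin k → ℤ) = 0 := by
  funext i; simp [toReal]

lemma toReal_ne_zero {k : ℕ} {a : Fin k → ℤ} (ha : a ≠ 0) : toReal a ≠ 0 := fun h =>
  ha (toReal_injective (h.trans toReal_zero.symm))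

lemma toReal_snoc {k : ℕ} (a : Fin k → ℤ) (t : ℤ) :
    toReal (Fin.snoc a t : Fin (k + 1) → ℤ) = (Fin.snoc (toReal a) (t : ℝ) : Fin (k + 1) → ℝ) := by
  funext i
  refine Fin.lastCases ?_ (fun j => ?_) i <;> simp [toReal]

lemma one_le_norm_toReal {k : ℕ} {a : Fin k → ℤ} (ha : a ≠ 0) : 1 ≤ ‖toReal a‖ := by
  obtain ⟨i, hi⟩ := Function.ne_iff.mp ha
  refine le_trans ?_ (norm_le_pi_norm (toReal a) i)
  rw [toReal, Real.norm_eq_abs, ← Int.cast_abs]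
  exact_mod_cast Int.one_le_abs hi

lemma vecMul_unip_snoc_castSucc (x : ℕ → ℕ → ℝ) {k : ℕ} (v : Fin k → ℝ) (t : ℝ) (j : Fin k) :
    ((Fin.snoc v t : Fin (k + 1) → ℝ) ᵥ* unip (k + 1) x) j.castSucc = (v ᵥ* unip k x) j := by
  simp only [Matrix.vecMul, dotProduct, Fin.sum_univ_castSucc]
  have h : unip (k + 1) x (Fin.last k) j.castSucc = 0 := by
    simp only [unip, Matrix.of_apply]
    rw [if_neg (by simp [Fin.le_last]), if_neg (Fin.castSucc_lt_last j).ne']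
  rw [h, mul_zero, add_zero]
  simp [unip]

lemma vecMul_unip_snoc_last (x : ℕ → ℕ → ℝ) {k : ℕ} (v : Fin k → ℝ) (t : ℝ) :
    ((Fin.snoc v t : Fin (k + 1) → ℝ) ᵥ* unip (k + 1) x) (Fin.last k) = t + colDot x k v := by
  simp only [Matrix.vecMul, dotProduct, Fin.sum_univ_castSucc]
  simp [unip, colDot, add_comm, Fin.castSucc_lt_last]

/-- The unipotent matrix is upper triangular, so the last variable enters one square only. All
inductions on the dimension rest on this, and it brings the form into the shape needed for Poisson
summation. -/
lemma quadForm_snoc (x : ℕ → ℕ → ℝ) (c : ℕ → ℝ) {k : ℕ} (v : Fin k → ℝ) (t : ℝ) :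
    quadForm x c (k + 1) (Fin.snoc v t) =
      quadForm x c k v + c k ^ 2 * (t + colDot x k v) ^ 2 := by
  simp only [quadForm, Fin.sum_univ_castSucc, vecMul_unip_snoc_castSucc, vecMul_unip_snoc_last]
  simp; ring

lemma quadForm_nonneg (x : ℕ → ℕ → ℝ) (c : ℕ → ℝ) {k : ℕ} (v : Fin k → ℝ) :
    0 ≤ quadForm x c k v := Finset.sum_nonneg fun _ _ => sq_nonneg _

@[simp] lemma quadForm_zero (x : ℕ → ℕ → ℝ) (c : ℕ → ℝ) (k : ℕ) : quadForm x c k 0 = 0 := by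
  simp [quadForm]

@[simp] lemma colDot_zero (x : ℕ → ℕ → ℝ) (k : ℕ) : colDot x k 0 = 0 := by
  simp [colDot]

lemma quadForm_smul (x : ℕ → ℕ → ℝ) (c : ℕ → ℝ) {k : ℕ} (t : ℝ) (v : Fin k → ℝ) :
    quadForm x c k (t • v) = t ^ 2 * quadForm x c k v := by
  simp only [quadForm, Finset.mul_sum, Matrix.smul_vecMul, Pi.smul_apply, smul_eq_mul]
  exact Finset.sum_congr rfl fun _ _ => by ring

lemma quadForm_pos (x : ℕ → ℕ → ℝ) {c : ℕ → ℝ} {k : ℕ} (hc : ∀ j < k, 0 < c j)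
    {v : Fin k → ℝ} (hv : v ≠ 0) : 0 < quadForm x c k v := by
  induction k with
  | zero => exact absurd (Subsingleton.elim v 0) hv
  | succ k ih =>
    obtain ⟨a, t, rfl⟩ : ∃ (a : Fin k → ℝ) (t : ℝ), (Fin.snoc a t : Fin (k + 1) → ℝ) = v :=
      ⟨Fin.init v, v (Fin.last k), Fin.snoc_init_self v⟩
    rw [quadForm_snoc]
    by_cases ha : a = 0
    · subst ha
      have ht : t ≠ 0 := by
        rintro rfl
        refine hv ?_
        funext i
        refine Fin.lastCases ?_ (fun j => ?_) i <;> simp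
      have := hc k (Nat.lt_succ_self k)
      simp
      positivity
    · have := ih (fun j hj => hc j (hj.trans (Nat.lt_succ_self k))) ha
      positivity

lemma continuous_colDot (k : ℕ) (v : Fin k → ℝ) : Continuous fun x => colDot x k v := by
  unfold colDot
  fun_prop

lemma continuous_quadForm_uncurry (c : ℕ → ℝ) (k : ℕ) :
    Continuous fun p : (ℕ → ℕ → ℝ) × (Fin k → ℝ) => quadForm p.1 c k p.2 := by
  unfold quadForm
  refine continuous_finsetSum _ fun j _ => (Continuous.mul ?_ continuous_const).pow 2
  simp only [Matrix.vecMul, dotProduct]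
  refine continuous_finsetSum _ fun i _ => Continuous.mul (by fun_prop) ?_
  simp only [unip, Matrix.of_apply]
  split_ifs <;> fun_prop

lemma continuous_quadForm (c : ℕ → ℝ) (k : ℕ) (v : Fin k → ℝ) :
    Continuous fun x => quadForm x c k v := by
  have h : Continuous fun x : ℕ → ℕ → ℝ => (x, v) := by fun_prop
  have h' := (continuous_quadForm_uncurry c k).comp h
  simpa only [Function.comp_def] using h'

/-- A positive lower bound for the quadratic forms, uniform for `x` in a compact set. -/
lemma exists_le_quadForm {K : Set (ℕ → ℕ → ℝ)} (hK : IsCompact K) {c : ℕ → ℝ} {k : ℕ}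
    (hc : ∀ j < k, 0 < c j) :
    ∃ δ > 0, ∀ x ∈ K, ∀ v : Fin k → ℝ, δ * ‖v‖ ^ 2 ≤ quadForm x c k v := by
  -- The product is empty if `K` is empty or `k = 0`. Otherwise the form attains its minimum on it,
  -- and homogeneity of degree two carries the bound to all `v`.
  rcases (K ×ˢ Metric.sphere (0 : Fin k → ℝ) 1).eq_empty_or_nonempty with h | h
  · refine ⟨1, one_pos, fun x hx v => ?_⟩
    by_cases hv : v = 0
    · simp [hv]
    · have : (x, ‖v‖⁻¹ • v) ∈ K ×ˢ Metric.sphere (0 : Fin k → ℝ) 1 := by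
        refine ⟨hx, ?_⟩
        simp [norm_smul, hv]
      simp [h] at this
  · obtain ⟨⟨x₀, v₀⟩, ⟨_, hv₀⟩, hmin⟩ :=
      IsCompact.exists_isMinOn (hK.prod (isCompact_sphere (0 : Fin k → ℝ) 1)) h
        (continuous_quadForm_uncurry c k).continuousOn
    have hv0 : v₀ ≠ 0 := by
      rintro rfl
      simp at hv₀
    refine ⟨quadForm x₀ c k v₀, quadForm_pos x₀ hc hv0, fun x hx v => ?_⟩
    by_cases hv : v = 0
    · simp [hv]
    · have h1 : (x, ‖v‖⁻¹ • v) ∈ K ×ˢ Metric.sphere (0 : Fin k → ℝ) 1 := by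
        refine ⟨hx, ?_⟩
        simp [norm_smul, hv]
      have h2 : quadForm x₀ c k v₀ ≤ quadForm x c k (‖v‖⁻¹ • v) :=
        isMinOn_iff.mp hmin (x, ‖v‖⁻¹ • v) h1
      rw [quadForm_smul] at h2
      have h3 : 0 < ‖v‖ := norm_pos_iff.mpr hv
      calc _ ≤ ‖v‖⁻¹ ^ 2 * quadForm x c k v * ‖v‖ ^ 2 := by gcongr
        _ = _ := by field_simp

/-! ### Convergence of lattice sums and Bessel sums -/

lemma summable_norm_toReal_rpow (k : ℕ) {σ : ℝ} (hσ : k < σ) :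
    Summable fun a : Fin k → ℤ => ‖toReal a‖ ^ (-σ) := by
  set L := Submodule.span ℤ (Set.range (Pi.basisFun ℝ (Fin k))) with hL
  have hrank : Module.finrank ℤ L = k := by
    rw [ZLattice.rank ℝ L]
    simp
  have h := ZLattice.summable_norm_rpow L (-σ) (by rw [hrank]; linarith)
  have hmem (a : Fin k → ℤ) : toReal a ∈ L := by
    rw [hL, Module.Basis.mem_span_iff_repr_mem]
    intro i
    exact ⟨a i, by simp [toReal]⟩
  exact h.comp_injective (i := fun a => (⟨toReal a, hmem a⟩ : L)) fun a b hab =>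
    toReal_injective (congrArg Subtype.val hab)

lemma summable_exp_neg_norm (k : ℕ) {κ : ℝ} (hκ : 0 < κ) :
    Summable fun p : NZ k × NZInt =>
      Real.exp (-(κ * (‖toReal p.1.1‖ * |(p.2.1 : ℝ)|))) := by
  -- This exponent exceeds both `k` and `1`, so that `∑ ‖a‖^(-N)` and `∑ |m|^(-N)` converge; the
  -- exponential is then estimated by `exp(-T) ≤ N! / T^N`.
  set N := k + 2
  have h1 : Summable fun a : NZ k => ‖toReal a.1‖ ^ (-(N : ℝ)) :=
    (summable_norm_toReal_rpow k (by simp [N])).comp_injective Subtype.val_injective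
  have h2 : Summable fun m : NZInt => |(m.1 : ℝ)| ^ (-(N : ℝ)) :=
    (Real.summable_abs_int_rpow (b := N) (by simp only [N]; push_cast; linarith)).comp_injective
      Subtype.val_injective
  have h3 := (h1.mul_of_nonneg h2 (fun _ => by positivity) (fun _ => by positivity)).mul_left
    (N.factorial / κ ^ N : ℝ)
  refine h3.of_nonneg_of_le (fun _ => (Real.exp_pos _).le) fun ⟨⟨a, ha⟩, ⟨m, hm⟩⟩ => ?_
  have ha' : 0 < ‖toReal a‖ := norm_pos_iff.mpr (toReal_ne_zero ha)
  have hm' : 0 < |(m : ℝ)| := abs_pos.mpr (by exact_mod_cast hm)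
  have := Real.pow_div_factorial_le_exp (κ * (‖toReal a‖ * |(m : ℝ)|)) (by positivity) N
  rw [Real.exp_neg]
  simp only [Real.rpow_neg (norm_nonneg _), Real.rpow_neg (abs_nonneg _), Real.rpow_natCast]
  refine (inv_anti₀ (by positivity) this).trans (le_of_eq ?_)
  rw [mul_pow, mul_pow]
  field_simp

/-- The term of index `(a, m)` of the sum of Bessel functions attached to the column `k + 1`. -/
def besselTerm (x : ℕ → ℕ → ℝ) (c : ℕ → ℝ) (k : ℕ) (ν : ℂ) (a : Fin k → ℤ) (m : ℤ) : ℂ :=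
  e (m * colDot x k (toReal a)) *
    ((c k : ℂ)⁻¹ * besselInt (quadForm x c k (toReal a)) ((m / c k) ^ 2) ν)

/-- The sum of Bessel functions attached to the column `k + 1`. -/
def besselSum (x : ℕ → ℕ → ℝ) (c : ℕ → ℝ) (k : ℕ) (ν : ℂ) : ℂ :=
  ∑' p : NZ k × NZInt, besselTerm x c k ν p.1 p.2

lemma norm_e (t : ℝ) : ‖e t‖ = 1 := by
  rw [e, show 2 * (Real.pi : ℂ) * Complex.I * t = ((2 * Real.pi * t : ℝ) : ℂ) * Complex.I by
    push_cast; ring, Complex.norm_exp_ofReal_mul_I]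

@[simp] lemma e_zero : e 0 = 1 := by simp [e]

lemma e_add (s t : ℝ) : e (s + t) = e s * e t := by
  simp only [e, ← Complex.exp_add]
  push_cast
  ring_nf

@[simp] lemma e_intCast (m : ℤ) : e m = 1 := by
  rw [e, show 2 * (Real.pi : ℂ) * Complex.I * ((m : ℝ) : ℂ) = m * (2 * Real.pi * Complex.I) by
    push_cast; ring, Complex.exp_int_mul_two_pi_mul_I]

lemma continuous_e : Continuous e := by
  unfold e
  fun_prop

/-- Lower bounds for the arguments of the Bessel functions. -/
lemma exists_besselArg_bound {K : Set (ℕ → ℕ → ℝ)} (hK : IsCompact K) {c : ℕ → ℝ} {k : ℕ}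
    (hc : ∀ j ≤ k, 0 < c j) :
    ∃ p₀ > 0, ∃ q₀ > 0, ∃ κ > 0, ∀ x ∈ K, ∀ a : Fin k → ℤ, a ≠ 0 → ∀ m : ℤ, m ≠ 0 →
      p₀ ≤ quadForm x c k (toReal a) ∧ q₀ ≤ ((m : ℝ) / c k) ^ 2 ∧
      Real.exp (-Real.pi * √(quadForm x c k (toReal a) * (m / c k) ^ 2)) ≤
        Real.exp (-(κ * (‖toReal a‖ * |(m : ℝ)|))) := by
  obtain ⟨δ, hδ, h⟩ := exists_le_quadForm hK (c := c) (k := k) fun j hj => hc j hj.le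
  have hck := hc k le_rfl
  refine ⟨δ, hδ, (1 / c k) ^ 2, by positivity, Real.pi * (√δ / c k), by positivity,
    fun x hx a ha m hm => ⟨?_, ?_, ?_⟩⟩
  · refine le_trans ?_ (h x hx _)
    have := one_le_norm_toReal ha
    nlinarith [mul_le_mul this this zero_le_one (by positivity)]
  · have : (1 : ℝ) ≤ |(m : ℝ)| := by
      rw [← Int.cast_abs]
      exact_mod_cast Int.one_le_abs hm
    rw [div_pow, div_pow, ← sq_abs (m : ℝ)]
    gcongr
  · rw [Real.exp_le_exp, neg_mul, neg_le_neg_iff, mul_assoc]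
    refine mul_le_mul_of_nonneg_left ?_ Real.pi_pos.le
    refine Real.le_sqrt_of_sq_le ?_
    calc _ = (δ * ‖toReal a‖ ^ 2) * (m / c k) ^ 2 := by
          rw [mul_pow, mul_pow, div_pow, div_pow, sq_abs, Real.sq_sqrt hδ.le]
          ring
      _ ≤ _ := by gcongr; exact h x hx _

/-- A summable bound for the terms of the Bessel sums, uniform for `x` in a compact set and `ν` in
a vertical strip. -/
lemma exists_besselTerm_bound {K : Set (ℕ → ℕ → ℝ)} (hK : IsCompact K) {c : ℕ → ℝ} {k : ℕ}
    (hc : ∀ j ≤ k, 0 < c j) (R : ℝ) :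
    ∃ b : NZ k × NZInt → ℝ, Summable b ∧ ∀ x ∈ K, ∀ ν : ℂ, |ν.re| ≤ R →
      ∀ p : NZ k × NZInt, ‖besselTerm x c k ν p.1 p.2‖ ≤ b p := by
  obtain ⟨p₀, hp₀, q₀, hq₀, κ, hκ, h⟩ := exists_besselArg_bound hK hc
  refine ⟨_, ((summable_exp_neg_norm k hκ).mul_right (besselBound p₀ q₀ R)).mul_left (c k)⁻¹,
    fun x hx ν hν p => ?_⟩
  obtain ⟨h1, h2, h3⟩ := h x hx p.1.1 p.1.2 p.2.1 p.2.2
  have hck := hc k le_rfl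
  rw [besselTerm, norm_mul, norm_e, one_mul, norm_mul, norm_inv, Complex.norm_real,
    Real.norm_of_nonneg hck.le]
  gcongr
  exact (norm_besselInt_le hp₀ hq₀ h1 h2 hν).trans
    (mul_le_mul_of_nonneg_right h3 (besselBound_nonneg _ _ _))

lemma summable_besselTerm (x : ℕ → ℕ → ℝ) {c : ℕ → ℝ} {k : ℕ} (hc : ∀ j ≤ k, 0 < c j) (ν : ℂ) :
    Summable fun p : NZ k × NZInt => besselTerm x c k ν p.1 p.2 := by
  obtain ⟨b, hb, h⟩ := exists_besselTerm_bound (isCompact_singleton (x := x)) hc |ν.re|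
  exact hb.of_norm_bounded fun p => h x rfl ν le_rfl p

/-- The convergence is uniform on vertical strips. Hence the Bessel sums contribute no poles to the
Eisenstein series. -/
lemma differentiable_besselSum (x : ℕ → ℕ → ℝ) {c : ℕ → ℝ} {k : ℕ} (hc : ∀ j ≤ k, 0 < c j) :
    Differentiable ℂ (besselSum x c k) := by
  intro ν₀
  obtain ⟨b, hb, h⟩ := exists_besselTerm_bound (isCompact_singleton (x := x)) hc (|ν₀.re| + 1)
  have hopen : IsOpen {ν : ℂ | |ν.re| < |ν₀.re| + 1} :=
    isOpen_lt (by fun_prop) continuous_const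
  refine DifferentiableOn.differentiableAt (s := {ν : ℂ | |ν.re| < |ν₀.re| + 1}) ?_
    (hopen.mem_nhds (by simp))
  refine Complex.differentiableOn_tsum_of_summable_norm hb (fun p => ?_) hopen
    fun p ν hν => h x rfl ν (le_of_lt hν) p
  have hck := hc k le_rfl
  have hm : (p.2.1 : ℝ) ≠ 0 := by exact_mod_cast p.2.2
  exact (((besselInt_differentiable
    (quadForm_pos x (fun j hj => hc j hj.le) (toReal_ne_zero p.1.2))
    (by positivity)).const_mul _).const_mul _).differentiableOn

lemma continuous_besselTerm {c : ℕ → ℝ} {k : ℕ} (hc : ∀ j ≤ k, 0 < c j) (ν : ℂ)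
    (p : NZ k × NZInt) : Continuous fun x => besselTerm x c k ν p.1 p.2 := by
  have hck := hc k le_rfl
  have hm : (p.2.1 : ℝ) ≠ 0 := by exact_mod_cast p.2.2
  refine (continuous_e.comp (continuous_const.mul (continuous_colDot k _))).mul
    (continuous_const.mul ?_)
  exact (besselInt_continuousOn (by positivity) ν).comp_continuous (continuous_quadForm c k _)
    fun x => quadForm_pos x (fun j hj => hc j hj.le) (toReal_ne_zero p.1.2)

lemma continuousOn_besselSum {K : Set (ℕ → ℕ → ℝ)} (hK : IsCompact K) {c : ℕ → ℝ} {k : ℕ}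
    (hc : ∀ j ≤ k, 0 < c j) (ν : ℂ) : ContinuousOn (fun x => besselSum x c k ν) K := by
  obtain ⟨b, hb, h⟩ := exists_besselTerm_bound hK hc |ν.re|
  exact continuousOn_tsum (fun p => (continuous_besselTerm hc ν p).continuousOn) hb
    fun p x hx => h x hx ν le_rfl p

/-! ### Poisson summation and the expansion of the Epstein zeta function -/

lemma gammaIntegrand_integrable {X : ℝ} (hX : 0 < X) {w : ℂ} (hw : 0 < w.re) :
    IntegrableOn (fun r : ℝ => (r : ℂ) ^ (w / 2 - 1) * (Real.exp (-Real.pi * (X * r)) : ℂ))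
      (Ioi 0) := by
  have h := integrableOn_rpow_mul_exp_neg_mul_rpow (p := 1) (s := (w / 2 - 1).re)
    (b := Real.pi * X) (by simp [hw]) one_pos (by positivity)
  refine Integrable.mono' h ?_ ?_
  · refine ContinuousOn.aestronglyMeasurable (fun r hr => ?_) measurableSet_Ioi
    have hr : 0 < r := hr
    refine ContinuousAt.continuousWithinAt (ContinuousAt.mul ?_ (by fun_prop))
    exact Complex.continuous_ofReal.continuousAt.cpow continuousAt_const (by simp [hr])
  · filter_upwards [ae_restrict_mem measurableSet_Ioi] with r hr
    have hr : 0 < r := hr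
    rw [norm_mul, Complex.norm_cpow_eq_rpow_re_of_pos hr, Complex.norm_real,
      Real.norm_of_nonneg (Real.exp_pos _).le, Real.rpow_one]
    ring_nf
    rfl

/-- Writes a power of the quadratic form as a Mellin integral of a Gaussian, so that a sum of powers
becomes the integral of a theta function. -/
lemma integral_gamma {X : ℝ} (hX : 0 < X) {w : ℂ} (hw : 0 < w.re) :
    ∫ r in Ioi (0 : ℝ), (r : ℂ) ^ (w / 2 - 1) * (Real.exp (-Real.pi * (X * r)) : ℂ) =
      Complex.Gammaℝ w * (X : ℂ) ^ (-w / 2) := by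
  have h := Complex.integral_cpow_mul_exp_neg_mul_Ioi (a := w / 2) (r := Real.pi * X)
    (by simp [hw]) (by positivity)
  push_cast at h
  have e1 : (1 / ((Real.pi : ℂ) * X)) ^ (w / 2) = (Real.pi : ℂ) ^ (-w / 2) * (X : ℂ) ^ (-w / 2) := by
    rw [← Complex.mul_cpow_ofReal_nonneg Real.pi_pos.le hX.le, one_div, neg_div, Complex.cpow_neg,
      Complex.inv_cpow]
    rw [← Complex.ofReal_mul, Complex.arg_ofReal_of_nonneg (by positivity)]
    exact Real.pi_pos.ne
  rw [Complex.Gammaℝ_def, mul_right_comm, ← e1, ← h]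
  refine setIntegral_congr_fun measurableSet_Ioi fun r _ => ?_
  push_cast
  ring_nf

lemma integral_norm_gamma {X : ℝ} (hX : 0 < X) {w : ℂ} (hw : 0 < w.re) :
    ∫ r in Ioi (0 : ℝ), ‖(r : ℂ) ^ (w / 2 - 1) * (Real.exp (-Real.pi * (X * r)) : ℂ)‖ =
      (1 / Real.pi) ^ (w.re / 2) * Real.Gamma (w.re / 2) * X ^ (-(w.re / 2)) := by
  have h := Real.integral_rpow_mul_exp_neg_mul_Ioi (a := w.re / 2) (r := Real.pi * X)
    (by simp [hw]) (by positivity)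
  rw [one_div, mul_inv, Real.mul_rpow (by positivity) (by positivity), Real.inv_rpow hX.le,
    ← Real.rpow_neg hX.le] at h
  rw [one_div, mul_right_comm, ← h]
  refine setIntegral_congr_fun measurableSet_Ioi fun r hr => ?_
  have hr : 0 < r := hr
  rw [norm_mul, Complex.norm_cpow_eq_rpow_re_of_pos hr, Complex.norm_real,
    Real.norm_of_nonneg (Real.exp_pos _).le, show (w / 2 - 1).re = w.re / 2 - 1 by simp]
  ring_nf

/-- The transformation formula of the theta function with a shift. -/
lemma theta_shift {s : ℝ} (hs : 0 < s) (β : ℝ) :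
    ∑' t : ℤ, (Real.exp (-Real.pi * (s * (t + β) ^ 2)) : ℂ) =
      ((√s : ℝ) : ℂ)⁻¹ * ∑' m : ℤ, e (m * β) * (Real.exp (-Real.pi * (m ^ 2 / s)) : ℂ) := by
  -- With `a = 1 / s` and `b = iβ` the Gaussians are centred at `β`; reflecting `n ↦ -n` moves the
  -- centre to `-β`.
  have h := Complex.tsum_exp_neg_quadratic (a := ((1 / s : ℝ) : ℂ))
    (by simpa using hs) (Complex.I * β)
  have h1 : (((1 / s : ℝ) : ℂ)) ^ (1 / 2 : ℂ) = ((√s : ℝ) : ℂ)⁻¹ := by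
    rw [show (1 / 2 : ℂ) = ((1 / 2 : ℝ) : ℂ) by push_cast; ring, ← Complex.ofReal_cpow (by positivity),
      ← Real.sqrt_eq_rpow, one_div, Real.sqrt_inv, Complex.ofReal_inv]
  have hs0 : (s : ℂ) ≠ 0 := by exact_mod_cast hs.ne'
  have hs' : ((√s : ℝ) : ℂ) ≠ 0 := by exact_mod_cast (Real.sqrt_pos.mpr hs).ne'
  rw [h1, one_div (((√s : ℝ) : ℂ)⁻¹), inv_inv, ← inv_mul_eq_iff_eq_mul₀ hs', ← (Equiv.neg ℤ).tsum_eq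
    (fun n : ℤ => Complex.exp (-(Real.pi : ℂ) / _ * ((n : ℂ) + _) ^ 2))] at h
  convert! h.symm using 1
  · refine tsum_congr fun t => ?_
    rw [Complex.ofReal_exp]
    congr 1
    push_cast [Equiv.neg_apply]
    rw [← mul_assoc Complex.I, Complex.I_mul_I]
    field_simp
    ring
  · congr 1
    refine tsum_congr fun m => ?_
    rw [e, Complex.ofReal_exp, ← Complex.exp_add]
    congr 1
    push_cast
    ring

lemma tsum_eq_add_tsum_ne {α : Type*} {f : α → ℂ} (hf : Summable f) (a₀ : α) :
    ∑' a, f a = f a₀ + ∑' a : {a // a ≠ a₀}, f a := by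
  rw [← hf.tsum_subtype_add_tsum_subtype_compl {a₀}, tsum_singleton]
  rfl

lemma summable_of_summable_ne {α : Type*} {f : α → ℝ} (a₀ : α)
    (hf : Summable fun a : {a // a ≠ a₀} => f a) : Summable f := by
  classical
  refine (Finset.summable_compl_iff {a₀}).mp ?_
  refine (Equiv.summable_iff (Equiv.subtypeEquivRight (p := fun a => a ∉ ({a₀} : Finset α))
    (q := fun a => a ≠ a₀) (by simp))).mpr hf

lemma summable_exp_neg_abs {κ : ℝ} (hκ : 0 < κ) :
    Summable fun m : NZInt => Real.exp (-(κ * |(m.1 : ℝ)|)) := by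
  have h1 : (1 : Fin 1 → ℤ) ≠ 0 := one_ne_zero
  refine ((summable_exp_neg_norm 1 hκ).prod_factor ⟨1, h1⟩).congr fun m => ?_
  have : ‖toReal (1 : Fin 1 → ℤ)‖ = 1 := by
    rw [show toReal (1 : Fin 1 → ℤ) = fun _ => (1 : ℝ) by funext; simp [toReal]]
    simp
  simp [this]

/-- The Poisson summation formula for `t ↦ (p + c² (t + β)²) ^ (-w / 2)`. -/
lemma poisson_epstein {p c : ℝ} (hp : 0 < p) (hc : 0 < c) (β : ℝ) {w : ℂ} (hw : 1 < w.re)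
    (hsum : Summable fun t : ℤ => (p + c ^ 2 * (t + β) ^ 2) ^ (-(w.re / 2))) :
    ∑' t : ℤ, Complex.Gammaℝ w * ((p + c ^ 2 * (t + β) ^ 2 : ℝ) : ℂ) ^ (-w / 2) =
      (c : ℂ)⁻¹ * (Complex.Gammaℝ (w - 1) * (p : ℂ) ^ (-(w - 1) / 2)) +
        ∑' m : NZInt, e (m * β) * ((c : ℂ)⁻¹ * besselInt p ((m / c) ^ 2) ((w - 1) / 2)) := by
  have hw0 : 0 < w.re := by linarith
  have hw1 : 0 < (w - 1).re := by simpa using hw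
  have hX (t : ℤ) : 0 < p + c ^ 2 * (t + β) ^ 2 := by positivity
  set F : ℤ → ℝ → ℂ := fun t r =>
    (r : ℂ) ^ (w / 2 - 1) * (Real.exp (-Real.pi * ((p + c ^ 2 * (t + β) ^ 2) * r)) : ℂ) with hF
  set H : ℤ → ℝ → ℂ := fun m r =>
    e (m * β) * ((c : ℂ)⁻¹ * ((r : ℂ) ^ ((w - 1) / 2 - 1) •
      (Real.exp (-Real.pi * (p * r + (m / c) ^ 2 / r)) : ℂ))) with hH
  have hFs := hasSum_integral_of_summable_integral_norm (μ := volume.restrict (Ioi 0)) (F := F)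
    (fun t => gammaIntegrand_integrable (hX t) hw0)
    (by simp only [hF, integral_norm_gamma (hX _) hw0]; exact hsum.mul_left _)
  -- The zero frequency has no factor `exp(-πq/r)`: it is a Gamma integral at `w - 1`, convergent
  -- since `Re w > 1`, and not a Bessel integral.
  have hH0 : ∀ r : ℝ, H 0 r = (c : ℂ)⁻¹ * ((r : ℂ) ^ ((w - 1) / 2 - 1) *
      (Real.exp (-Real.pi * (p * r)) : ℂ)) := by
    intro r
    simp [hH]
  have hHint (m : ℤ) : Integrable (H m) (volume.restrict (Ioi 0)) := by
    by_cases hm : m = 0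
    · subst hm
      rw [show H 0 = _ from funext hH0]
      exact (gammaIntegrand_integrable hp hw1).const_mul _
    · have hm' : (m : ℝ) ≠ 0 := by exact_mod_cast hm
      exact ((besselInt_convergent hp (by positivity : 0 < ((m : ℝ) / c) ^ 2) _).const_mul _).const_mul _
  have hHsum : Summable fun m : ℤ => ∫ r in Ioi (0 : ℝ), ‖H m r‖ := by
    refine summable_of_summable_ne 0 ?_
    set R := |((w - 1) / 2).re|
    refine Summable.of_nonneg_of_le (fun _ => integral_nonneg fun _ => norm_nonneg _) (fun m => ?_)
      (((summable_exp_neg_abs (κ := Real.pi * (√p / c)) (by positivity)).mul_right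
        (besselBound p ((1 / c) ^ 2) R)).mul_left c⁻¹)
    have hm1 : (1 : ℝ) ≤ |(m.1 : ℝ)| := by
      rw [← Int.cast_abs]
      exact_mod_cast Int.one_le_abs m.2
    have hq : (1 / c) ^ 2 ≤ ((m.1 : ℝ) / c) ^ 2 := by
      rw [div_pow, div_pow, ← sq_abs (m.1 : ℝ)]
      gcongr
    simp only [hH, norm_mul, norm_e, one_mul, norm_inv, Complex.norm_real, Real.norm_of_nonneg hc.le,
      integral_const_mul]
    refine mul_le_mul_of_nonneg_left ?_ (by positivity)
    refine (integral_norm_besselIntegrand_le hp (by positivity) le_rfl hq le_rfl).trans (le_of_eq ?_)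
    congr 2
    rw [Real.sqrt_mul hp.le, Real.sqrt_sq_eq_abs, abs_div, abs_of_pos hc]
    ring
  have hHs := hasSum_integral_of_summable_integral_norm hHint hHsum
  -- Under the integral sign this is the theta transformation with parameter `c² r`; the factor `(c²
  -- r)^(-1/2)` provides `c⁻¹` and lowers the exponent `w/2 - 1` to `(w - 1)/2 - 1`.
  have hFH : ∫ r in Ioi (0 : ℝ), ∑' t, F t r = ∫ r in Ioi (0 : ℝ), ∑' m, H m r := by
    refine setIntegral_congr_fun measurableSet_Ioi fun r hr => ?_
    have hr : 0 < r := hr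
    have hr0 : (r : ℂ) ≠ 0 := by exact_mod_cast hr.ne'
    have h1 (t : ℤ) : F t r = (r : ℂ) ^ (w / 2 - 1) * (Real.exp (-Real.pi * (p * r)) : ℂ) *
        (Real.exp (-Real.pi * ((c ^ 2 * r) * (t + β) ^ 2)) : ℂ) := by
      rw [mul_assoc, ← Complex.ofReal_mul, ← Real.exp_add]
      simp only [hF]
      ring_nf
    have h3 : ((√(c ^ 2 * r) : ℝ) : ℂ)⁻¹ = (c : ℂ)⁻¹ * (r : ℂ) ^ (-(1 / 2) : ℂ) := by
      rw [Real.sqrt_mul (by positivity), Real.sqrt_sq hc.le, Real.sqrt_eq_rpow, Complex.ofReal_mul,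
        Complex.ofReal_cpow hr.le, mul_inv, Complex.cpow_neg]
      push_cast
      rfl
    simp only [h1]
    rw [tsum_mul_left, theta_shift (by positivity), h3, ← tsum_mul_left, ← tsum_mul_left]
    refine tsum_congr fun m => ?_
    simp only [hH, smul_eq_mul]
    rw [show (w - 1) / 2 - 1 = (w / 2 - 1) + (-(1 / 2)) by ring, Complex.cpow_add _ _ hr0,
      show -Real.pi * (p * r + (m / c) ^ 2 / r) = -Real.pi * (p * r) +
        -Real.pi * (m ^ 2 / (c ^ 2 * r)) by rw [div_pow, div_div]; ring, Real.exp_add,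
      Complex.ofReal_mul]
    ring
  have e1 (t : ℤ) : Complex.Gammaℝ w * ((p + c ^ 2 * (t + β) ^ 2 : ℝ) : ℂ) ^ (-w / 2) =
      ∫ r in Ioi (0 : ℝ), F t r := (integral_gamma (hX t) hw0).symm
  simp only [e1]
  rw [hFs.tsum_eq, hFH, ← hHs.tsum_eq, tsum_eq_add_tsum_ne hHs.summable 0]
  congr 1
  · rw [show H 0 = _ from funext hH0, integral_const_mul, integral_gamma hp hw1]
  · refine tsum_congr fun m => ?_
    simp only [hH, integral_const_mul]
    rfl

lemma ofReal_sq_cpow {X : ℝ} (hX : 0 ≤ X) (w : ℂ) : ((X ^ 2 : ℝ) : ℂ) ^ w = (X : ℂ) ^ (2 * w) := by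
  rw [pow_two, Complex.ofReal_mul, Complex.mul_cpow_ofReal_nonneg hX hX]
  by_cases hX0 : X = 0
  · by_cases hw : w = 0 <;> simp [hX0, hw]
  · rw [two_mul, Complex.cpow_add _ _ (by exact_mod_cast hX0)]

/-- The completed zeta function as a sum over the integers. -/
lemma tsum_zeta {c : ℝ} (hc : 0 < c) {w : ℂ} (hw : 1 < w.re) :
    ∑' t : ℤ, Complex.Gammaℝ w * ((c ^ 2 * (t : ℝ) ^ 2 : ℝ) : ℂ) ^ (-w / 2) =
      2 * completedRiemannZeta w * (c : ℂ) ^ (-w) := by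
  have hw0 : w ≠ 0 := by
    rintro rfl
    simp at hw
    linarith
  have hterm (t : ℕ) : Complex.Gammaℝ w * ((c ^ 2 * (t : ℝ) ^ 2 : ℝ) : ℂ) ^ (-w / 2) =
      Complex.Gammaℝ w * (c : ℂ) ^ (-w) * (1 / (t : ℂ) ^ w) := by
    rw [← mul_pow, ofReal_sq_cpow (by positivity), Complex.ofReal_mul,
      Complex.mul_cpow_ofReal_nonneg hc.le (by positivity), mul_div_cancel₀ _ two_ne_zero,
      Complex.cpow_neg (_ : ℂ), Complex.cpow_neg (_ : ℂ)]
    push_cast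
    ring
  have hs : Summable fun t : ℕ => Complex.Gammaℝ w * (c : ℂ) ^ (-w) * (1 / (t : ℂ) ^ w) :=
    (Complex.summable_one_div_nat_cpow.mpr hw).mul_left _
  -- The integers `t` and `-t` give equal terms, whence the factor `2`; the term at `t = 0`
  -- vanishes, since a nonzero power of `0` is `0`.
  rw [Summable.tsum_of_nat_of_neg]
  · simp only [Int.cast_neg, Int.cast_natCast, neg_sq, hterm, Int.cast_zero]
    rw [tsum_mul_left, completedZeta_eq_tsum_of_one_lt_re hw, ← Complex.Gammaℝ_def]
    simp [hw0]
    ring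
  · simpa only [Int.cast_natCast, hterm] using hs
  · simpa only [Int.cast_neg, neg_sq, Int.cast_natCast, hterm] using hs

lemma summable_quadForm_rpow (x : ℕ → ℕ → ℝ) {c : ℕ → ℝ} {n : ℕ} (hc : ∀ j < n, 0 < c j)
    {σ : ℝ} (hσ : n < σ) :
    Summable fun v : Fin n → ℤ => quadForm x c n (toReal v) ^ (-(σ / 2)) := by
  obtain ⟨δ, hδ, h⟩ := exists_le_quadForm (isCompact_singleton (x := x)) hc
  have hσ0 : 0 < σ := (Nat.cast_nonneg n).trans_lt hσ
  refine Summable.of_nonneg_of_le (fun v => Real.rpow_nonneg (quadForm_nonneg _ _ _) _) (fun v => ?_)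
    ((summable_norm_toReal_rpow n hσ).mul_left (δ ^ (-(σ / 2))))
  by_cases hv : v = 0
  · rw [hv, toReal_zero, quadForm_zero, Real.zero_rpow (by linarith)]
    positivity
  · have hv' : 0 < ‖toReal v‖ := norm_pos_iff.mpr (toReal_ne_zero hv)
    have h1 := h x rfl (toReal v)
    calc _ ≤ (δ * ‖toReal v‖ ^ 2) ^ (-(σ / 2)) :=
          Real.rpow_le_rpow_of_nonpos (by positivity) h1 (by linarith)
      _ = _ := by
          rw [Real.mul_rpow hδ.le (by positivity), ← Real.rpow_natCast ‖toReal v‖ 2,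
            ← Real.rpow_mul hv'.le]
          congr 2
          push_cast
          ring

lemma norm_ofReal_cpow {X : ℝ} (hX : 0 ≤ X) {w : ℂ} (hw : w.re ≠ 0) :
    ‖(X : ℂ) ^ w‖ = X ^ w.re := by
  rcases hX.eq_or_lt with rfl | h
  · have : w ≠ 0 := by
      rintro rfl
      simp at hw
    simp [this, hw]
  · exact Complex.norm_cpow_eq_rpow_re_of_pos h w

lemma summable_quadForm_cpow (x : ℕ → ℕ → ℝ) {c : ℕ → ℝ} {n : ℕ} (hc : ∀ j < n, 0 < c j)
    {w : ℂ} (hw : n < w.re) :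
    Summable fun v : Fin n → ℤ => (quadForm x c n (toReal v) : ℂ) ^ (-w / 2) := by
  have hw0 : 0 < w.re := (Nat.cast_nonneg n).trans_lt hw
  refine Summable.of_norm ((summable_quadForm_rpow x hc hw).congr fun v => ?_)
  have h1 : (-w / 2).re = -(w.re / 2) := by simp [neg_div]
  rw [norm_ofReal_cpow (quadForm_nonneg _ _ _) (by rw [h1]; linarith), h1]

/-- The completed Epstein zeta function of `quadForm x c n`, given by its expansion of
Chowla-Selberg type. -/
def complEpstein (x : ℕ → ℕ → ℝ) (c : ℕ → ℝ) : ℕ → ℂ → ℂ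
  | 0, _ => 0
  | k + 1, w => 2 * completedRiemannZeta w * (c k : ℂ) ^ (-w) +
      (c k : ℂ)⁻¹ * complEpstein x c k (w - 1) + besselSum x c k ((w - 1) / 2)

/-- Induction on the dimension, writing vectors as `(a, t)`. The part `a = 0` is a zeta value. For
each `a ≠ 0`, Poisson summation in `t` gives a zero frequency, which sums over `a` to the same
function one dimension lower at `w - 1`, and Bessel terms. The condition `Re w > n` is preserved, as
both sides drop by one. -/
theorem tsum_quadForm_cpow (x : ℕ → ℕ → ℝ) {c : ℕ → ℝ} {n : ℕ} (hc : ∀ j < n, 0 < c j)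
    {w : ℂ} (hw : n < w.re) :
    ∑' v : NZ n, Complex.Gammaℝ w * (quadForm x c n (toReal v.1) : ℂ) ^ (-w / 2) =
      complEpstein x c n w := by
  induction n generalizing w with
  | zero =>
    have : IsEmpty (NZ 0) := ⟨fun a => a.2 (Subsingleton.elim _ _)⟩
    simp [complEpstein]
  | succ k ih =>
    have hck : 0 < c k := hc k (Nat.lt_succ_self k)
    have hc' : ∀ j < k, 0 < c j := fun j hj => hc j (hj.trans (Nat.lt_succ_self k))
    have hc'' : ∀ j ≤ k, 0 < c j := fun j hj => hc j (Nat.lt_succ_of_le hj)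
    push_cast at hw
    have hk0 : (0 : ℝ) ≤ k := Nat.cast_nonneg k
    have hw1 : 1 < w.re := by linarith
    have hw0 : w ≠ 0 := by
      rintro rfl
      simp at hw1
      linarith
    have hS : Summable fun v : Fin (k + 1) → ℤ =>
        Complex.Gammaℝ w * (quadForm x c (k + 1) (toReal v) : ℂ) ^ (-w / 2) :=
      (summable_quadForm_cpow x hc (by exact_mod_cast hw)).mul_left _
    have hSr : Summable fun v : Fin (k + 1) → ℤ =>
        quadForm x c (k + 1) (toReal v) ^ (-(w.re / 2)) :=
      summable_quadForm_rpow x hc (by exact_mod_cast hw)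
    -- The zero vector may be included because `0 ^ (-w / 2) = 0`; this makes the index set a
    -- product.
    have h0 := tsum_eq_add_tsum_ne hS 0
    rw [toReal_zero, quadForm_zero, Complex.ofReal_zero, Complex.zero_cpow (by simpa using hw0),
      mul_zero, zero_add] at h0
    let E : (Fin k → ℤ) × ℤ ≃ (Fin (k + 1) → ℤ) :=
      (Equiv.prodComm _ _).trans (Fin.snocEquiv fun _ => ℤ)
    have hE (a : Fin k → ℤ) (t : ℤ) : E (a, t) = (Fin.snoc a t : Fin (k + 1) → ℤ) := rfl
    have hq (a : Fin k → ℤ) (t : ℤ) : quadForm x c (k + 1) (toReal (E (a, t))) =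
        quadForm x c k (toReal a) + c k ^ 2 * (t + colDot x k (toReal a)) ^ 2 := by
      rw [hE, toReal_snoc, quadForm_snoc]
    have hS' := E.summable_iff.mpr hS
    have hSr' := E.summable_iff.mpr hSr
    rw [← h0, ← E.tsum_eq]
    rw [show (fun v => Complex.Gammaℝ w * (quadForm x c (k + 1) (toReal v) : ℂ) ^ (-w / 2)) ∘ E =
      fun p : (Fin k → ℤ) × ℤ => Complex.Gammaℝ w *
        (quadForm x c (k + 1) (toReal (E p)) : ℂ) ^ (-w / 2) from rfl] at hS'
    rw [hS'.tsum_prod, tsum_eq_add_tsum_ne hS'.prod 0]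
    have hzero : ∑' t : ℤ, Complex.Gammaℝ w *
        (quadForm x c (k + 1) (toReal (E (0, t))) : ℂ) ^ (-w / 2) =
        2 * completedRiemannZeta w * (c k : ℂ) ^ (-w) := by
      rw [← tsum_zeta hck hw1]
      refine tsum_congr fun t => ?_
      rw [hq, toReal_zero, quadForm_zero, colDot_zero]
      simp
    have hne (a : NZ k) : ∑' t : ℤ, Complex.Gammaℝ w *
        (quadForm x c (k + 1) (toReal (E (a.1, t))) : ℂ) ^ (-w / 2) =
        (c k : ℂ)⁻¹ * (Complex.Gammaℝ (w - 1) *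
          (quadForm x c k (toReal a.1) : ℂ) ^ (-(w - 1) / 2)) +
        ∑' m : NZInt, besselTerm x c k ((w - 1) / 2) a m := by
      simp only [hq]
      refine poisson_epstein (quadForm_pos x hc' (toReal_ne_zero a.2)) hck _ hw1 ?_
      refine (hSr'.prod_factor a.1).congr fun t => ?_
      simp only [Function.comp, hq]
    have hT := summable_besselTerm x hc'' ((w - 1) / 2)
    have hw2 : (k : ℝ) < (w - 1).re := by simp; linarith
    have hS2 : Summable fun a : NZ k => (c k : ℂ)⁻¹ * (Complex.Gammaℝ (w - 1) *
        (quadForm x c k (toReal a.1) : ℂ) ^ (-(w - 1) / 2)) :=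
      (((summable_quadForm_cpow x hc' hw2).mul_left _).mul_left _).comp_injective
        Subtype.val_injective
    simp only [hzero, hne]
    rw [hS2.tsum_add hT.prod, tsum_mul_left, ih hc' hw2, complEpstein, besselSum, hT.tsum_prod,
      add_assoc]

/-- The closed form of `complEpstein`. -/
lemma complEpstein_eq (x : ℕ → ℕ → ℝ) (c : ℕ → ℝ) (n : ℕ) (w : ℂ) :
    complEpstein x c n w = ∑ k ∈ Finset.range n,
      (∏ j ∈ Finset.Ico (k + 1) n, (c j : ℂ)⁻¹) *
        (2 * completedRiemannZeta (w - n + k + 1) * (c k : ℂ) ^ (-(w - n + k + 1)) +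
          besselSum x c k ((w - n + k) / 2)) := by
  induction n generalizing w with
  | zero => simp [complEpstein]
  | succ n ih =>
    rw [complEpstein, ih, Finset.sum_range_succ, Finset.mul_sum]
    simp only [Finset.Ico_self, Finset.prod_empty, one_mul]
    have h : ∀ k ∈ Finset.range n, (c n : ℂ)⁻¹ * ((∏ j ∈ Finset.Ico (k + 1) n, (c j : ℂ)⁻¹) *
        (2 * completedRiemannZeta (w - 1 - n + k + 1) * (c k : ℂ) ^ (-(w - 1 - n + k + 1)) +
          besselSum x c k ((w - 1 - n + k) / 2))) =
        (∏ j ∈ Finset.Ico (k + 1) (n + 1), (c j : ℂ)⁻¹) *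
        (2 * completedRiemannZeta (w - (n + 1 : ℕ) + k + 1) *
          (c k : ℂ) ^ (-(w - (n + 1 : ℕ) + k + 1)) +
          besselSum x c k ((w - (n + 1 : ℕ) + k) / 2)) := by
      intro k hk
      rw [Finset.prod_Ico_succ_top (by have := Finset.mem_range.mp hk; omega)]
      rw [show w - (n + 1 : ℕ) + k = w - 1 - n + k by push_cast; ring]
      ring
    rw [Finset.sum_congr rfl h, show w - (n + 1 : ℕ) + n = w - 1 by push_cast; ring, sub_add_cancel]
    ring

/-! ### Primitive vectors and cosets -/

/-- Unimodular integral vectors. -/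
def IsPrimitive {n : ℕ} (v : Fin n → ℤ) : Prop := ∃ u : Fin n → ℤ, v ⬝ᵥ u = 1

/-- The type of primitive vectors. -/
abbrev Prim (n : ℕ) := {v : Fin n → ℤ // IsPrimitive v}

lemma IsPrimitive.ne_zero {n : ℕ} {v : Fin n → ℤ} (hv : IsPrimitive v) : v ≠ 0 := by
  rintro rfl
  obtain ⟨u, hu⟩ := hv
  simp at hu

/-- Uniqueness: pairing `d v = d' v'` with a vector `u` such that `v ⬝ᵥ u = 1` shows `d' ∣ d`, and
conversely. Existence: `d` is the absolute value of a generator of the ideal of all pairings with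
`v`. -/
lemma primitive_multiple_bijective (n : ℕ) : Function.Bijective
    (fun p : Prim n × ℕ+ => (⟨((p.2 : ℕ) : ℤ) • p.1.1, smul_ne_zero
      (by exact_mod_cast p.2.ne_zero) p.1.2.ne_zero⟩ : NZ n)) := by
  constructor
  · rintro ⟨⟨v, hv⟩, d⟩ ⟨⟨v', hv'⟩, d'⟩ h
    simp only [Subtype.mk.injEq] at h
    have key : ∀ {v v' : Fin n → ℤ} {d d' : ℕ+}, IsPrimitive v →
        ((d : ℕ) : ℤ) • v = ((d' : ℕ) : ℤ) • v' → (d' : ℕ) ∣ d := by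
      rintro v v' d d' ⟨u, hu⟩ h
      have h1 := congrArg (fun w => w ⬝ᵥ u) h
      simp only [smul_dotProduct, hu, smul_eq_mul, mul_one] at h1
      exact Int.natCast_dvd_natCast.mp ⟨_, h1⟩
    have hd : d = d' := PNat.coe_injective (Nat.dvd_antisymm (key hv' h.symm) (key hv h))
    subst hd
    have := smul_right_injective (Fin n → ℤ) (r := ((d : ℕ) : ℤ)) (by exact_mod_cast d.ne_zero) h
    simp [this]
  · rintro ⟨v, hv⟩
    obtain ⟨g, hg⟩ := IsPrincipalIdealRing.principal
      (LinearMap.range (dotProductBilin ℤ ℤ v : (Fin n → ℤ) →ₗ[ℤ] ℤ))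
    obtain ⟨u, hu⟩ : g ∈ LinearMap.range (dotProductBilin ℤ ℤ v : (Fin n → ℤ) →ₗ[ℤ] ℤ) := by
      rw [hg]
      exact Submodule.mem_span_singleton_self g
    have hu' : v ⬝ᵥ u = g := hu
    have hdvd (i : Fin n) : ∃ t, g * t = v i := by
      have : v i ∈ LinearMap.range (dotProductBilin ℤ ℤ v : (Fin n → ℤ) →ₗ[ℤ] ℤ) :=
        ⟨Pi.single i 1, by simp⟩
      rw [hg, Submodule.mem_span_singleton] at this
      obtain ⟨t, ht⟩ := this
      exact ⟨t, by rw [← ht, smul_eq_mul, mul_comm]⟩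
    choose v' hv' using hdvd
    have hvv : v = g • v' := by
      funext i
      simp [hv']
    have hg0 : g ≠ 0 := by
      rintro rfl
      exact hv (by simpa using hvv)
    have hpr : v' ⬝ᵥ u = 1 := by
      rw [hvv, smul_dotProduct, smul_eq_mul] at hu'
      exact mul_left_cancel₀ hg0 (hu'.trans (mul_one g).symm)
    have hsg : g.sign * g.sign = 1 := by
      rcases lt_or_gt_of_ne hg0 with h | h
      · simp [Int.sign_eq_neg_one_of_neg h]
      · simp [Int.sign_eq_one_of_pos h]
    -- The generator is determined up to sign; the sign is moved into the primitive vector.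
    refine ⟨⟨⟨g.sign • v', g.sign • u, ?_⟩, ⟨g.natAbs, Int.natAbs_pos.mpr hg0⟩⟩, ?_⟩
    · rw [smul_dotProduct, dotProduct_smul, hpr, smul_eq_mul, smul_eq_mul, mul_one, hsg]
    · refine Subtype.ext ?_
      simp only [PNat.mk_coe, hvv, smul_smul]
      rw [mul_comm, Int.sign_mul_natAbs]

/-- Every nonzero integral vector is a positive multiple of a unique primitive vector. -/
def primEquiv (n : ℕ) : Prim n × ℕ+ ≃ NZ n := Equiv.ofBijective _ (primitive_multiple_bijective n)

lemma primEquiv_coe {n : ℕ} (p : Prim n × ℕ+) :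
    (primEquiv n p : Fin n → ℤ) = ((p.2 : ℕ) : ℤ) • p.1.1 := rfl

/-- The last index. -/
def lastIdx {n : ℕ} (hn : 0 < n) : Fin n := ⟨n - 1, Nat.sub_lt hn one_pos⟩

lemma eq_lastIdx_iff {n : ℕ} (hn : 0 < n) (a : Fin n) : a = lastIdx hn ↔ (a : ℕ) + 1 = n := by
  rw [Fin.ext_iff, lastIdx]
  have := a.isLt
  simp only
  omega

lemma mem_P_iff {n : ℕ} (hn : 0 < n) (γ : Matrix.SpecialLinearGroup (Fin n) ℤ) :
    γ ∈ P n ↔ γ (lastIdx hn) = Pi.single (lastIdx hn) 1 := by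
  constructor
  · intro h
    funext b
    rw [h (lastIdx hn) b ((eq_lastIdx_iff hn _).mp rfl), Pi.single_apply]
    simp [eq_comm]
  · intro h a b ha
    obtain rfl := (eq_lastIdx_iff hn a).mpr ha
    rw [h, Pi.single_apply]
    simp [eq_comm]

lemma row_mul {n : ℕ} (g h : Matrix.SpecialLinearGroup (Fin n) ℤ) (l : Fin n) :
    (g * h) l = g l ᵥ* (h : Matrix (Fin n) (Fin n) ℤ) := by
  rw [Matrix.SpecialLinearGroup.coe_mul]
  rfl

lemma isPrimitive_row {n : ℕ} (g : Matrix.SpecialLinearGroup (Fin n) ℤ) (l : Fin n) :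
    IsPrimitive (g l) := by
  refine ⟨fun i => g⁻¹ i l, ?_⟩
  have h : (g * g⁻¹ : Matrix.SpecialLinearGroup (Fin n) ℤ) l l = 1 := by simp
  rwa [Matrix.SpecialLinearGroup.coe_mul, Matrix.mul_apply] at h

/-- A primitive vector is the last row of a matrix of determinant one. -/
lemma exists_row_eq {n : ℕ} (hn : 2 ≤ n) {v : Fin n → ℤ} (hv : IsPrimitive v) :
    ∃ g : Matrix.SpecialLinearGroup (Fin n) ℤ, g (lastIdx (by omega)) = v := by
  obtain ⟨u, hu⟩ := hv
  set l : Fin n := lastIdx (by omega) with hl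
  -- Since `v ⬝ᵥ u = 1`, `ℤ^n` is the direct sum of `ℤ u` and the kernel of pairing with `v`. In a
  -- basis consisting of `u` at place `l` and a basis of the kernel, pairing with `v` is the
  -- coordinate at `l`; so `v` is row `l` of the inverse of the matrix whose columns are the basis
  -- vectors.
  set f : (Fin n → ℤ) →ₗ[ℤ] ℤ := dotProductBilin ℤ ℤ v with hf
  have hfa (w) : f w = v ⬝ᵥ w := rfl
  set K := LinearMap.ker f
  set bK := Module.finBasis ℤ K
  let b := Module.Basis.mkFinCons u bK
    (fun c x hx h => by
      have := congrArg f h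
      have hx' : f x = 0 := hx
      rw [map_add, map_smul, hx', map_zero, hfa, hu] at this
      simpa using this)
    (fun z => ⟨-f z, by
      rw [LinearMap.mem_ker, map_add, map_smul, hfa u, hu]
      simp⟩)
  have hcard : Module.finrank ℤ K + 1 = n := by
    have h := Module.finrank_eq_card_basis b
    simpa using h.symm
  let σ : Fin (Module.finrank ℤ K + 1) ≃ Fin n :=
    (finCongr hcard).trans (Equiv.swap (finCongr hcard 0) l)
  have hσ0 : σ 0 = l := by simp [σ]
  let b' := b.reindex σ
  have hb'l : b' l = u := by
    rw [Module.Basis.reindex_apply, ← hσ0, Equiv.symm_apply_apply, Module.Basis.coe_mkFinCons,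
      Fin.cons_zero]
  have hb' (j : Fin n) (hj : j ≠ l) : f (b' j) = 0 := by
    rw [Module.Basis.reindex_apply]
    have hne : σ.symm j ≠ 0 := by
      intro h
      rw [Equiv.symm_apply_eq, hσ0] at h
      exact hj h
    obtain ⟨i, hi⟩ := Fin.exists_succ_eq.mpr hne
    rw [← hi, Module.Basis.coe_mkFinCons, Fin.cons_succ]
    exact (bK i).2
  set M := (Pi.basisFun ℤ (Fin n)).toMatrix b' with hM
  set B := b'.toMatrix (Pi.basisFun ℤ (Fin n)) with hB
  have hMB : M * B = 1 := Module.Basis.toMatrix_mul_toMatrix_flip _ _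
  have hvM : v ᵥ* M = Pi.single l 1 := by
    funext j
    have h1 : (v ᵥ* M) j = f (b' j) := by
      simp [Matrix.vecMul, hfa, dotProduct, hM, Module.Basis.toMatrix_apply]
    rw [h1, Pi.single_apply]
    split_ifs with h
    · rw [h, hb'l, hfa, hu]
    · exact hb' j h
  have hBl : B l = v := by
    have h1 : (v ᵥ* M) ᵥ* B = v := by
      rw [Matrix.vecMul_vecMul, hMB, Matrix.vecMul_one]
    rw [hvM, Matrix.single_one_vecMul] at h1
    exact h1
  have hdet : IsUnit B.det := by
    have := congrArg Matrix.det hMB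
    rw [Matrix.det_mul, Matrix.det_one] at this
    exact IsUnit.of_mul_eq_one M.det ((mul_comm _ _).trans this)
  rcases Int.isUnit_iff.mp hdet with h | h
  · exact ⟨⟨B, h⟩, hBl⟩
  -- If the determinant is `-1`, the first row is negated; it is not the last one because `n ≥ 2`.
  · let z : Fin n := ⟨0, by omega⟩
    have hzl : z ≠ l := by
      intro h
      have := congrArg Fin.val h
      simp [z, hl, lastIdx] at this
      omega
    refine ⟨⟨B.updateRow z ((-1 : ℤ) • B z), ?_⟩, ?_⟩
    · rw [Matrix.det_updateRow_smul, Matrix.updateRow_eq_self, h]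
      rfl
    · change B.updateRow z ((-1 : ℤ) • B z) l = v
      rw [Matrix.updateRow_ne hzl.symm, hBl]

/-- Elements of `P n` have last row `(0, …, 0, 1)`, so multiplying by them on the left keeps the
last row; conversely, matrices with equal last rows differ by such an element. -/
lemma coset_row_bijective {n : ℕ} (hn : 2 ≤ n) {T : Set (Matrix.SpecialLinearGroup (Fin n) ℤ)}
    (hT : Subgroup.IsComplement (P n : Set (Matrix.SpecialLinearGroup (Fin n) ℤ)) T) :
    Function.Bijective (fun t : T =>
      (⟨t.1 (lastIdx (by omega)), isPrimitive_row _ _⟩ : Prim n)) := by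
  have hn0 : 0 < n := by omega
  constructor
  · intro t t' h
    simp only [Subtype.mk.injEq] at h
    have hmem : t.1 * t'.1⁻¹ ∈ P n := by
      rw [mem_P_iff hn0, row_mul, h, ← row_mul, mul_inv_cancel]
      funext j
      simp [Matrix.one_apply, Pi.single_apply, eq_comm]
    have := hT.1 (a₁ := (⟨1, (P n).one_mem⟩, t)) (a₂ := (⟨t.1 * t'.1⁻¹, hmem⟩, t')) (by simp)
    exact congrArg Prod.snd this
  · rintro ⟨v, hv⟩
    obtain ⟨g, hg⟩ := exists_row_eq hn hv
    obtain ⟨⟨p, t⟩, hpt⟩ := hT.2 g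
    have hp := (mem_P_iff hn0 p.1).mp p.2
    have hpt' : p.1 * t.1 = g := hpt
    have h : g (lastIdx hn0) = t.1 (lastIdx hn0) := by
      rw [← hpt', row_mul, hp, Matrix.single_one_vecMul]
      rfl
    exact ⟨t, Subtype.ext (h.symm.trans hg)⟩

/-- The cosets of `P n` correspond to the primitive vectors. -/
def cosetEquiv {n : ℕ} (hn : 2 ≤ n) {T : Set (Matrix.SpecialLinearGroup (Fin n) ℤ)}
    (hT : Subgroup.IsComplement (P n : Set (Matrix.SpecialLinearGroup (Fin n) ℤ)) T) :
    T ≃ Prim n := Equiv.ofBijective _ (coset_row_bijective hn hT)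

/-! ### Iwasawa coordinates and the summand of the Eisenstein series -/

lemma unip_congr {n : ℕ} {x x' : ℕ → ℕ → ℝ}
    (h : ∀ i j, 1 ≤ i → i < j → j ≤ n → x i j = x' i j) : unip n x = unip n x' := by
  ext a b
  simp only [unip, Matrix.of_apply]
  split_ifs with h1
  · have h2 : (a : ℕ) < b := h1
    have h3 := b.isLt
    exact h _ _ (by omega) (by omega) (by omega)
  · rfl
  · rfl

lemma quadForm_congr {n : ℕ} {x x' : ℕ → ℕ → ℝ} {c c' : ℕ → ℝ}
    (h : ∀ i j, 1 ≤ i → i < j → j ≤ n → x i j = x' i j) (hc : ∀ j < n, c j = c' j)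
    (v : Fin n → ℝ) : quadForm x c n v = quadForm x' c' n v := by
  unfold quadForm
  rw [unip_congr h]
  exact Finset.sum_congr rfl fun j _ => by rw [hc j j.isLt]

/-- `x`, `c` are coordinates of the class of `z` modulo the orthogonal group. -/
def Coords (n : ℕ) (z : Matrix (Fin n) (Fin n) ℝ) (x : ℕ → ℕ → ℝ) (c : ℕ → ℝ) : Prop :=
  (∀ j < n, 0 < c j) ∧ ∀ v : Fin n → ℝ, (v ᵥ* z) ⬝ᵥ (v ᵥ* z) = quadForm x c n v

/-- Cholesky decomposition: completing the square in the last variable leaves the Schur complement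
`S'`, a positive form in one variable less. -/
lemma exists_quadForm_eq {k : ℕ} (S : Matrix (Fin k) (Fin k) ℝ) (hS : ∀ i j, S i j = S j i)
    (hpos : ∀ v : Fin k → ℝ, v ≠ 0 → 0 < ∑ i, ∑ j, v i * v j * S i j) :
    ∃ (x : ℕ → ℕ → ℝ) (c : ℕ → ℝ), (∀ j < k, 0 < c j) ∧
      ∀ v : Fin k → ℝ, ∑ i, ∑ j, v i * v j * S i j = quadForm x c k v := by
  induction k with
  | zero => exact ⟨0, 0, by simp, fun v => by simp [quadForm]⟩
  | succ k ih =>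
    set l := Fin.last k
    set α := S l l with hα
    have hsplit (a : Fin k → ℝ) (t : ℝ) :
        ∑ i, ∑ j, (Fin.snoc a t : Fin (k + 1) → ℝ) i * (Fin.snoc a t : Fin (k + 1) → ℝ) j * S i j =
        ∑ i : Fin k, ∑ j : Fin k, a i * a j * S i.castSucc j.castSucc +
          2 * t * ∑ i : Fin k, a i * S i.castSucc l + α * t ^ 2 := by
      simp only [Fin.sum_univ_castSucc, Fin.snoc_castSucc, Fin.snoc_last, Finset.sum_add_distrib]
      have h1 : ∑ i : Fin k, a i * t * S i.castSucc (Fin.last k) =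
          t * ∑ i : Fin k, a i * S i.castSucc l := by
        rw [Finset.mul_sum]
        exact Finset.sum_congr rfl fun i _ => by ring
      have h2 : ∑ j : Fin k, t * a j * S (Fin.last k) j.castSucc =
          t * ∑ i : Fin k, a i * S i.castSucc l := by
        rw [Finset.mul_sum]
        exact Finset.sum_congr rfl fun i _ => by rw [hS]; ring
      rw [h1, h2]
      ring
    have hα0 : 0 < α := by
      have h1 : (Fin.snoc (0 : Fin k → ℝ) 1 : Fin (k + 1) → ℝ) ≠ 0 := fun h => by
        have := congrFun h (Fin.last k)
        simp at this
      have := hpos _ h1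
      rw [hsplit] at this
      simpa using this
    set S' : Matrix (Fin k) (Fin k) ℝ := Matrix.of fun i j =>
      S i.castSucc j.castSucc - S i.castSucc l * S j.castSucc l / α with hS'
    have hform (a : Fin k → ℝ) : ∑ i, ∑ j, a i * a j * S' i j =
        ∑ i : Fin k, ∑ j : Fin k, a i * a j * S i.castSucc j.castSucc -
          (∑ i : Fin k, a i * S i.castSucc l) ^ 2 / α := by
      rw [sq, Finset.sum_mul_sum, Finset.sum_div, ← Finset.sum_sub_distrib]
      refine Finset.sum_congr rfl fun i _ => ?_
      rw [Finset.sum_div, ← Finset.sum_sub_distrib]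
      refine Finset.sum_congr rfl fun j _ => ?_
      simp only [hS', Matrix.of_apply]
      ring
    obtain ⟨x, c, hc, hxc⟩ := ih S' (fun i j => by
        simp only [hS', Matrix.of_apply]
        rw [hS i.castSucc j.castSucc, mul_comm (S i.castSucc l)]) (fun a ha => by
        -- For given `a` this last coordinate minimizes the form, and the minimum is the value of
        -- `S'` at `a`.
        have h1 : (Fin.snoc a (-(∑ i : Fin k, a i * S i.castSucc l) / α) : Fin (k + 1) → ℝ) ≠ 0 :=
          fun h => ha (by
            funext i
            simpa using congrFun h i.castSucc)
        have h2 := hpos _ h1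
        rw [hsplit] at h2
        rw [hform]
        convert! h2 using 1
        field_simp
        ring)
    refine ⟨fun i j => if j = k + 1 then (if h : i - 1 < k then S (Fin.castSucc ⟨i - 1, h⟩) l / α
      else 0) else x i j, fun j => if j = k then √α else c j, fun j hj => ?_, fun v => ?_⟩
    · dsimp only
      split_ifs with h
      · exact Real.sqrt_pos.mpr hα0
      · exact hc j (by omega)
    · obtain ⟨a, t, rfl⟩ : ∃ (a : Fin k → ℝ) (t : ℝ), (Fin.snoc a t : Fin (k + 1) → ℝ) = v :=
        ⟨Fin.init v, v (Fin.last k), Fin.snoc_init_self v⟩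
      rw [hsplit, quadForm_snoc, quadForm_congr (x' := x) (c' := c), ← hxc, hform]
      · have h1 : colDot (fun i j => if j = k + 1 then (if h : i - 1 < k then
            S (Fin.castSucc ⟨i - 1, h⟩) l / α else 0) else x i j) k a =
            (∑ i : Fin k, a i * S i.castSucc l) / α := by
          simp [colDot, Finset.sum_div, mul_div_assoc]
        rw [h1, if_pos rfl, Real.sq_sqrt hα0.le]
        field_simp
        ring
      · intro i j _ _ hj
        rw [if_neg (by omega)]
      · intro j hj
        rw [if_neg (by omega)]

lemma vecMul_dot_self_eq {n : ℕ} (z : Matrix (Fin n) (Fin n) ℝ) (v : Fin n → ℝ) :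
    (v ᵥ* z) ⬝ᵥ (v ᵥ* z) = ∑ i, ∑ j, v i * v j * (z * zᵀ) i j := by
  simp only [Matrix.vecMul, dotProduct, Matrix.mul_apply, Matrix.transpose_apply,
    Finset.sum_mul_sum]
  simp only [Finset.mul_sum]
  rw [Finset.sum_comm]
  refine Finset.sum_congr rfl fun i _ => ?_
  rw [Finset.sum_comm]
  exact Finset.sum_congr rfl fun j _ => Finset.sum_congr rfl fun l _ => by ring

/-- Every invertible matrix has coordinates. -/
lemma exists_coords {n : ℕ} {z : Matrix (Fin n) (Fin n) ℝ} (hz : z.det ≠ 0) :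
    ∃ x c, Coords n z x c := by
  obtain ⟨x, c, hc, h⟩ := exists_quadForm_eq (z * zᵀ)
    (fun i j => by
      have := congrFun (congrFun (Matrix.transpose_mul z zᵀ) i) j
      rw [Matrix.transpose_transpose] at this
      rw [← this, Matrix.transpose_apply])
    (fun v hv => by
      rw [← vecMul_dot_self_eq]
      refine lt_of_le_of_ne (Finset.sum_nonneg fun i _ => mul_self_nonneg _) fun h => hv ?_
      have h1 : v ᵥ* z = 0 := dotProduct_self_eq_zero.mp h.symm
      exact Matrix.eq_zero_of_vecMul_eq_zero hz h1)
  exact ⟨x, c, hc, fun v => by rw [vecMul_dot_self_eq, h]⟩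

/-- The matrix `unip n x * diag (c 0, …, c (n - 1))`. -/
def coordMatrix (n : ℕ) (x : ℕ → ℕ → ℝ) (c : ℕ → ℝ) : Matrix (Fin n) (Fin n) ℝ :=
  unip n x * Matrix.diagonal fun a : Fin n => c a

lemma quadForm_eq_dot (x : ℕ → ℕ → ℝ) (c : ℕ → ℝ) {n : ℕ} (v : Fin n → ℝ) :
    quadForm x c n v = (v ᵥ* coordMatrix n x c) ⬝ᵥ (v ᵥ* coordMatrix n x c) := by
  rw [coordMatrix, ← Matrix.vecMul_vecMul]
  simp [quadForm, dotProduct, Matrix.vecMul_diagonal, sq]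

lemma det_unip (n : ℕ) (x : ℕ → ℕ → ℝ) : (unip n x).det = 1 := by
  rw [Matrix.det_of_isUpperTriangular]
  · simp [unip]
  · intro i j h
    have h : j < i := h
    simp [unip, h.not_gt, h.ne']

lemma det_coordMatrix (n : ℕ) (x : ℕ → ℕ → ℝ) (c : ℕ → ℝ) :
    (coordMatrix n x c).det = ∏ j ∈ Finset.range n, c j := by
  rw [coordMatrix, Matrix.det_mul, det_unip, Matrix.det_diagonal, one_mul,
    Finset.prod_range]

/-- Polarization: the entry `(i, j)` comes from the values at `e_i + e_j`, `e_i` and `e_j`. -/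
lemma gram_eq_of_dot_eq {n : ℕ} {A B : Matrix (Fin n) (Fin n) ℝ}
    (h : ∀ v, (v ᵥ* A) ⬝ᵥ (v ᵥ* A) = (v ᵥ* B) ⬝ᵥ (v ᵥ* B)) : A * Aᵀ = B * Bᵀ := by
  ext i j
  have h1 := h (Pi.single i 1 + Pi.single j 1)
  have h2 := h (Pi.single i 1)
  have h3 := h (Pi.single j 1)
  simp only [Matrix.add_vecMul, Matrix.single_one_vecMul, dotProduct_add, add_dotProduct] at h1 h2 h3
  have e1 : (A * Aᵀ) i j = A.row i ⬝ᵥ A.row j := rfl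
  have e2 : (B * Bᵀ) i j = B.row i ⬝ᵥ B.row j := rfl
  rw [dotProduct_comm (A.row j) (A.row i), dotProduct_comm (B.row j) (B.row i)] at h1
  rw [e1, e2]
  linarith

lemma Coords.gram_eq {n : ℕ} {z : Matrix (Fin n) (Fin n) ℝ} {x : ℕ → ℕ → ℝ} {c : ℕ → ℝ}
    (h : Coords n z x c) : z * zᵀ = coordMatrix n x c * (coordMatrix n x c)ᵀ :=
  gram_eq_of_dot_eq fun v => by rw [h.2, quadForm_eq_dot]

lemma Coords.prod_pos {n : ℕ} {z : Matrix (Fin n) (Fin n) ℝ} {x : ℕ → ℕ → ℝ} {c : ℕ → ℝ}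
    (h : Coords n z x c) : 0 < ∏ j ∈ Finset.range n, c j :=
  Finset.prod_pos fun j hj => h.1 j (Finset.mem_range.mp hj)

lemma Coords.abs_det {n : ℕ} {z : Matrix (Fin n) (Fin n) ℝ} {x : ℕ → ℕ → ℝ} {c : ℕ → ℝ}
    (h : Coords n z x c) : |z.det| = ∏ j ∈ Finset.range n, c j := by
  have h1 := congrArg Matrix.det h.gram_eq
  rw [Matrix.det_mul, Matrix.det_mul, Matrix.det_transpose, Matrix.det_transpose,
    det_coordMatrix] at h1
  rw [← abs_of_pos h.prod_pos]
  exact (mul_self_inj_of_nonneg (abs_nonneg _) (abs_nonneg _)).mp (by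
    rw [abs_mul_abs_self, abs_mul_abs_self, h1])

/-- The `y`-coordinates attached to column scales. -/
lemma bigY_ratio {n : ℕ} {c : ℕ → ℝ} (hc : ∀ j < n, 0 < c j) {a : ℕ} (ha : a < n) :
    c (n - 1) * bigY (fun j => c (n - 1 - j) / c (n - j)) (n - a) = c a := by
  have key : ∀ m, m < n → c (n - 1) * bigY (fun j => c (n - 1 - j) / c (n - j)) (m + 1) =
      c (n - 1 - m) := by
    intro m
    induction m with
    | zero => intro _; simp [bigY]
    | succ m ih =>
      intro hm
      have h := ih (by omega)
      rw [bigY] at h ⊢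
      rw [show m + 1 + 1 - 1 = m + 1 by omega, Finset.prod_Icc_succ_top (by omega),
        ← mul_assoc, show m = m + 1 - 1 by omega, h]
      have := (hc (n - 1 - m) (by omega)).ne'
      rw [show m + 1 - 1 + 1 = m + 1 by omega, show n - (m + 1) = n - 1 - m by omega]
      field_simp
  have := key (n - 1 - a) (by omega)
  rwa [show n - 1 - a + 1 = n - a by omega, show n - 1 - (n - 1 - a) = a by omega] at this

/-- Two invertible matrices with the same Gram matrix differ by an orthogonal factor on the right.
The last scale `c (n - 1)` is taken out as the real factor, which makes the last diagonal entry `1`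
and the `y_j` quotients of adjacent scales. -/
lemma Coords.isIwasawa {n : ℕ} (hn : 0 < n) {z : Matrix (Fin n) (Fin n) ℝ} {x : ℕ → ℕ → ℝ}
    {c : ℕ → ℝ} (h : Coords n z x c) :
    IsIwasawa n z x (fun j => c (n - 1 - j) / c (n - j)) := by
  have hdet : (coordMatrix n x c).det ≠ 0 := by
    rw [det_coordMatrix]
    exact h.prod_pos.ne'
  have hu : IsUnit (coordMatrix n x c).det := isUnit_iff_ne_zero.mpr hdet
  have hcm : coordMatrix n x c =
      c (n - 1) • (unip n x * torus n (fun j => c (n - 1 - j) / c (n - j))) := by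
    rw [coordMatrix, torus, ← Matrix.mul_smul]
    congr 1
    rw [← Matrix.diagonal_smul]
    congr 1
    funext a
    exact (bigY_ratio h.1 a.isLt).symm
  refine ⟨fun j hj => ?_, (coordMatrix n x c)⁻¹ * z, ?_, c (n - 1), (h.1 _ (by omega)).ne', ?_⟩
  · rw [Finset.mem_Icc] at hj
    exact div_pos (h.1 _ (by omega)) (h.1 _ (by omega))
  · rw [Matrix.mem_orthogonalGroup_iff, Matrix.transpose_mul]
    calc _ = (coordMatrix n x c)⁻¹ * (z * zᵀ) * ((coordMatrix n x c)⁻¹)ᵀ := by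
          simp only [Matrix.mul_assoc]
      _ = _ := by
          rw [h.gram_eq, ← Matrix.mul_assoc, Matrix.nonsing_inv_mul _ hu, Matrix.one_mul,
            ← Matrix.transpose_mul, Matrix.nonsing_inv_mul _ hu, Matrix.transpose_one]
  · rw [← Matrix.smul_mul, ← hcm, ← Matrix.mul_assoc, Matrix.mul_nonsing_inv _ hu, Matrix.one_mul]

lemma bigY_one (y : ℕ → ℝ) : bigY y 1 = 1 := by simp [bigY]

lemma bigY_pos {n : ℕ} {y : ℕ → ℝ} (hy : ∀ j ∈ Finset.Icc 1 (n - 1), 0 < y j) {j : ℕ}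
    (hj : j ≤ n) : 0 < bigY y j :=
  Finset.prod_pos fun i hi => hy i (by rw [Finset.mem_Icc] at hi ⊢; omega)

lemma prod_bigY (n : ℕ) (y : ℕ → ℝ) :
    ∏ a ∈ Finset.range n, bigY y (n - a) = ∏ j ∈ Finset.Icc 2 n, bigY y j := by
  rcases n.eq_zero_or_pos with rfl | hn
  · simp
  · have h : ∏ a ∈ Finset.range n, bigY y (n - a) = ∏ j ∈ Finset.Icc 1 n, bigY y j := by
      refine Finset.prod_nbij' (fun a => n - a) (fun j => n - j) (fun a ha => ?_) (fun j hj => ?_)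
        (fun a ha => ?_) (fun j hj => ?_) (fun _ _ => rfl) <;>
        simp only [Finset.mem_range, Finset.mem_Icc] at * <;> omega
    rw [h, ← Finset.insert_Icc_succ_left_eq_Icc hn, Finset.prod_insert (by simp), bigY_one, one_mul]
    rfl

/-- In `g = r u d k` the last row of `u d` is `(0, …, 0, 1)`, so the last row of `g` has norm `|r|`,
while `|det g| = |r|^n det d`. The right side does not involve the decomposition, so the choice made
in `iwasawaY` is irrelevant to `IFun`. -/
lemma prod_bigY_of_isIwasawa {n : ℕ} (hn : 0 < n) {g : Matrix (Fin n) (Fin n) ℝ}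
    {x : ℕ → ℕ → ℝ} {y : ℕ → ℝ} (h : IsIwasawa n g x y) :
    ∏ j ∈ Finset.Icc 2 n, bigY y j =
      |g.det| / √(g (lastIdx hn) ⬝ᵥ g (lastIdx hn)) ^ n := by
  obtain ⟨hy, k, hk, r, hr, hg⟩ := h
  have hk' : k * kᵀ = 1 := (Matrix.mem_orthogonalGroup_iff (Fin n) ℝ).mp hk
  have hdetk : |k.det| = 1 := by
    have := congrArg Matrix.det hk'
    rw [Matrix.det_mul, Matrix.det_transpose, Matrix.det_one] at this
    rcases mul_self_eq_one_iff.mp this with h | h <;> simp [h]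
  have hP : 0 < ∏ j ∈ Finset.Icc 2 n, bigY y j :=
    Finset.prod_pos fun j hj => bigY_pos hy (Finset.mem_Icc.mp hj).2
  have hdet : |g.det| = |r| ^ n * ∏ j ∈ Finset.Icc 2 n, bigY y j := by
    rw [hg, Matrix.det_smul, Matrix.det_mul, Matrix.det_mul, det_unip, torus, Matrix.det_diagonal,
      Fintype.card_fin, one_mul, abs_mul, abs_mul, hdetk, mul_one, abs_pow,
      Fin.prod_univ_eq_prod_range (fun a => bigY y (n - a)), prod_bigY, abs_of_pos hP]
  have hrow : g (lastIdx hn) = r • k (lastIdx hn) := by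
    have h1 : (Pi.single (lastIdx hn) 1 : Fin n → ℝ) ᵥ* (unip n x * torus n y) =
        Pi.single (lastIdx hn) 1 := by
      rw [← Matrix.vecMul_vecMul, Matrix.single_one_vecMul]
      funext b
      rw [torus, Matrix.vecMul_diagonal, Matrix.row]
      have hb : ¬ lastIdx hn < b := by
        have := b.isLt
        simp only [lastIdx, Fin.lt_def]
        omega
      simp only [unip, Matrix.of_apply, if_neg hb, Pi.single_apply]
      by_cases hbl : lastIdx hn = b
      · subst hbl
        have : n - ((lastIdx hn : Fin n) : ℕ) = 1 := by simp only [lastIdx]; omega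
        simp [this, bigY_one]
      · rw [if_neg hbl, if_neg (Ne.symm hbl), zero_mul]
    have h2 : g (lastIdx hn) = (Pi.single (lastIdx hn) 1 : Fin n → ℝ) ᵥ* g := by
      rw [Matrix.single_one_vecMul]
      rfl
    rw [h2, hg, Matrix.vecMul_smul, ← Matrix.vecMul_vecMul, h1, Matrix.single_one_vecMul]
    rfl
  have hkk : k (lastIdx hn) ⬝ᵥ k (lastIdx hn) = 1 := by
    have := congrFun (congrFun hk' (lastIdx hn)) (lastIdx hn)
    rwa [Matrix.one_apply_eq] at this
  rw [hrow, smul_dotProduct, dotProduct_smul, hkk, hdet, smul_eq_mul, smul_eq_mul, mul_one,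
    Real.sqrt_mul_self_eq_abs, mul_div_cancel_left₀]
  exact pow_ne_zero _ (abs_pos.mpr hr).ne'

lemma IFun_eq {n : ℕ} (hn : 0 < n) (s : ℂ) {g : Matrix (Fin n) (Fin n) ℝ} (hg : g.det ≠ 0) :
    IFun n s g = ((|g.det| / √(g (lastIdx hn) ⬝ᵥ g (lastIdx hn)) ^ n : ℝ) : ℂ) ^ s := by
  have hex : ∃ y x, IsIwasawa n g x y := by
    obtain ⟨x, c, h⟩ := exists_coords hg
    exact ⟨_, x, h.isIwasawa hn⟩
  obtain ⟨x, hx⟩ := hex.choose_spec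
  rw [IFun, iwasawaY, dif_pos hex, prod_bigY_of_isIwasawa hn hx]

lemma block_self (n : ℕ) (γ : Matrix.SpecialLinearGroup (Fin n) ℤ) :
    block n n γ = (γ : Matrix (Fin n) (Fin n) ℤ).map (Int.cast : ℤ → ℝ) := by
  ext a b
  simp [block]

lemma det_block_self (n : ℕ) (γ : Matrix.SpecialLinearGroup (Fin n) ℤ) :
    (block n n γ).det = 1 := by
  have h := (Int.castRingHom ℝ).map_det (γ : Matrix (Fin n) (Fin n) ℤ)
  rw [block_self]
  rw [γ.det_coe, map_one] at h
  exact h.symm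

lemma IFun_block {n : ℕ} (hn : 0 < n) (s : ℂ) {z : Matrix (Fin n) (Fin n) ℝ} {x : ℕ → ℕ → ℝ}
    {c : ℕ → ℝ} (h : Coords n z x c) (γ : Matrix.SpecialLinearGroup (Fin n) ℤ) :
    IFun n s (block n n γ * z) = ((∏ j ∈ Finset.range n, c j : ℝ) : ℂ) ^ s *
      (quadForm x c n (toReal (γ (lastIdx hn))) : ℂ) ^ (-(n * s) / 2) := by
  have hd : |(block n n γ * z).det| = ∏ j ∈ Finset.range n, c j := by
    rw [Matrix.det_mul, det_block_self, one_mul, h.abs_det]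
  have hrow : (block n n γ * z) (lastIdx hn) = toReal (γ (lastIdx hn)) ᵥ* z := by
    rw [block_self]
    rfl
  have hq : 0 < quadForm x c n (toReal (γ (lastIdx hn))) :=
    quadForm_pos x h.1 (toReal_ne_zero (isPrimitive_row γ _).ne_zero)
  have hq0 : (quadForm x c n (toReal (γ (lastIdx hn))) : ℂ) ≠ 0 := by exact_mod_cast hq.ne'
  rw [IFun_eq hn s (fun h0 => by
    rw [h0, abs_zero] at hd
    exact h.prod_pos.ne hd), hd, hrow, h.2, div_eq_mul_inv, Complex.ofReal_mul,
    Complex.mul_cpow_ofReal_nonneg h.prod_pos.le (by positivity)]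
  congr 1
  rw [Real.sqrt_eq_rpow, ← Real.rpow_natCast, ← Real.rpow_mul hq.le, ← Real.rpow_neg hq.le,
    Complex.ofReal_cpow hq.le, Complex.cpow_def_of_ne_zero hq0, Complex.cpow_def_of_ne_zero hq0,
    Complex.cpow_def_of_ne_zero (Complex.exp_ne_zero _), ← Complex.ofReal_log hq.le,
    ← Complex.ofReal_mul, ← Complex.ofReal_exp, ← Complex.ofReal_log (Real.exp_pos _).le,
    Real.log_exp]
  congr 1
  push_cast
  ring

/-! ### Meromorphic continuation -/

/-- The degenerate Eisenstein series in terms of coordinates. -/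
def eisFun (n : ℕ) (x : ℕ → ℕ → ℝ) (c : ℕ → ℝ) (s : ℂ) : ℂ :=
  ((∏ j ∈ Finset.range n, c j : ℝ) : ℂ) ^ s * complEpstein x c n (n * s) /
    completedRiemannZeta (n * s)

lemma completedRiemannZeta_ne_zero {w : ℂ} (hw : 1 < w.re) : completedRiemannZeta w ≠ 0 := by
  intro h
  have hw0 : w ≠ 0 := by
    rintro rfl
    simp at hw
    linarith
  have := riemannZeta_ne_zero_of_one_lt_re hw
  rw [riemannZeta_def_of_ne_zero hw0, h, zero_div] at this
  exact this rfl

/-- A nonzero vector is `d` times a primitive one, and the form scales by `d²`. The sum over all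
nonzero vectors is therefore the sum over primitive ones times `∑ d^(-w) = ζ(w)`, where `w = ns`. -/
lemma hasSum_IFun {n : ℕ} (hn : 2 ≤ n) {z : Matrix (Fin n) (Fin n) ℝ} {x : ℕ → ℕ → ℝ}
    {c : ℕ → ℝ} (h : Coords n z x c) {s : ℂ} (hs : 1 < s.re)
    {T : Set (Matrix.SpecialLinearGroup (Fin n) ℤ)}
    (hT : Subgroup.IsComplement (P n : Set (Matrix.SpecialLinearGroup (Fin n) ℤ)) T) :
    HasSum (fun γ : T => IFun n s (block n n γ * z)) (eisFun n x c s) := by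
  have hn0 : 0 < n := by omega
  have hnR : (0 : ℝ) < n := by exact_mod_cast hn0
  have hn1 : (1 : ℝ) ≤ n := by exact_mod_cast hn0
  set w : ℂ := n * s with hw
  have hwre : w.re = n * s.re := by simp [hw]
  have hwn : n < w.re := by rw [hwre]; nlinarith
  have hw1 : 1 < w.re := by linarith
  set D : ℂ := ((∏ j ∈ Finset.range n, c j : ℝ) : ℂ) ^ s with hD
  set f : NZ n → ℂ := fun v => Complex.Gammaℝ w * (quadForm x c n (toReal v.1) : ℂ) ^ (-w / 2)
    with hf
  have hfs : Summable f :=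
    ((summable_quadForm_cpow x h.1 hwn).mul_left _).comp_injective Subtype.val_injective
  have hfs' := (primEquiv n).summable_iff.mpr hfs
  set g : Prim n → ℂ := fun p => (quadForm x c n (toReal p.1) : ℂ) ^ (-w / 2) with hg
  have hg0 : Summable g := (summable_quadForm_cpow x h.1 hwn).comp_injective Subtype.val_injective
  have hfg (p : Prim n) (d : ℕ+) : f (primEquiv n (p, d)) =
      g p * (Complex.Gammaℝ w * (1 / ((d : ℕ) : ℂ) ^ w)) := by
    have e1 : toReal ((primEquiv n (p, d) : NZ n) : Fin n → ℤ) = ((d : ℕ) : ℝ) • toReal p.1 := by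
      funext i
      simp [primEquiv_coe, toReal]
    simp only [hf, hg]
    rw [e1, quadForm_smul, Complex.ofReal_mul, Complex.mul_cpow_ofReal_nonneg (by positivity)
      (quadForm_nonneg _ _ _), ofReal_sq_cpow (by positivity), mul_div_cancel₀ _ two_ne_zero,
      Complex.cpow_neg (_ : ℂ) w]
    push_cast
    ring
  have hzeta : ∑' d : ℕ+, Complex.Gammaℝ w * (1 / ((d : ℕ) : ℂ) ^ w) = completedRiemannZeta w := by
    rw [completedZeta_eq_tsum_of_one_lt_re hw1, ← Complex.Gammaℝ_def, tsum_mul_left]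
    congr 1
    have h0 : w ≠ 0 := by
      intro h0
      rw [h0] at hw1
      simp at hw1
      linarith
    refine PNat.coe_injective.tsum_eq (f := fun d : ℕ => 1 / (d : ℂ) ^ w) fun d hd => ?_
    refine ⟨⟨d, Nat.pos_of_ne_zero ?_⟩, rfl⟩
    rintro rfl
    simp [h0] at hd
  have hξ : completedRiemannZeta w ≠ 0 := completedRiemannZeta_ne_zero hw1
  have hsum : ∑' p, g p = complEpstein x c n w / completedRiemannZeta w := by
    rw [eq_div_iff hξ, ← tsum_quadForm_cpow x h.1 hwn]
    change _ = ∑' v, f v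
    rw [← (primEquiv n).tsum_eq]
    change _ = ∑' p, (f ∘ primEquiv n) p
    rw [hfs'.tsum_prod, ← tsum_mul_right]
    refine tsum_congr fun p => ?_
    rw [← hzeta, ← tsum_mul_left]
    exact tsum_congr fun d => (hfg p d).symm
  have hHas : HasSum (fun p => D * g p) (eisFun n x c s) := by
    rw [eisFun, mul_div_assoc, ← hsum]
    exact hg0.hasSum.mul_left D
  convert! (cosetEquiv hn hT).hasSum_iff.mpr hHas using 1
  funext γ
  exact IFun_block hn0 s h γ.1

lemma meromorphicAt_completedZeta_affine (a b s : ℂ) :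
    MeromorphicAt (fun s => completedRiemannZeta (a * s + b)) s := by
  simp only [completedRiemannZeta_eq]
  have h1 : AnalyticAt ℂ (fun s => completedRiemannZeta₀ (a * s + b)) s :=
    Differentiable.analyticAt (differentiable_completedZeta₀.comp (by fun_prop)) s
  have h2 : MeromorphicAt (fun s => a * s + b) s := by fun_prop
  have h3 := h1.meromorphicAt
  fun_prop

lemma analyticAt_completedZeta_affine {a b s : ℂ} (h0 : a * s + b ≠ 0) (h1 : a * s + b ≠ 1) :
    AnalyticAt ℂ (fun s => completedRiemannZeta (a * s + b)) s := by
  -- The completed zeta function is an entire function minus `1/w` and `1/(1 - w)`, so `0` and `1`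
  -- are its only possible poles.
  simp only [completedRiemannZeta_eq]
  have h2 : AnalyticAt ℂ (fun s => completedRiemannZeta₀ (a * s + b)) s :=
    Differentiable.analyticAt (differentiable_completedZeta₀.comp (by fun_prop)) s
  refine (h2.sub (analyticAt_const.div (by fun_prop) h0)).sub
    (analyticAt_const.div (by fun_prop) (sub_ne_zero.mpr (Ne.symm h1)))

lemma differentiable_const_cpow_affine {c : ℝ} (hc : 0 < c) (a b : ℂ) :
    Differentiable ℂ fun s : ℂ => (c : ℂ) ^ (a * s + b) := fun s =>
  DifferentiableAt.const_cpow (by fun_prop) (Or.inl (by exact_mod_cast hc.ne'))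

lemma eisFun_eq (n : ℕ) (x : ℕ → ℕ → ℝ) (c : ℕ → ℝ) : eisFun n x c = fun s =>
    ((∏ j ∈ Finset.range n, c j : ℝ) : ℂ) ^ (1 * s + 0) *
      (∑ k ∈ Finset.range n, (∏ j ∈ Finset.Ico (k + 1) n, (c j : ℂ)⁻¹) *
        (2 * completedRiemannZeta (n * s + (-n + k + 1)) * (c k : ℂ) ^ (-n * s + -(-n + k + 1)) +
          besselSum x c k ((n * s + (-n + k)) / 2))) / completedRiemannZeta (n * s + 0) := by
  funext s
  rw [eisFun, complEpstein_eq]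
  congr 1
  · congr 1
    · ring_nf
    · refine Finset.sum_congr rfl fun k _ => ?_
      ring_nf
  · ring_nf

lemma meromorphicOn_eisFun {n : ℕ} (x : ℕ → ℕ → ℝ) {c : ℕ → ℝ} (hc : ∀ j < n, 0 < c j) :
    MeromorphicOn (eisFun n x c) univ := by
  intro s _
  rw [eisFun_eq]
  have hD : 0 < ∏ j ∈ Finset.range n, c j :=
    Finset.prod_pos fun j hj => hc j (Finset.mem_range.mp hj)
  refine MeromorphicAt.div (MeromorphicAt.mul
    ((differentiable_const_cpow_affine hD 1 0).analyticAt s).meromorphicAt ?_)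
    (meromorphicAt_completedZeta_affine _ _ s)
  refine MeromorphicAt.fun_sum fun k hk => ?_
  have hk : k < n := Finset.mem_range.mp hk
  refine (MeromorphicAt.const _ _).mul (((MeromorphicAt.const _ _).mul
    (meromorphicAt_completedZeta_affine _ _ s)).mul
    ((differentiable_const_cpow_affine (hc k hk) _ _).analyticAt s).meromorphicAt |>.add ?_)
  exact (Differentiable.analyticAt ((differentiable_besselSum x
    (fun j hj => hc j (hj.trans_lt hk))).comp (by fun_prop)) s).meromorphicAt

/-- The zeta value of index `k` can have a pole only for `ns = n - k - 1` or `ns = n - k`; over `k <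
n` these are the excluded values `0, …, n`. The denominator accounts for the condition on `ξ(ns)`.
-/
lemma analyticAt_eisFun {n : ℕ} (hn : 0 < n) (x : ℕ → ℕ → ℝ) {c : ℕ → ℝ} (hc : ∀ j < n, 0 < c j)
    {s : ℂ} (hs : ∀ j : ℕ, j ≤ n → (n : ℂ) * s ≠ j) (hξ : completedRiemannZeta (n * s) ≠ 0) :
    AnalyticAt ℂ (eisFun n x c) s := by
  rw [eisFun_eq]
  have hD : 0 < ∏ j ∈ Finset.range n, c j :=
    Finset.prod_pos fun j hj => hc j (Finset.mem_range.mp hj)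
  have h0 := hs 0 (by omega)
  have h1 := hs 1 (by omega)
  refine AnalyticAt.div (AnalyticAt.mul
    ((differentiable_const_cpow_affine hD 1 0).analyticAt s) ?_)
    (analyticAt_completedZeta_affine (by simpa using h0) (by simpa using h1)) (by simpa using hξ)
  refine Finset.analyticAt_fun_sum _ fun k hk => ?_
  have hk : k < n := Finset.mem_range.mp hk
  have h2 := hs (n - (k + 1)) (by omega)
  have h3 := hs (n - k) (by omega)
  rw [Nat.cast_sub (by omega)] at h2 h3
  push_cast at h2 h3
  refine analyticAt_const.mul (((analyticAt_const.mul
    (analyticAt_completedZeta_affine ?_ ?_)).mul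
    ((differentiable_const_cpow_affine (hc k hk) _ _).analyticAt s)).add ?_)
  · exact fun h => h2 (by linear_combination h)
  · exact fun h => h3 (by linear_combination h)
  exact Differentiable.analyticAt ((differentiable_besselSum x
    (fun j hj => hc j (hj.trans_lt hk))).comp (by fun_prop)) s

lemma analyticAt_eisFun_of_one_lt {n : ℕ} (hn : 0 < n) (x : ℕ → ℕ → ℝ) {c : ℕ → ℝ}
    (hc : ∀ j < n, 0 < c j) {s : ℂ} (hs : 1 < s.re) : AnalyticAt ℂ (eisFun n x c) s := by
  have hn1 : (1 : ℝ) ≤ n := by exact_mod_cast hn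
  have hre : ((n : ℂ) * s).re = n * s.re := by simp
  refine analyticAt_eisFun hn x hc (fun j hj h => ?_) (completedRiemannZeta_ne_zero ?_)
  · have h1 := congrArg Complex.re h
    rw [hre, Complex.natCast_re] at h1
    have : (j : ℝ) ≤ n := by exact_mod_cast hj
    nlinarith
  · rw [hre]
    nlinarith

/-- Passing to the normal form does not change the values for `Re s > 1`, where `eisFun` is analytic
already. -/
lemma exists_isDegenerateEisenstein {n : ℕ} (hn : 2 ≤ n) : ∃ E, IsDegenerateEisenstein n E := by
  choose! x c h using fun (z : Matrix (Fin n) (Fin n) ℝ) (hz : z.det ≠ 0) => exists_coords hz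
  refine ⟨fun z => toMeromorphicNFOn (eisFun n (x z) (c z)) univ, fun z hz =>
    ⟨meromorphicNFOn_toMeromorphicNFOn _ _, fun s hs T hT => ?_⟩⟩
  have hc := h z hz
  have hm := meromorphicOn_eisFun (x z) hc.1
  have ha := analyticAt_eisFun_of_one_lt (by omega) (x z) hc.1 hs
  have h1 := hm.toMeromorphicNFOn_eq_self_on_nhdsNE (mem_univ s)
  have h2 := (MeromorphicNFAt.eventuallyEq_nhdsNE_iff_eventuallyEq_nhds ha.meromorphicNFAt
    (meromorphicNFOn_toMeromorphicNFOn (eisFun n (x z) (c z)) univ (mem_univ s))).mp h1.symm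
  simp only [← h2.self_of_nhds]
  exact hasSum_IFun hn hc hs hT

lemma exists_isComplement (n : ℕ) : ∃ T : Set (Matrix.SpecialLinearGroup (Fin n) ℤ),
    Subgroup.IsComplement (P n : Set (Matrix.SpecialLinearGroup (Fin n) ℤ)) T := by
  obtain ⟨T, hT, _⟩ := (P n).exists_isComplement_right 1
  exact ⟨T, hT⟩

/-- The values of the Eisenstein series at its regular points. -/
theorem IsDegenerateEisenstein.eventuallyEq {n : ℕ} (hn : 2 ≤ n)
    {E : Matrix (Fin n) (Fin n) ℝ → ℂ → ℂ} (hE : IsDegenerateEisenstein n E)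
    {s : ℂ} (hs : ∀ j : ℕ, j ≤ n → (n : ℂ) * s ≠ j) (hξ : completedRiemannZeta (n * s) ≠ 0)
    {z : Matrix (Fin n) (Fin n) ℝ} {x : ℕ → ℕ → ℝ} {c : ℕ → ℝ} (h : Coords n z x c) :
    E z =ᶠ[𝓝 s] eisFun n x c := by
  have hz : z.det ≠ 0 := fun h0 => by
    have := h.abs_det
    rw [h0, abs_zero] at this
    exact h.prod_pos.ne this
  obtain ⟨hNF, hsum⟩ := hE z hz
  have hm := meromorphicOn_eisFun x h.1
  have ha := analyticAt_eisFun (by omega) x h.1 hs hξ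
  refine (MeromorphicNFAt.eventuallyEq_nhdsNE_iff_eventuallyEq_nhds (hNF (mem_univ s))
    ha.meromorphicNFAt).mp ?_
  obtain ⟨T, hT⟩ := exists_isComplement n
  have hd : MeromorphicOn (E z - eisFun n x c) univ := hNF.meromorphicOn.sub hm
  -- Near `2` both functions are sums of the same convergent series. Infinite order of vanishing of
  -- the difference then spreads from `2` to `s`, as `ℂ` is connected.
  have htop2 : meromorphicOrderAt (E z - eisFun n x c) 2 = ⊤ := by
    rw [meromorphicOrderAt_eq_top_iff]
    refine Filter.Eventually.filter_mono nhdsWithin_le_nhds ?_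
    have hopen : IsOpen {s : ℂ | 1 < s.re} := isOpen_lt continuous_const Complex.continuous_re
    filter_upwards [hopen.mem_nhds (show (2 : ℂ) ∈ {s : ℂ | 1 < s.re} by simp)] with t ht
    rw [Pi.sub_apply, (hsum t ht T hT).unique (hasSum_IFun hn h ht hT), sub_self]
  have htop : meromorphicOrderAt (E z - eisFun n x c) s = ⊤ := by
    by_contra hne
    exact (hd.exists_meromorphicOrderAt_ne_top_iff_forall isConnected_univ).mp
      ⟨⟨s, mem_univ s⟩, hne⟩ ⟨2, mem_univ 2⟩ htop2
  rw [meromorphicOrderAt_eq_top_iff] at htop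
  filter_upwards [htop] with t ht
  exact sub_eq_zero.mp ht

/-! ### Left translation by unipotent matrices -/

/-- The entry of index `(i, l)` of the unipotent matrix with coordinates `u`. -/
def unipEntry (u : ℕ → ℕ → ℝ) (i l : ℕ) : ℝ := if i < l then u i l else if i = l then 1 else 0

/-- The coordinates of the product of two unipotent matrices. -/
def unipMul (u x : ℕ → ℕ → ℝ) (i j : ℕ) : ℝ :=
  u i j + ∑ l ∈ Finset.range (j - 1), unipEntry u i (l + 1) * x (l + 1) j

lemma unip_apply {n : ℕ} (u : ℕ → ℕ → ℝ) (a b : Fin n) :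
    unip n u a b = unipEntry u (a + 1) (b + 1) := by
  simp [unip, unipEntry, Fin.ext_iff]

lemma colDot_unipMul (u x : ℕ → ℕ → ℝ) {k : ℕ} (a : Fin k → ℝ) :
    colDot (unipMul u x) k a = colDot u k a + colDot x k (a ᵥ* unip k u) := by
  simp only [colDot, unipMul, mul_add, Finset.sum_add_distrib, Nat.add_sub_cancel]
  congr 1
  simp only [Matrix.vecMul, dotProduct, unip_apply, Finset.sum_mul, Finset.mul_sum,
    Finset.sum_range]
  rw [Finset.sum_comm]
  exact Finset.sum_congr rfl fun _ _ => Finset.sum_congr rfl fun _ _ => by ring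

lemma vecMul_unip_snoc (x : ℕ → ℕ → ℝ) {k : ℕ} (v : Fin k → ℝ) (t : ℝ) :
    (Fin.snoc v t : Fin (k + 1) → ℝ) ᵥ* unip (k + 1) x =
      (Fin.snoc (v ᵥ* unip k x) (t + colDot x k v) : Fin (k + 1) → ℝ) := by
  funext i
  refine Fin.lastCases ?_ (fun j => ?_) i
  · rw [vecMul_unip_snoc_last, Fin.snoc_last]
  · rw [vecMul_unip_snoc_castSucc, Fin.snoc_castSucc]

/-- With `Coords.unip_mul` this shows that translation by `u` changes only the unipotent coordinates
and leaves the scales `c` as they are. -/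
lemma quadForm_unipMul (u x : ℕ → ℕ → ℝ) (c : ℕ → ℝ) {k : ℕ} (v : Fin k → ℝ) :
    quadForm (unipMul u x) c k v = quadForm x c k (v ᵥ* unip k u) := by
  induction k with
  | zero => simp [quadForm]
  | succ k ih =>
    obtain ⟨a, t, rfl⟩ : ∃ (a : Fin k → ℝ) (t : ℝ), (Fin.snoc a t : Fin (k + 1) → ℝ) = v :=
      ⟨Fin.init v, v (Fin.last k), Fin.snoc_init_self v⟩
    rw [vecMul_unip_snoc, quadForm_snoc, quadForm_snoc, ih, colDot_unipMul, add_assoc]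

lemma Coords.unip_mul {n : ℕ} {z : Matrix (Fin n) (Fin n) ℝ} {x : ℕ → ℕ → ℝ} {c : ℕ → ℝ}
    (h : Coords n z x c) (u : ℕ → ℕ → ℝ) : Coords n (unip n u * z) (unipMul u x) c := by
  have h2 (v : Fin n → ℝ) : (v ᵥ* (unip n u * z)) ⬝ᵥ (v ᵥ* (unip n u * z)) =
      quadForm (unipMul u x) c n v := by
    rw [← Matrix.vecMul_vecMul, quadForm_unipMul]
    exact h.2 (v ᵥ* unip n u)
  exact And.intro h.1 h2

lemma coords_unip_mul_torus {n : ℕ} (x : ℕ → ℕ → ℝ) {y : ℕ → ℝ}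
    (hy : ∀ j ∈ Finset.Icc 1 (n - 1), 0 < y j) :
    Coords n (unip n x * torus n y) x (fun a => bigY y (n - a)) :=
  And.intro (fun j _ => bigY_pos hy (Nat.sub_le n j)) fun v => by
    rw [quadForm_eq_dot, coordMatrix, torus]

lemma unipMul_superdiag (u x : ℕ → ℕ → ℝ) {k : ℕ} (hk : 1 ≤ k) :
    unipMul u x k (k + 1) = u k (k + 1) + x k (k + 1) := by
  rw [unipMul, Nat.add_sub_cancel, Finset.sum_eq_single (k - 1)]
  · rw [Nat.sub_add_cancel hk]
    simp [unipEntry]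
  · intro l hl hne
    rw [Finset.mem_range] at hl
    rw [unipEntry, if_neg (by omega), if_neg (by omega), zero_mul]
  · intro h
    simp at h
    omega

lemma unipMul_congr {u u' : ℕ → ℕ → ℝ} (x : ℕ → ℕ → ℝ) {i j : ℕ}
    (h : ∀ l, l ≤ j → u i l = u' i l) : unipMul u x i j = unipMul u' x i j := by
  rw [unipMul, unipMul, h j le_rfl]
  congr 1
  refine Finset.sum_congr rfl fun l hl => ?_
  rw [Finset.mem_range] at hl
  rw [unipEntry, unipEntry, h (l + 1) (by omega)]

lemma continuous_ext (n i j : ℕ) : Continuous fun u : upperPairs n → ℝ => ext n u i j := by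
  unfold ext
  split_ifs <;> fun_prop

lemma continuous_unipMul_ext (n : ℕ) (x : ℕ → ℕ → ℝ) :
    Continuous fun u : upperPairs n → ℝ => unipMul (ext n u) x := by
  refine continuous_pi fun i => continuous_pi fun j => ?_
  refine (continuous_ext n i j).add (continuous_finsetSum _ fun l _ => Continuous.mul ?_ continuous_const)
  unfold unipEntry
  split_ifs
  · exact continuous_ext n _ _
  · exact continuous_const
  · exact continuous_const

lemma mem_upperPairs {n i j : ℕ} : (i, j) ∈ upperPairs n ↔ 1 ≤ i ∧ i < j ∧ j ≤ n := by
  simp only [upperPairs, Finset.mem_filter, Finset.mem_product, Finset.mem_Icc]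
  omega

lemma ext_update {n : ℕ} (u : upperPairs n → ℝ) {i j : ℕ} (h : (i, j) ∈ upperPairs n) (t : ℝ)
    (i' j' : ℕ) : ext n (Function.update u ⟨(i, j), h⟩ t) i' j' =
      ext n (Function.update u ⟨(i, j), h⟩ 0) i' j' + if i' = i ∧ j' = j then t else 0 := by
  unfold ext
  by_cases hp : i' = i ∧ j' = j
  · obtain ⟨rfl, rfl⟩ := hp
    simp [h]
  · rw [if_neg hp, add_zero]
    split_ifs with h1
    · have hne : (⟨(i', j'), h1⟩ : upperPairs n) ≠ ⟨(i, j), h⟩ := by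
        simpa using hp
      rw [Function.update_of_ne hne, Function.update_of_ne hne]
    · rfl

/-! ### Integrals against characters over the unit cube -/

/-- The character of index `m`. -/
def chr (n : ℕ) (m : ℕ → ℤ) (u : upperPairs n → ℝ) : ℂ :=
  e (-∑ k ∈ Finset.Icc 1 (n - 1), (m k : ℝ) * ext n u k (k + 1))

lemma continuous_chr (n : ℕ) (m : ℕ → ℤ) : Continuous (chr n m) :=
  continuous_e.comp (continuous_finsetSum _ fun k _ =>
    continuous_const.mul (continuous_ext n k (k + 1))).neg

lemma chr_update {n : ℕ} (m : ℕ → ℤ) (u : upperPairs n → ℝ) {i j : ℕ}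
    (h : (i, j) ∈ upperPairs n) (t : ℝ) :
    chr n m (Function.update u ⟨(i, j), h⟩ t) = chr n m (Function.update u ⟨(i, j), h⟩ 0) *
      e (((-(if j = i + 1 then m i else 0) : ℤ) : ℝ) * t) := by
  rw [chr, chr, ← e_add]
  congr 1
  simp only [ext_update u h t, mul_add, Finset.sum_add_distrib]
  rw [neg_add]
  congr 1
  have h' := mem_upperPairs.mp h
  rw [Finset.sum_eq_single i]
  · by_cases hj : j = i + 1
    · simp [hj]
    · simp [hj, Ne.symm hj]
  · intro b _ hb
    simp [hb]
  · intro hi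
    rw [Finset.mem_Icc] at hi
    have : ¬ (i + 1 = j) := by omega
    simp [this]

lemma integral_e_eq_zero {l : ℤ} (hl : l ≠ 0) : ∫ t in Icc (0 : ℝ) 1, e (l * t) = 0 := by
  rw [integral_Icc_eq_integral_Ioc, ← intervalIntegral.integral_of_le zero_le_one]
  have hne : 2 * (Real.pi : ℂ) * Complex.I * l ≠ 0 := by
    simp [Real.pi_ne_zero, hl]
  have h := integral_exp_mul_complex (a := 0) (b := 1) hne
  have h1 : ∀ t : ℝ, e (l * t) = Complex.exp (2 * (Real.pi : ℂ) * Complex.I * l * t) := by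
    intro t
    rw [e]
    push_cast
    ring_nf
  simp only [h1, h]
  have h2 := e_intCast l
  rw [e] at h2
  push_cast at h2
  simp [h2]

lemma integral_pi_e_eq_zero {ι : Type*} [Fintype ι] {l : ℤ} (hl : l ≠ 0) (q : ι) :
    ∫ a : ι → ℝ, e (l * a q) ∂(Measure.pi fun _ => volume.restrict (Icc (0 : ℝ) 1)) = 0 := by
  have hp : IsProbabilityMeasure (volume.restrict (Icc (0 : ℝ) 1)) := ⟨by simp⟩
  have h := integral_comp_eval (X := fun _ : ι => ℝ) (E := ℂ)
    (μ := fun _ => volume.restrict (Icc (0 : ℝ) 1)) (i := q) (f := fun t : ℝ => e (l * t))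
    (continuous_e.comp (continuous_const.mul continuous_id)).aestronglyMeasurable
  exact h.trans (integral_e_eq_zero hl)

/-- The integral of a function with a nontrivial character in one variable vanishes. -/
lemma integral_eq_zero_of_update {ι : Type*} [Fintype ι] [DecidableEq ι] (h : (ι → ℝ) → ℂ) (p : ι)
    {l : ℤ} (hl : l ≠ 0)
    (hh : ∀ u t, h (Function.update u p t) = h (Function.update u p 0) * e (l * t)) :
    ∫ u in Icc (0 : ι → ℝ) 1, h u = 0 := by
  let μ : ι → Measure ℝ := fun _ => volume.restrict (Icc 0 1)
  have hprob : ∀ i, IsProbabilityMeasure (μ i) := fun i => ⟨by simp [μ]⟩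
  have hμ : (volume : Measure (ι → ℝ)).restrict (Icc (0 : ι → ℝ) 1) = Measure.pi μ := by
    rw [← Set.pi_univ_Icc, volume_pi, Measure.restrict_pi_pi]
    rfl
  rw [hμ]
  -- No integrability is assumed: the integral of a non-integrable function is `0` by convention.
  -- Otherwise Fubini splits off the coordinate `p`, over which the character integrates to zero.
  by_cases hi : Integrable h (Measure.pi μ)
  swap
  · exact integral_undef hi
  have hmp := (measurePreserving_piEquivPiSubtypeProd μ (fun i => i = p)).symm
  rw [← hmp.integral_comp (MeasurableEquiv.measurableEmbedding _)]
  have hi' := (hmp.integrable_comp_emb (MeasurableEquiv.measurableEmbedding _)).mpr hi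
  rw [integral_prod_symm (fun q => h ((MeasurableEquiv.piEquivPiSubtypeProd _ _).symm q)) hi']
  refine integral_eq_zero_of_ae (Eventually.of_forall fun b => ?_)
  set E := (MeasurableEquiv.piEquivPiSubtypeProd (fun _ : ι => ℝ) (fun i => i = p)).symm
  have hE (a : {i // i = p} → ℝ) : E (a, b) = Function.update (E (0, b)) p (a ⟨p, rfl⟩) := by
    funext i
    by_cases hip : i = p
    · subst hip
      simp [E, MeasurableEquiv.piEquivPiSubtypeProd, Equiv.piEquivPiSubtypeProd]
    · rw [Function.update_of_ne hip]
      simp [E, MeasurableEquiv.piEquivPiSubtypeProd, Equiv.piEquivPiSubtypeProd, hip]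
  have h1 (a : {i // i = p} → ℝ) : h (E (a, b)) =
      h (Function.update (E (0, b)) p 0) * e (l * a ⟨p, rfl⟩) := by
    rw [hE, hh]
  simp only [h1, Pi.zero_apply]
  rw [integral_const_mul]
  refine mul_eq_zero_of_right _ ?_
  convert! integral_pi_e_eq_zero hl (⟨p, rfl⟩ : {i // i = p})

open Classical in
lemma integral_chr (n : ℕ) (m : ℕ → ℤ) : ∫ u in Icc (0 : upperPairs n → ℝ) 1, chr n m u =
    if ∀ j ∈ Finset.Icc 1 (n - 1), m j = 0 then 1 else 0 := by
  split_ifs with h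
  · have h1 : ∀ u, chr n m u = 1 := fun u => by
      rw [chr, Finset.sum_eq_zero fun k hk => by simp [h k hk], neg_zero, e_zero]
    simp only [h1]
    simp [Measure.real, Real.volume_Icc_pi]
  · push Not at h
    obtain ⟨j, hj, hm⟩ := h
    rw [Finset.mem_Icc] at hj
    refine integral_eq_zero_of_update _ ⟨(j, j + 1), mem_upperPairs.mpr (by omega)⟩
      (neg_ne_zero.mpr hm) fun u t => ?_
    rw [chr_update, if_pos rfl]

section Terms

variable {n : ℕ} (x : ℕ → ℕ → ℝ) (c : ℕ → ℝ) {k : ℕ} (ν : ℂ) (m : ℕ → ℤ)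

/-- Adding `t` to `u_{i+1,k+1}` adds `t` to the entry `(i+1, k+1)` of the product and affects no
other entry of the columns up to `k + 1`. The quadratic form sees only the first `k` columns; the
phase changes by `m' a_i t`. -/
lemma besselTerm_update (a : Fin k → ℤ) (m' : ℤ) (i : Fin k)
    (h : ((i : ℕ) + 1, k + 1) ∈ upperPairs n) (u : upperPairs n → ℝ) (t : ℝ) :
    besselTerm (unipMul (ext n (Function.update u ⟨_, h⟩ t)) x) c k ν a m' =
      besselTerm (unipMul (ext n (Function.update u ⟨_, h⟩ 0)) x) c k ν a m' *
        e (((m' * a i : ℤ) : ℝ) * t) := by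
  have hlow : ∀ i' j', j' ≤ k → unipMul (ext n (Function.update u ⟨_, h⟩ t)) x i' j' =
      unipMul (ext n (Function.update u ⟨_, h⟩ 0)) x i' j' := fun i' j' hj' =>
    unipMul_congr x fun l hl => by
      rw [ext_update u h t, if_neg (by omega), add_zero]
  have hcol : colDot (unipMul (ext n (Function.update u ⟨_, h⟩ t)) x) k (toReal a) =
      colDot (unipMul (ext n (Function.update u ⟨_, h⟩ 0)) x) k (toReal a) + a i * t := by
    have h1 : ∀ i', unipMul (ext n (Function.update u ⟨_, h⟩ t)) x i' (k + 1) =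
        unipMul (ext n (Function.update u ⟨_, h⟩ 0)) x i' (k + 1) +
          if i' = (i : ℕ) + 1 then t else 0 := by
      intro i'
      rw [unipMul, unipMul, ext_update u h t]
      simp only [and_true]
      rw [add_right_comm]
      congr 2
      refine Finset.sum_congr rfl fun l hl => ?_
      rw [Finset.mem_range] at hl
      rw [unipEntry, unipEntry, ext_update u h t, if_neg (c := i' = _ ∧ _) (by omega), add_zero]
    simp only [colDot, h1, mul_add, Finset.sum_add_distrib]
    congr 1
    rw [Finset.sum_eq_single i]
    · simp [toReal]
    · intro b _ hb
      have : ¬ ((b : ℕ) = i) := fun h => hb (Fin.ext h)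
      simp [this]
    · simp
  rw [besselTerm, besselTerm, quadForm_congr (fun i' j' _ _ hj => hlow i' j' hj) (fun _ _ => rfl),
    hcol, mul_add, e_add]
  push_cast
  ring_nf

lemma toReal_smul_single {k : ℕ} (d : ℤ) : toReal (Pi.single (Fin.last k) d : Fin (k + 1) → ℤ) =
    (Fin.snoc (0 : Fin k → ℝ) (d : ℝ) : Fin (k + 1) → ℝ) := by
  funext i
  refine Fin.lastCases ?_ (fun j => ?_) i
  · simp [toReal]
  · simp [toReal, (Fin.castSucc_lt_last j).ne]

lemma quadForm_single (k : ℕ) (d : ℤ) :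
    quadForm x c (k + 1) (toReal (Pi.single (Fin.last k) d)) = (d * c k) ^ 2 := by
  rw [toReal_smul_single, quadForm_snoc]
  simp
  ring

lemma colDot_single (k : ℕ) (d : ℤ) :
    colDot x (k + 1) (toReal (Pi.single (Fin.last k) d)) = d * x (k + 1) (k + 2) := by
  simp [toReal_smul_single, colDot, Fin.sum_univ_castSucc]

-- If some component of `m' a` differs from that of `(0, …, 0, m_k)`, the integral over the matching
-- entry of column `k + 1` vanishes. Otherwise `a` lies on the last axis, so the term depends on `u`
-- only through one superdiagonal entry, where it cancels the character; what is left is the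
-- integral of the character with `m_k` removed.
open Classical in
lemma integral_besselTerm_mul_chr (hk : k < n) (a : NZ k) (m' : NZInt) :
    ∫ u in Icc (0 : upperPairs n → ℝ) 1,
      besselTerm (unipMul (ext n u) x) c k ν a m' * chr n m u =
    if (∀ i : Fin k, m'.1 * a.1 i = if (i : ℕ) + 1 = k then m k else 0) ∧
      (∀ j ∈ Finset.Icc 1 (n - 1), j ≠ k → m j = 0) then besselTerm x c k ν a m' else 0 := by
  by_cases h1 : ∀ i : Fin k, m'.1 * a.1 i = if (i : ℕ) + 1 = k then m k else 0
  swap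
  · rw [if_neg fun h => h1 h.1]
    push Not at h1
    obtain ⟨i, hi⟩ := h1
    have hik := i.isLt
    have hp : ((i : ℕ) + 1, k + 1) ∈ upperPairs n := mem_upperPairs.mpr (by omega)
    refine integral_eq_zero_of_update _ ⟨_, hp⟩ (sub_ne_zero.mpr hi) fun u t => ?_
    rw [besselTerm_update x c ν a.1 m'.1 i hp, chr_update]
    have h2 : (if k + 1 = (i : ℕ) + 1 + 1 then m ((i : ℕ) + 1) else 0) =
        if (i : ℕ) + 1 = k then m k else 0 := by
      by_cases h3 : (i : ℕ) + 1 = k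
      · simp [h3]
      · rw [if_neg h3, if_neg (by omega)]
    rw [h2, Int.cast_sub, sub_mul, sub_eq_add_neg, e_add]
    push_cast
    ring_nf
  · obtain ⟨k, rfl⟩ : ∃ k', k = k' + 1 := Nat.exists_eq_succ_of_ne_zero (by
      rintro rfl
      exact a.2 (Subsingleton.elim _ _))
    have hm' := m'.2
    obtain ⟨d, hd⟩ : ∃ d, a.1 = Pi.single (Fin.last k) d := by
      refine ⟨a.1 (Fin.last k), ?_⟩
      funext i
      refine Fin.lastCases ?_ (fun j => ?_) i
      · simp
      · have := h1 j.castSucc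
        have hj := j.isLt
        simp [hm', hj.ne] at this
        simp [this, (Fin.castSucc_lt_last j).ne]
    have hmd : m'.1 * d = m (k + 1) := by
      have := h1 (Fin.last k)
      simpa [hd] using this
    -- On the last axis the form is `(d c_k)²`, independent of `u`, and the phase is `M` times a
    -- superdiagonal entry; these entries add up in a product of unipotent matrices.
    have h2 (u : upperPairs n → ℝ) : besselTerm (unipMul (ext n u) x) c (k + 1) ν a m' * chr n m u =
        besselTerm x c (k + 1) ν a m' * chr n (Function.update m (k + 1) 0) u := by
      have h3 : chr n (Function.update m (k + 1) 0) u =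
          chr n m u * e (m (k + 1) * ext n u (k + 1) (k + 2)) := by
        rw [chr, chr, ← e_add]
        congr 1
        rw [← Finset.add_sum_erase _ _ (show k + 1 ∈ Finset.Icc 1 (n - 1) by
          rw [Finset.mem_Icc]; omega), ← Finset.add_sum_erase _ (fun j => (m j : ℝ) * _)
          (show k + 1 ∈ Finset.Icc 1 (n - 1) by rw [Finset.mem_Icc]; omega),
          Finset.sum_congr rfl fun j hj => by
            rw [Function.update_of_ne (Finset.ne_of_mem_erase hj)]]
        simp
      rw [besselTerm, besselTerm, hd, quadForm_single, quadForm_single, colDot_single, colDot_single,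
        unipMul_superdiag _ _ (by omega), h3, ← hmd, mul_add, mul_add, e_add]
      push_cast
      ring_nf
    simp only [h2]
    rw [integral_const_mul, integral_chr]
    have h4 : (∀ j ∈ Finset.Icc 1 (n - 1), Function.update m (k + 1) 0 j = 0) ↔
        ∀ j ∈ Finset.Icc 1 (n - 1), j ≠ k + 1 → m j = 0 := by
      refine forall₂_congr fun j _ => ?_
      by_cases hj : j = k + 1
      · simp [hj]
      · simp [hj]
    simp only [h4, h1, implies_true, true_and]
    split_ifs <;> simp

end Terms

/-! ### Fourier coefficients of the Eisenstein series -/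

open Classical in
/-- The sum of the terms of the Bessel sum whose frequency is the vector `v`. -/
def fiberSum (x : ℕ → ℕ → ℝ) (c : ℕ → ℝ) (k : ℕ) (ν : ℂ) (v : Fin k → ℤ) : ℂ :=
  ∑' p : NZ k × NZInt, if p.2.1 • p.1.1 = v then besselTerm x c k ν p.1 p.2 else 0

/-- The vector `(0, …, 0, M)`. -/
def lastVec (k : ℕ) (M : ℤ) : Fin k → ℤ := fun i => if (i : ℕ) + 1 = k then M else 0

/-- The product of the inverse scales of the columns after the column `k + 1`. -/
def tailProd (n : ℕ) (c : ℕ → ℝ) (k : ℕ) : ℂ := ∏ j ∈ Finset.Ico (k + 1) n, (c j : ℂ)⁻¹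

/-- The factor in front of the expansion of the Eisenstein series. -/
def eisScale (n : ℕ) (c : ℕ → ℝ) (s : ℂ) : ℂ :=
  ((∏ j ∈ Finset.range n, c j : ℝ) : ℂ) ^ s / completedRiemannZeta (n * s)

/-- The constant term attached to the column `k + 1`. -/
def constPart (n : ℕ) (c : ℕ → ℝ) (k : ℕ) (s : ℂ) : ℂ :=
  2 * completedRiemannZeta (n * s - n + k + 1) * (c k : ℂ) ^ (-(n * s - n + k + 1))

lemma eisFun_expansion (n : ℕ) (x : ℕ → ℕ → ℝ) (c : ℕ → ℝ) (s : ℂ) :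
    eisFun n x c s = eisScale n c s * ∑ k ∈ Finset.range n, tailProd n c k *
      (constPart n c k s + besselSum x c k ((n * s - n + k) / 2)) := by
  rw [eisFun, complEpstein_eq, eisScale, mul_div_right_comm]
  rfl

lemma isCompact_unipMul_image (n : ℕ) (x : ℕ → ℕ → ℝ) :
    IsCompact ((fun u : upperPairs n → ℝ => unipMul (ext n u) x) '' Icc 0 1) :=
  isCompact_Icc.image (continuous_unipMul_ext n x)

lemma continuousOn_besselSum_unipMul {n : ℕ} (x : ℕ → ℕ → ℝ) {c : ℕ → ℝ} (hc : ∀ j < n, 0 < c j)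
    {k : ℕ} (hk : k < n) (ν : ℂ) :
    ContinuousOn (fun u : upperPairs n → ℝ => besselSum (unipMul (ext n u) x) c k ν) (Icc 0 1) :=
  (continuousOn_besselSum (isCompact_unipMul_image n x) (fun j hj => hc j (hj.trans_lt hk)) ν).comp
    (continuous_unipMul_ext n x).continuousOn (mapsTo_image _ _)

lemma integrableOn_besselSum_mul_chr {n : ℕ} (x : ℕ → ℕ → ℝ) {c : ℕ → ℝ}
    (hc : ∀ j < n, 0 < c j) {k : ℕ} (hk : k < n) (ν : ℂ) (m : ℕ → ℤ) :
    IntegrableOn (fun u : upperPairs n → ℝ => besselSum (unipMul (ext n u) x) c k ν * chr n m u)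
      (Icc 0 1) :=
  ((continuousOn_besselSum_unipMul x hc hk ν).mul
    (continuous_chr n m).continuousOn).integrableOn_compact isCompact_Icc

-- The bound on the Bessel terms is uniform over the compact cube, so the sum may be integrated term
-- by term; the surviving terms are those of frequency `lastVec k (m k)`.
open Classical in
lemma integral_besselSum_mul_chr {n : ℕ} (x : ℕ → ℕ → ℝ) {c : ℕ → ℝ} (hc : ∀ j < n, 0 < c j)
    {k : ℕ} (hk : k < n) (ν : ℂ) (m : ℕ → ℤ) :
    ∫ u in Icc (0 : upperPairs n → ℝ) 1, besselSum (unipMul (ext n u) x) c k ν * chr n m u =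
      if ∀ j ∈ Finset.Icc 1 (n - 1), j ≠ k → m j = 0 then fiberSum x c k ν (lastVec k (m k))
      else 0 := by
  have hc' : ∀ j ≤ k, 0 < c j := fun j hj => hc j (hj.trans_lt hk)
  obtain ⟨b, hb, hbound⟩ := exists_besselTerm_bound (isCompact_unipMul_image n x) hc' |ν.re|
  have hb' : ∀ u ∈ Icc (0 : upperPairs n → ℝ) 1, ∀ p : NZ k × NZInt,
      ‖besselTerm (unipMul (ext n u) x) c k ν p.1 p.2 * chr n m u‖ ≤ b p := fun u hu p => by
    rw [norm_mul, chr, norm_e, mul_one]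
    exact hbound _ (mem_image_of_mem _ hu) ν le_rfl p
  have h := hasSum_integral_of_dominated_convergence (μ := volume.restrict (Icc 0 1))
    (F := fun (p : NZ k × NZInt) (u : upperPairs n → ℝ) =>
      besselTerm (unipMul (ext n u) x) c k ν p.1 p.2 * chr n m u)
    (f := fun u => besselSum (unipMul (ext n u) x) c k ν * chr n m u)
    (fun p _ => b p)
    (fun p => (((continuous_besselTerm hc' ν p).comp (continuous_unipMul_ext n x)).mul
      (continuous_chr n m)).aestronglyMeasurable)
    (fun p => by
      filter_upwards [ae_restrict_mem measurableSet_Icc] with u hu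
      exact hb' u hu p)
    (Eventually.of_forall fun _ => hb)
    (integrableOn_const isCompact_Icc.measure_lt_top.ne)
    (Eventually.of_forall fun u => (summable_besselTerm _ hc' ν).hasSum.mul_right _)
  rw [← h.tsum_eq]
  simp only [integral_besselTerm_mul_chr x c ν m hk]
  split_ifs with h1
  · refine tsum_congr fun p => ?_
    have h2 : (∀ i : Fin k, p.2.1 * p.1.1 i = if (i : ℕ) + 1 = k then m k else 0) ↔
        p.2.1 • p.1.1 = lastVec k (m k) := by
      rw [funext_iff]
      rfl
    simp only [h2, and_iff_left h1]
  · refine (tsum_congr fun p => ?_).trans tsum_zero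
    exact if_neg fun h2 => h1 h2.2

open Classical in
/-- The Fourier coefficients of the Eisenstein series. -/
theorem fourierCoeff_eq {n : ℕ} (hn : 2 ≤ n) {E : Matrix (Fin n) (Fin n) ℝ → ℂ → ℂ}
    (hE : IsDegenerateEisenstein n E) {s : ℂ} (hs : ∀ j : ℕ, j ≤ n → (n : ℂ) * s ≠ j)
    (hξ : completedRiemannZeta (n * s) ≠ 0) {z : Matrix (Fin n) (Fin n) ℝ} {x : ℕ → ℕ → ℝ}
    {c : ℕ → ℝ} (h : Coords n z x c) (m : ℕ → ℤ) :
    fourierCoeff n (fun g => E g s) m z = eisScale n c s * ∑ k ∈ Finset.range n, tailProd n c k *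
      ((if ∀ j ∈ Finset.Icc 1 (n - 1), m j = 0 then constPart n c k s else 0) +
        if ∀ j ∈ Finset.Icc 1 (n - 1), j ≠ k → m j = 0 then
          fiberSum x c k ((n * s - n + k) / 2) (lastVec k (m k)) else 0) := by
  have hval (u : upperPairs n → ℝ) : E (unip n (ext n u) * z) s =
      eisFun n (unipMul (ext n u) x) c s :=
    (hE.eventuallyEq hn hs hξ (h.unip_mul (ext n u))).self_of_nhds
  have hchr : IntegrableOn (chr n m) (Icc 0 1) :=
    (continuous_chr n m).continuousOn.integrableOn_compact isCompact_Icc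
  rw [fourierCoeff]
  change ∫ u in Icc (0 : upperPairs n → ℝ) 1, E (unip n (ext n u) * z) s * chr n m u = _
  simp only [hval, eisFun_expansion, mul_assoc, Finset.sum_mul, add_mul]
  rw [integral_const_mul, integral_finsetSum]
  · congr 1
    refine Finset.sum_congr rfl fun k hk => ?_
    have hk : k < n := Finset.mem_range.mp hk
    rw [integral_const_mul, integral_add (hchr.const_mul _)
      (integrableOn_besselSum_mul_chr x h.1 hk _ m), integral_const_mul, integral_chr,
      integral_besselSum_mul_chr x h.1 hk]
    simp
  · intro k hk
    have hk : k < n := Finset.mem_range.mp hk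
    exact ((hchr.const_mul _).add (integrableOn_besselSum_mul_chr x h.1 hk _ m)).const_mul _

lemma integrableOn_eisenstein {n : ℕ} (hn : 2 ≤ n) {E : Matrix (Fin n) (Fin n) ℝ → ℂ → ℂ}
    (hE : IsDegenerateEisenstein n E) {s : ℂ} (hs : ∀ j : ℕ, j ≤ n → (n : ℂ) * s ≠ j)
    (hξ : completedRiemannZeta (n * s) ≠ 0) {z : Matrix (Fin n) (Fin n) ℝ} {x : ℕ → ℕ → ℝ}
    {c : ℕ → ℝ} (h : Coords n z x c) :
    IntegrableOn (fun u : upperPairs n → ℝ => E (unip n (ext n u) * z) s) (Icc 0 1) := by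
  have hval (u : upperPairs n → ℝ) : E (unip n (ext n u) * z) s =
      eisFun n (unipMul (ext n u) x) c s :=
    (hE.eventuallyEq hn hs hξ (h.unip_mul (ext n u))).self_of_nhds
  simp only [hval, eisFun_expansion]
  refine ContinuousOn.integrableOn_compact isCompact_Icc ?_
  refine continuousOn_const.mul (continuousOn_finsetSum _ fun k hk => continuousOn_const.mul ?_)
  exact continuousOn_const.add
    (continuousOn_besselSum_unipMul x h.1 (Finset.mem_range.mp hk) _)

/-- No term has frequency zero, since `m` and `a` are nonzero; so the Bessel sums do not enter the
constant term. -/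
lemma fiberSum_zero (x : ℕ → ℕ → ℝ) (c : ℕ → ℝ) (k : ℕ) (ν : ℂ) :
    fiberSum x c k ν (lastVec k 0) = 0 := by
  have h : ∀ p : NZ k × NZInt, ¬ p.2.1 • p.1.1 = lastVec k 0 := fun p hp => by
    have h0 : lastVec k 0 = 0 := by
      funext i
      simp [lastVec]
    rw [h0] at hp
    exact smul_ne_zero p.2.2 p.1.2 hp
  exact (tsum_congr fun p => if_neg (h p)).trans tsum_zero

lemma fourierCoeff_eq_zero {n : ℕ} (hn : 2 ≤ n) {E : Matrix (Fin n) (Fin n) ℝ → ℂ → ℂ}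
    (hE : IsDegenerateEisenstein n E) {s : ℂ} (hs : ∀ j : ℕ, j ≤ n → (n : ℂ) * s ≠ j)
    (hξ : completedRiemannZeta (n * s) ≠ 0) {z : Matrix (Fin n) (Fin n) ℝ} {x : ℕ → ℕ → ℝ}
    {c : ℕ → ℝ} (h : Coords n z x c) {m : ℕ → ℤ} {i j : ℕ} (hi : i ∈ Finset.Icc 1 (n - 1))
    (hj : j ∈ Finset.Icc 1 (n - 1)) (hij : i ≠ j) (hmi : m i ≠ 0) (hmj : m j ≠ 0) :
    fourierCoeff n (fun g => E g s) m z = 0 := by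
  rw [fourierCoeff_eq hn hE hs hξ h, Finset.sum_eq_zero, mul_zero]
  intro k _
  rw [if_neg fun h0 => hmi (h0 i hi), if_neg, add_zero, mul_zero]
  intro h0
  by_cases hik : i = k
  · exact hmj (h0 j hj fun hjk => hij (hik.trans hjk.symm))
  · exact hmi (h0 i hi hik)

lemma fourierCoeff_zero {n : ℕ} (hn : 2 ≤ n) {E : Matrix (Fin n) (Fin n) ℝ → ℂ → ℂ}
    (hE : IsDegenerateEisenstein n E) {s : ℂ} (hs : ∀ j : ℕ, j ≤ n → (n : ℂ) * s ≠ j)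
    (hξ : completedRiemannZeta (n * s) ≠ 0) {z : Matrix (Fin n) (Fin n) ℝ} {x : ℕ → ℕ → ℝ}
    {c : ℕ → ℝ} (h : Coords n z x c) :
    fourierCoeff n (fun g => E g s) 0 z =
      eisScale n c s * ∑ k ∈ Finset.range n, tailProd n c k * constPart n c k s := by
  rw [fourierCoeff_eq hn hE hs hξ h]
  congr 1
  refine Finset.sum_congr rfl fun k _ => ?_
  simp [fiberSum_zero]

lemma fourierCoeff_single {n : ℕ} (hn : 2 ≤ n) {E : Matrix (Fin n) (Fin n) ℝ → ℂ → ℂ}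
    (hE : IsDegenerateEisenstein n E) {s : ℂ} (hs : ∀ j : ℕ, j ≤ n → (n : ℂ) * s ≠ j)
    (hξ : completedRiemannZeta (n * s) ≠ 0) {z : Matrix (Fin n) (Fin n) ℝ} {x : ℕ → ℕ → ℝ}
    {c : ℕ → ℝ} (h : Coords n z x c) {k : ℕ} (hk : k ∈ Finset.Icc 1 (n - 1)) {M : ℤ}
    (hM : M ≠ 0) :
    fourierCoeff n (fun g => E g s) (single k M) z =
      eisScale n c s * (tailProd n c k *
        fiberSum x c k ((n * s - n + k) / 2) (lastVec k M)) := by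
  rw [fourierCoeff_eq hn hE hs hξ h]
  have hk' := Finset.mem_Icc.mp hk
  have hkk : single k M k = M := Pi.single_eq_same _ _
  have hne : ∀ j ∈ Finset.Icc 1 (n - 1), j ≠ k → single k M j = 0 :=
    fun j _ hj => Pi.single_eq_of_ne hj _
  rw [Finset.sum_eq_single k]
  · rw [if_neg fun h0 => hM (hkk ▸ h0 k hk), if_pos hne, hkk,
      zero_add]
  · intro l _ hl
    rw [if_neg fun h0 => hM (hkk ▸ h0 k hk), if_neg fun h0 => hM (hkk ▸ h0 k hk (Ne.symm hl)),
      add_zero, mul_zero]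
  · intro h0
    exact absurd (Finset.mem_range.mpr (by omega)) h0

/-- The frequency of a term of the Bessel sum. -/
def frequency {k : ℕ} (p : NZ k × NZInt) : NZ k := ⟨p.2.1 • p.1.1, smul_ne_zero p.2.2 p.1.2⟩

lemma hasSum_fiberSum (x : ℕ → ℕ → ℝ) {c : ℕ → ℝ} {k : ℕ} (hc : ∀ j ≤ k, 0 < c j) (ν : ℂ) :
    HasSum (fun v : NZ k => fiberSum x c k ν v) (besselSum x c k ν) := by
  have hT := summable_besselTerm x hc ν
  have h := (Equiv.sigmaFiberEquiv (frequency (k := k))).hasSum_iff.mpr hT.hasSum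
  refine HasSum.sigma h fun v => ?_
  have h1 := (h.summable.sigma_factor v).hasSum
  convert! h1 using 1
  rw [fiberSum]
  change _ = ∑' p : {p : NZ k × NZInt // p ∈ {p | frequency p = v}}, besselTerm x c k ν p.1.1 p.1.2
  rw [tsum_subtype {p : NZ k × NZInt | frequency p = v}
    (fun p => besselTerm x c k ν p.1 p.2)]
  refine tsum_congr fun p => ?_
  rw [indicator_apply]
  refine if_congr ?_ rfl rfl
  rw [mem_ofPred_eq, Subtype.ext_iff]
  rfl

/-! ### The action of `diag(γ, I)` -/

/-- The entries of `diag (γ, I)`. -/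
def blockEntry (k : ℕ) (γ : Matrix.SpecialLinearGroup (Fin k) ℤ) (a b : ℕ) : ℝ :=
  if h : a < k ∧ b < k then ((γ ⟨a, h.1⟩ ⟨b, h.2⟩ : ℤ) : ℝ) else if a = b then 1 else 0

lemma block_apply (k n : ℕ) (γ : Matrix.SpecialLinearGroup (Fin k) ℤ) (a b : Fin n) :
    block k n γ a b = blockEntry k γ a b := by
  simp [block, blockEntry, Fin.ext_iff]

/-- The action of `γ` on the columns of `x` after the column `k`. -/
def blockMul (k : ℕ) (γ : Matrix.SpecialLinearGroup (Fin k) ℤ) (x x₀ : ℕ → ℕ → ℝ) (i j : ℕ) : ℝ :=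
  if j ≤ k then x₀ i j else ∑ l ∈ Finset.range (j - 1), blockEntry k γ (i - 1) l * x (l + 1) j

lemma colDot_blockMul (k : ℕ) (γ : Matrix.SpecialLinearGroup (Fin k) ℤ) (x x₀ : ℕ → ℕ → ℝ) {j : ℕ}
    (hj : k ≤ j) (a : Fin j → ℝ) :
    colDot (blockMul k γ x x₀) j a = colDot x j (a ᵥ* block k j γ) := by
  have h : ¬ j + 1 ≤ k := by omega
  simp only [colDot, blockMul, if_neg h, Nat.add_sub_cancel]
  simp only [Matrix.vecMul, dotProduct, block_apply, Finset.sum_mul, Finset.mul_sum,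
    Finset.sum_range]
  rw [Finset.sum_comm]
  exact Finset.sum_congr rfl fun _ _ => Finset.sum_congr rfl fun _ _ => by ring

lemma vecMul_block_snoc (k : ℕ) (γ : Matrix.SpecialLinearGroup (Fin k) ℤ) {j : ℕ} (hj : k ≤ j)
    (a : Fin j → ℝ) (t : ℝ) : (Fin.snoc a t : Fin (j + 1) → ℝ) ᵥ* block k (j + 1) γ =
      (Fin.snoc (a ᵥ* block k j γ) t : Fin (j + 1) → ℝ) := by
  funext i
  refine Fin.lastCases ?_ (fun l => ?_) i
  · simp only [Matrix.vecMul, dotProduct, Fin.sum_univ_castSucc, block_apply, Fin.snoc_castSucc,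
      Fin.snoc_last, Fin.val_castSucc, Fin.val_last]
    have h1 : ∀ i : Fin j, blockEntry k γ i j = 0 := fun i => by
      have := i.isLt
      rw [blockEntry, dif_neg (by omega), if_neg (by omega)]
    have h2 : blockEntry k γ j j = 1 := by
      rw [blockEntry, dif_neg (by omega), if_pos rfl]
    simp [h1, h2]
  · simp only [Matrix.vecMul, dotProduct, Fin.sum_univ_castSucc, block_apply, Fin.snoc_castSucc,
      Fin.snoc_last, Fin.val_castSucc, Fin.val_last]
    have h1 : blockEntry k γ j l = 0 := by
      have := l.isLt
      rw [blockEntry, dif_neg (by omega), if_neg (by omega)]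
    rw [h1, mul_zero, add_zero]

/-- Only the leading `k × k` block has to be decomposed anew. The later columns are multiplied by
`γ` and keep their scales, by induction on the number of columns. -/
lemma quadForm_blockMul (k : ℕ) (γ : Matrix.SpecialLinearGroup (Fin k) ℤ) {x x₀ : ℕ → ℕ → ℝ}
    {c c₀ : ℕ → ℝ}
    (h : ∀ v : Fin k → ℝ, quadForm x₀ c₀ k v = quadForm x c k (v ᵥ* block k k γ)) {j : ℕ}
    (hj : k ≤ j) (v : Fin j → ℝ) :
    quadForm (blockMul k γ x x₀) (fun j => if j < k then c₀ j else c j) j v =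
      quadForm x c j (v ᵥ* block k j γ) := by
  induction j, hj using Nat.le_induction with
  | base =>
    rw [← h]
    refine quadForm_congr (fun i j _ _ hj => ?_) (fun j hj => if_pos hj) v
    rw [blockMul, if_pos hj]
  | succ j hj ih =>
    obtain ⟨a, t, rfl⟩ : ∃ (a : Fin j → ℝ) (t : ℝ), (Fin.snoc a t : Fin (j + 1) → ℝ) = v :=
      ⟨Fin.init v, v (Fin.last j), Fin.snoc_init_self v⟩
    rw [vecMul_block_snoc k γ hj, quadForm_snoc, quadForm_snoc, ih, colDot_blockMul k γ x x₀ hj,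
      if_neg (by omega)]

/-- The coordinates of `diag (γ, I) z`. -/
lemma Coords.block {n k : ℕ} (hk : k ≤ n) {z : Matrix (Fin n) (Fin n) ℝ} {x : ℕ → ℕ → ℝ}
    {c : ℕ → ℝ} (h : Coords n z x c) (γ : Matrix.SpecialLinearGroup (Fin k) ℤ) :
    ∃ x' c', Coords n (block k n γ * z) x' c' ∧ (∀ j, k ≤ j → c' j = c j) ∧
      ∏ j ∈ Finset.range n, c' j = ∏ j ∈ Finset.range n, c j ∧
      (∀ v : Fin k → ℝ, quadForm x' c' k v = quadForm x c k (v ᵥ* DegEis.block k k γ)) ∧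
      ∀ v : Fin k → ℝ, colDot x' k v = colDot x k (v ᵥ* DegEis.block k k γ) := by
  have hck : ∀ j < k, 0 < c j := fun j hj => h.1 j (hj.trans_le hk)
  have hpos : 0 < ∏ j ∈ Finset.range k, c j :=
    Finset.prod_pos fun j hj => hck j (Finset.mem_range.mp hj)
  have hdet : (DegEis.block k k γ * coordMatrix k x c).det = ∏ j ∈ Finset.range k, c j := by
    rw [Matrix.det_mul, det_block_self, one_mul, det_coordMatrix]
  obtain ⟨x₀, c₀, h₀⟩ := exists_coords (hdet.trans_ne hpos.ne')
  have hq : ∀ v : Fin k → ℝ, quadForm x₀ c₀ k v = quadForm x c k (v ᵥ* DegEis.block k k γ) := by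
    intro v
    rw [← h₀.2 v, quadForm_eq_dot, Matrix.vecMul_vecMul]
  -- As `det γ = 1`, the product of the first `k` scales is unchanged, and so is `eisScale`.
  have hprod₀ : ∏ j ∈ Finset.range k, c₀ j = ∏ j ∈ Finset.range k, c j := by
    rw [← h₀.abs_det, hdet, abs_of_pos hpos]
  refine ⟨blockMul k γ x x₀, fun j => if j < k then c₀ j else c j, ⟨fun j hj => ?_, fun v => ?_⟩,
    fun j hj => if_neg (by omega), ?_, fun v => quadForm_blockMul k γ hq le_rfl v,
    fun v => colDot_blockMul k γ x x₀ le_rfl v⟩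
  · dsimp only
    split_ifs with hjk
    · exact h₀.1 j hjk
    · exact h.1 j hj
  · rw [quadForm_blockMul k γ hq hk, ← h.2, Matrix.vecMul_vecMul]
  · rw [← Finset.prod_range_mul_prod_Ico _ hk, ← Finset.prod_range_mul_prod_Ico c hk, ← hprod₀]
    congr 1
    · exact Finset.prod_congr rfl fun j hj => if_pos (Finset.mem_range.mp hj)
    · refine Finset.prod_congr rfl fun j hj => if_neg ?_
      rw [Finset.mem_Ico] at hj
      omega

lemma toReal_vecMul_block {k : ℕ} (γ : Matrix.SpecialLinearGroup (Fin k) ℤ) (a : Fin k → ℤ) :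
    toReal a ᵥ* block k k γ = toReal (a ᵥ* (γ : Matrix (Fin k) (Fin k) ℤ)) := by
  funext j
  simp [block_self, toReal, Matrix.vecMul, dotProduct]

lemma vecMul_vecMul_inv {k : ℕ} (γ : Matrix.SpecialLinearGroup (Fin k) ℤ) (a : Fin k → ℤ) :
    (a ᵥ* (γ : Matrix (Fin k) (Fin k) ℤ)) ᵥ*
      ((γ⁻¹ : Matrix.SpecialLinearGroup (Fin k) ℤ) : Matrix (Fin k) (Fin k) ℤ) = a := by
  rw [Matrix.vecMul_vecMul, ← Matrix.SpecialLinearGroup.coe_mul, mul_inv_cancel,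
    Matrix.SpecialLinearGroup.coe_one, Matrix.vecMul_one]

lemma vecMul_inv_vecMul {k : ℕ} (γ : Matrix.SpecialLinearGroup (Fin k) ℤ) (a : Fin k → ℤ) :
    (a ᵥ* ((γ⁻¹ : Matrix.SpecialLinearGroup (Fin k) ℤ) : Matrix (Fin k) (Fin k) ℤ)) ᵥ*
      (γ : Matrix (Fin k) (Fin k) ℤ) = a := by
  rw [Matrix.vecMul_vecMul, ← Matrix.SpecialLinearGroup.coe_mul, inv_mul_cancel,
    Matrix.SpecialLinearGroup.coe_one, Matrix.vecMul_one]

/-- Right multiplication by `γ` on the nonzero vectors. -/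
def vecMulEquiv {k : ℕ} (γ : Matrix.SpecialLinearGroup (Fin k) ℤ) : NZ k ≃ NZ k where
  toFun a := ⟨a.1 ᵥ* (γ : Matrix (Fin k) (Fin k) ℤ), fun h => a.2 (by
    rw [← vecMul_vecMul_inv γ a.1, h, Matrix.zero_vecMul])⟩
  invFun a := ⟨a.1 ᵥ* ((γ⁻¹ : Matrix.SpecialLinearGroup (Fin k) ℤ) : Matrix (Fin k) (Fin k) ℤ),
    fun h => a.2 (by rw [← vecMul_inv_vecMul γ a.1, h, Matrix.zero_vecMul])⟩
  left_inv a := Subtype.ext (vecMul_vecMul_inv γ a.1)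
  right_inv a := Subtype.ext (vecMul_inv_vecMul γ a.1)

/-- Reindexing by `a ↦ a γ`, which multiplies the frequency `m a` by `γ` on the right. -/
lemma fiberSum_block {k : ℕ} (γ : Matrix.SpecialLinearGroup (Fin k) ℤ) {x x' : ℕ → ℕ → ℝ}
    {c c' : ℕ → ℝ} (hc : c' k = c k)
    (hq : ∀ v : Fin k → ℝ, quadForm x' c' k v = quadForm x c k (v ᵥ* block k k γ))
    (hl : ∀ v : Fin k → ℝ, colDot x' k v = colDot x k (v ᵥ* block k k γ)) (ν : ℂ)
    (v : Fin k → ℤ) :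
    fiberSum x' c' k ν v = fiberSum x c k ν (v ᵥ* (γ : Matrix (Fin k) (Fin k) ℤ)) := by
  rw [fiberSum, fiberSum]
  refine Eq.trans ?_ (((vecMulEquiv γ).prodCongr (Equiv.refl NZInt)).tsum_eq _)
  refine tsum_congr fun p => if_congr ?_ ?_ rfl
  · change _ ↔ p.2.1 • (p.1.1 ᵥ* (γ : Matrix (Fin k) (Fin k) ℤ)) = _
    rw [← Matrix.smul_vecMul]
    refine ⟨fun h => by rw [h], fun h => ?_⟩
    rw [← vecMul_vecMul_inv γ (p.2.1 • p.1.1), h, vecMul_vecMul_inv]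
  · change besselTerm x' c' k ν p.1.1 p.2.1 =
      besselTerm x c k ν (p.1.1 ᵥ* (γ : Matrix (Fin k) (Fin k) ℤ)) p.2.1
    rw [besselTerm, besselTerm, hq, hl, hc, toReal_vecMul_block]

lemma lastVec_vecMul {k : ℕ} (hk : 0 < k) (γ : Matrix.SpecialLinearGroup (Fin k) ℤ) (M : ℤ) :
    lastVec k M ᵥ* (γ : Matrix (Fin k) (Fin k) ℤ) = M • γ (lastIdx hk) := by
  have h : lastVec k M = M • Pi.single (lastIdx hk) 1 := by
    funext i
    simp only [lastVec, ← eq_lastIdx_iff hk, Pi.smul_apply, Pi.single_apply, smul_eq_mul,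
      mul_ite, mul_one, mul_zero]
  rw [h, Matrix.smul_vecMul, Matrix.single_one_vecMul]
  rfl

lemma fourierCoeff_single_block {n : ℕ} (hn : 2 ≤ n) {E : Matrix (Fin n) (Fin n) ℝ → ℂ → ℂ}
    (hE : IsDegenerateEisenstein n E) {s : ℂ} (hs : ∀ j : ℕ, j ≤ n → (n : ℂ) * s ≠ j)
    (hξ : completedRiemannZeta (n * s) ≠ 0) {z : Matrix (Fin n) (Fin n) ℝ} {x : ℕ → ℕ → ℝ}
    {c : ℕ → ℝ} (h : Coords n z x c) {k : ℕ} (hk : k ∈ Finset.Icc 1 (n - 1)) {M : ℤ}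
    (hM : M ≠ 0) (γ : Matrix.SpecialLinearGroup (Fin k) ℤ) :
    fourierCoeff n (fun g => E g s) (single k M) (block k n γ * z) =
      eisScale n c s * (tailProd n c k * fiberSum x c k ((n * s - n + k) / 2)
        (M • γ (lastIdx (Finset.mem_Icc.mp hk).1))) := by
  have hk' := Finset.mem_Icc.mp hk
  obtain ⟨x', c', h', hc, hprod, hq, hl⟩ := h.block (show k ≤ n by omega) γ
  rw [fourierCoeff_single hn hE hs hξ h' hk hM, fiberSum_block γ (hc k le_rfl) hq hl,
    lastVec_vecMul hk'.1, eisScale, eisScale, hprod, tailProd, tailProd]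
  congr 2
  refine Finset.prod_congr rfl fun j hj => ?_
  rw [Finset.mem_Ico] at hj
  rw [hc j (by omega)]

/-! ### Explicit form of the degenerate coefficients -/

/-- `besselInt_sq` applies with `P = |d| c_k` and `Q = |m| / c_{k+1}`. Here `P Q = |M| c_k /
c_{k+1}` and `Q / P = |M| / (d² c_k c_{k+1})`, so the factorization `M = m d` matters only through
`|d|^(-2ν)`, which is why a divisor sum appears. -/
lemma besselTerm_single (x : ℕ → ℕ → ℝ) {c : ℕ → ℝ} {k : ℕ} (h0 : 0 < c k) (h1 : 0 < c (k + 1))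
    (ν : ℂ) {d m M : ℤ} (hM : M ≠ 0) (hmd : m * d = M) :
    besselTerm x c (k + 1) ν (Pi.single (Fin.last k) d) m =
      (d.natAbs : ℂ) ^ (-2 * ν) * (2 * e (M * x (k + 1) (k + 2)) * (c (k + 1) : ℂ)⁻¹ *
        (M.natAbs : ℂ) ^ ν * ((c k * c (k + 1) : ℝ) : ℂ) ^ (-ν) *
        besselK ν (2 * Real.pi * M.natAbs * (c k / c (k + 1)))) := by
  have hd0 : d ≠ 0 := by
    rintro rfl
    simp at hmd
    exact hM hmd.symm
  have hm0 : m ≠ 0 := by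
    rintro rfl
    simp at hmd
    exact hM hmd.symm
  have hd : (0 : ℝ) < d.natAbs := by exact_mod_cast Int.natAbs_pos.mpr hd0
  have hm : (0 : ℝ) < m.natAbs := by exact_mod_cast Int.natAbs_pos.mpr hm0
  have hMn : (M.natAbs : ℝ) = m.natAbs * d.natAbs := by
    rw [← hmd, Int.natAbs_mul]
    push_cast
    ring
  have hM0 : (0 : ℝ) < M.natAbs := by rw [hMn]; positivity
  have e1 : ((d : ℝ) * c k) ^ 2 = (d.natAbs * c k) ^ 2 := by
    rw [mul_pow, mul_pow, Nat.cast_natAbs, Int.cast_abs, sq_abs]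
  have e2 : ((m : ℝ) / c (k + 1)) ^ 2 = (m.natAbs / c (k + 1)) ^ 2 := by
    rw [div_pow, div_pow, Nat.cast_natAbs, Int.cast_abs, sq_abs]
  have e3 : (m.natAbs : ℝ) / c (k + 1) / (d.natAbs * c k) =
      M.natAbs * (((d.natAbs : ℝ) ^ 2)⁻¹ * (c k * c (k + 1))⁻¹) := by
    rw [hMn]
    field_simp
  have e4 : ((((d.natAbs : ℝ) ^ 2)⁻¹ : ℝ) : ℂ) ^ ν = (d.natAbs : ℂ) ^ (-2 * ν) := by
    rw [← inv_pow, ofReal_sq_cpow (by positivity), Complex.ofReal_inv, Complex.inv_cpow, ← Complex.cpow_neg,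
      Complex.ofReal_natCast]
    · ring_nf
    · rw [Complex.arg_ofReal_of_nonneg hd.le]
      exact Real.pi_pos.ne
  have e5 : (((c k * c (k + 1))⁻¹ : ℝ) : ℂ) ^ ν = ((c k * c (k + 1) : ℝ) : ℂ) ^ (-ν) := by
    rw [Complex.ofReal_inv, Complex.inv_cpow, ← Complex.cpow_neg]
    rw [Complex.arg_ofReal_of_nonneg (by positivity)]
    exact Real.pi_pos.ne
  have e6 : 2 * Real.pi * (d.natAbs * c k * (m.natAbs / c (k + 1))) =
      2 * Real.pi * M.natAbs * (c k / c (k + 1)) := by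
    rw [hMn]
    field_simp
  have e7 : (m : ℝ) * (d * x (k + 1) (k + 2)) = M * x (k + 1) (k + 2) := by
    rw [← hmd]
    push_cast
    ring
  rw [besselTerm, quadForm_single, colDot_single, e1, e2, besselInt_sq (by positivity) (by positivity),
    e3, e6, e7, Complex.ofReal_mul, Complex.mul_cpow_ofReal_nonneg hM0.le (by positivity),
    Complex.ofReal_mul (((d.natAbs : ℝ) ^ 2)⁻¹),
    Complex.mul_cpow_ofReal_nonneg (by positivity) (by positivity), e4, e5, Complex.ofReal_natCast]
  ring

/-- The terms of frequency `(0, …, 0, M)` are indexed by the divisors of `M` and a sign. -/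
lemma fiberSum_lastVec (x : ℕ → ℕ → ℝ) {c : ℕ → ℝ} {k : ℕ} (h0 : 0 < c k) (h1 : 0 < c (k + 1))
    (ν : ℂ) {M : ℤ} (hM : M ≠ 0) :
    fiberSum x c (k + 1) ν (lastVec (k + 1) M) =
      4 * e (M * x (k + 1) (k + 2)) * (c (k + 1) : ℂ)⁻¹ *
        (M.natAbs : ℂ) ^ ν * sigma (-2 * ν) M.natAbs * ((c k * c (k + 1) : ℝ) : ℂ) ^ (-ν) *
        besselK ν (2 * Real.pi * M.natAbs * (c k / c (k + 1))) := by
  classical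
  have hdvd (d : M.natAbs.divisors) : ((d : ℕ) : ℤ) ∣ M :=
    Int.natCast_dvd.mpr (Nat.dvd_of_mem_divisors d.2)
  have hdpos (d : M.natAbs.divisors) : (0 : ℤ) < (d : ℕ) := by
    exact_mod_cast Nat.pos_of_mem_divisors d.2
  have hq0 (d : M.natAbs.divisors) : M / ((d : ℕ) : ℤ) ≠ 0 := fun h => hM (by
    rw [← Int.ediv_mul_cancel (hdvd d), h, zero_mul])
  have hε (ε : ℤˣ) : (ε : ℤ) * ε = 1 := by
    rcases Int.units_eq_one_or ε with rfl | rfl <;> simp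
  -- A divisor `d` and a sign `ε` give `a = (0, …, 0, ε d)` and `m = ε M / d`, an exact division.
  -- The two signs, together with the factor `2` from `besselInt_sq`, account for the constant `4`.
  let ψ : M.natAbs.divisors × ℤˣ → NZ (k + 1) × NZInt := fun p =>
    (⟨Pi.single (Fin.last k) ((p.2 : ℤ) * (p.1 : ℕ)), fun h => by
      have := congrFun h (Fin.last k)
      simp at this
      have h2 := hdpos p.1
      omega⟩,
     ⟨(p.2 : ℤ) * (M / ((p.1 : ℕ) : ℤ)), mul_ne_zero p.2.ne_zero (hq0 p.1)⟩)
  have hψ1 (p) : (ψ p).1.1 = Pi.single (Fin.last k) ((p.2 : ℤ) * (p.1 : ℕ)) := rfl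
  have hψ2 (p) : (ψ p).2.1 = (p.2 : ℤ) * (M / ((p.1 : ℕ) : ℤ)) := rfl
  have hprod (p) : (ψ p).2.1 * ((p.2 : ℤ) * (p.1 : ℕ)) = M := by
    rw [hψ2, mul_mul_mul_comm, hε, one_mul, Int.ediv_mul_cancel (hdvd p.1)]
  have hlast (N : ℤ) : lastVec (k + 1) N = Pi.single (Fin.last k) N := by
    funext i
    simp [lastVec, Pi.single_apply, Fin.ext_iff]
  have hinj : Function.Injective ψ := by
    rintro ⟨d, ε⟩ ⟨d', ε'⟩ h
    have h2 := congrFun (congrArg (fun q => q.1.1) h) (Fin.last k)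
    simp only [hψ1, Pi.single_eq_same] at h2
    have h3 := congrArg Int.natAbs h2
    simp only [Int.natAbs_mul, Int.units_natAbs, one_mul, Int.natAbs_natCast] at h3
    have h4 : d = d' := Subtype.ext h3
    subst h4
    have h5 := mul_right_cancel₀ (hdpos d).ne' h2
    rw [Units.ext h5]
  have hsupp : Function.support (fun p : NZ (k + 1) × NZInt =>
      if p.2.1 • p.1.1 = lastVec (k + 1) M then besselTerm x c (k + 1) ν p.1 p.2 else 0) ⊆ range ψ := by
    rintro ⟨⟨a, ha⟩, ⟨m, hm⟩⟩ hp
    have hp' : m • a = lastVec (k + 1) M := by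
      by_contra hne
      exact hp (if_neg hne)
    rw [hlast] at hp'
    set d := a (Fin.last k) with hd
    have hmd : m * d = M := by
      have := congrFun hp' (Fin.last k)
      simpa using this
    have haeq : a = Pi.single (Fin.last k) d := by
      funext i
      refine Fin.lastCases ?_ (fun j => ?_) i
      · simp [hd]
      · have := congrFun hp' j.castSucc
        simp [hm, (Fin.castSucc_lt_last j).ne] at this
        simp [this, (Fin.castSucc_lt_last j).ne]
    have hd0 : d ≠ 0 := by
      rintro h
      rw [h, mul_zero] at hmd
      exact hM hmd.symm
    have hdabs : d.natAbs ∈ M.natAbs.divisors := by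
      rw [Nat.mem_divisors]
      exact ⟨Int.natAbs_dvd_natAbs.mpr ⟨m, by rw [← hmd, mul_comm]⟩, by simpa using hM⟩
    obtain ⟨ε, hεd⟩ : ∃ ε : ℤˣ, (ε : ℤ) * d.natAbs = d := by
      rcases Int.natAbs_eq d with h | h
      · exact ⟨1, by rw [Units.val_one, one_mul, ← h]⟩
      · exact ⟨-1, by rw [Units.val_neg, Units.val_one, neg_one_mul, ← h]⟩
    refine ⟨(⟨d.natAbs, hdabs⟩, ε), ?_⟩
    refine Prod.ext (Subtype.ext ?_) (Subtype.ext ?_)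
    · exact ((hψ1 _).trans (congrArg (Pi.single (Fin.last k)) hεd)).trans haeq.symm
    · have h2 := hprod (⟨d.natAbs, hdabs⟩, ε)
      rw [hεd] at h2
      exact mul_right_cancel₀ hd0 (h2.trans hmd.symm)
  rw [fiberSum, ← hinj.tsum_eq hsupp, tsum_fintype, Fintype.sum_prod_type]
  have hterm (d : M.natAbs.divisors) (ε : ℤˣ) :
      (if (ψ (d, ε)).2.1 • (ψ (d, ε)).1.1 = lastVec (k + 1) M then
        besselTerm x c (k + 1) ν (ψ (d, ε)).1 (ψ (d, ε)).2 else 0) =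
      ((d : ℕ) : ℂ) ^ (-2 * ν) * (2 * e (M * x (k + 1) (k + 2)) * (c (k + 1) : ℂ)⁻¹ *
        (M.natAbs : ℂ) ^ ν * ((c k * c (k + 1) : ℝ) : ℂ) ^ (-ν) *
        besselK ν (2 * Real.pi * M.natAbs * (c k / c (k + 1)))) := by
    have h2 := hprod (d, ε)
    rw [if_pos, hψ1, besselTerm_single x h0 h1 ν hM h2]
    · simp [Int.natAbs_mul]
    · rw [hψ1, hlast, ← Pi.single_smul, smul_eq_mul, h2]
  have hsum : ∑ d : M.natAbs.divisors, ((d : ℕ) : ℂ) ^ (-2 * ν) = sigma (-2 * ν) M.natAbs :=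
    Finset.sum_coe_sort M.natAbs.divisors fun d => (d : ℂ) ^ (-2 * ν)
  simp only [hterm, Finset.sum_const, Finset.card_univ, Fintype.card_units_int, nsmul_eq_mul]
  rw [← Finset.mul_sum, ← Finset.sum_mul, hsum]
  push_cast
  ring

/-! ### Products of powers of the `y`-coordinates -/

lemma bigY_succ (y : ℕ → ℝ) {j : ℕ} (hj : 1 ≤ j) : bigY y (j + 1) = bigY y j * y j := by
  obtain ⟨j, rfl⟩ : ∃ i, j = i + 1 := ⟨j - 1, by omega⟩
  rw [bigY, bigY, Nat.add_sub_cancel, Nat.add_sub_cancel, Finset.prod_Icc_succ_top (by omega)]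

/-- The factor `y_j` occurs in `Y_l` exactly for `l > j`, so `N - j` times in the first product and
`j` times in the second. -/
lemma prod_bigY_mul_prod_pow (y : ℕ → ℝ) (N : ℕ) :
    (∏ l ∈ Finset.Icc 1 N, bigY y l) * ∏ j ∈ Finset.Icc 1 N, y j ^ j = bigY y (N + 1) ^ N := by
  induction N with
  | zero => simp
  | succ N ih =>
    rw [Finset.prod_Icc_succ_top (by omega), Finset.prod_Icc_succ_top (by omega),
      bigY_succ y (show 1 ≤ N + 1 by omega), mul_mul_mul_comm, ih]
    ring

lemma prod_reflect (n k : ℕ) (y : ℕ → ℝ) (hk : k < n) :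
    ∏ j ∈ Finset.Ico (k + 1) n, bigY y (n - j) = ∏ l ∈ Finset.Icc 1 (n - k - 1), bigY y l := by
  refine Finset.prod_nbij' (fun a => n - a) (fun j => n - j) (fun a ha => ?_) (fun j hj => ?_)
    (fun a ha => ?_) (fun j hj => ?_) (fun _ _ => rfl) <;>
    simp only [Finset.mem_Ico, Finset.mem_Icc] at * <;> omega

lemma prod_tail_mul (n k : ℕ) (y : ℕ → ℝ) (hk : k < n) :
    (∏ j ∈ Finset.Ico (k + 1) n, bigY y (n - j)) * ∏ j ∈ Finset.Icc 1 (n - k - 1), y j ^ j =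
      bigY y (n - k) ^ (n - k - 1) := by
  rw [prod_reflect n k y hk, prod_bigY_mul_prod_pow, Nat.sub_add_cancel (by omega)]

/-- On both sides `y_j` has exponent `n` for `j < n - k` and `n - j` for `j ≥ n - k`. -/
lemma prod_all_mul (n k : ℕ) {y : ℕ → ℝ} (hy : ∀ j ∈ Finset.Icc 1 (n - 1), 0 < y j) (hk : k < n) :
    (∏ j ∈ Finset.range n, bigY y (n - j)) * ∏ j ∈ Finset.Icc 1 (n - k - 1), y j ^ j =
      bigY y (n - k) ^ n * ∏ j ∈ Finset.Icc (n - k) (n - 1), y j ^ (n - j) := by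
  induction k with
  | zero =>
    rw [Finset.range_eq_Ico, Finset.prod_eq_prod_Ico_succ_bot hk, mul_assoc, prod_tail_mul n 0 y hk,
      Finset.Icc_eq_empty (by omega), Finset.prod_empty, mul_one, Nat.sub_zero, ← pow_succ',
      Nat.sub_add_cancel hk]
  | succ k ih =>
    have h := ih (by omega)
    obtain ⟨r, hr⟩ : ∃ r, n - k = r + 2 := ⟨n - k - 2, by omega⟩
    have hr1 : n - (k + 1) = r + 1 := by omega
    have hrn : n = r + 2 + k := by omega
    have hyr : 0 < y (r + 1) := hy _ (by rw [Finset.mem_Icc]; omega)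
    rw [hr] at h
    rw [hr1]
    rw [show r + 2 - 1 = r + 1 by omega, Finset.prod_Icc_succ_top (by omega),
      bigY_succ y (show 1 ≤ r + 1 by omega)] at h
    rw [show r + 1 - 1 = r by omega]
    have hI : Finset.Icc (r + 1) (n - 1) = insert (r + 1) (Finset.Icc (r + 2) (n - 1)) := by
      ext j
      simp only [Finset.mem_insert, Finset.mem_Icc]
      omega
    rw [hI, Finset.prod_insert (by simp)]
    have hpow : y (r + 1) ^ n = y (r + 1) ^ (n - (r + 1)) * y (r + 1) ^ (r + 1) := by
      rw [← pow_add]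
      congr 1
      omega
    rw [mul_pow, hpow] at h
    have hne : y (r + 1) ^ (r + 1) ≠ 0 := (pow_pos hyr _).ne'
    refine mul_right_cancel₀ hne ?_
    rw [mul_assoc, h]
    ring

lemma ofReal_pow_cpow {a : ℝ} (ha : 0 < a) (n : ℕ) (s : ℂ) :
    ((a ^ n : ℝ) : ℂ) ^ s = (a : ℂ) ^ (n * s) := by
  have h0 : (a : ℂ) ≠ 0 := by exact_mod_cast ha.ne'
  have h1 : ((a ^ n : ℝ) : ℂ) ≠ 0 := by exact_mod_cast (pow_pos ha n).ne'
  rw [Complex.cpow_def_of_ne_zero h0, Complex.cpow_def_of_ne_zero h1, ← Complex.ofReal_log (by positivity),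
    ← Complex.ofReal_log ha.le, Real.log_pow]
  push_cast
  ring_nf

/-- With `D A = C^n B` and `T A = C^(n-k-1)`, the left side `D^s T⁻¹ C^(-(ns-n+k+1))` loses all
powers of `C` and becomes `A^(1-s) B^s`. Every coefficient gets its power function in this way. -/
lemma scale_mul_tailProd {n k : ℕ} {y : ℕ → ℝ} (hy : ∀ j ∈ Finset.Icc 1 (n - 1), 0 < y j)
    (hk : k < n) (s : ℂ) :
    ((∏ j ∈ Finset.range n, bigY y (n - j) : ℝ) : ℂ) ^ s * (tailProd n (fun a => bigY y (n - a)) k *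
      (bigY y (n - k) : ℂ) ^ (-(n * s - n + k + 1))) = powerFun n k s y := by
  set C := bigY y (n - k) with hC
  set A := ∏ j ∈ Finset.Icc 1 (n - k - 1), y j ^ j with hA
  set B := ∏ j ∈ Finset.Icc (n - k) (n - 1), y j ^ (n - j) with hB
  set D := ∏ j ∈ Finset.range n, bigY y (n - j) with hD
  set T := ∏ j ∈ Finset.Ico (k + 1) n, bigY y (n - j) with hT
  have hCp : 0 < C := bigY_pos hy (Nat.sub_le _ _)
  have hAp : 0 < A := Finset.prod_pos fun j hj => pow_pos (hy j (by
    rw [Finset.mem_Icc] at hj ⊢; omega)) _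
  have hBp : 0 < B := Finset.prod_pos fun j hj => pow_pos (hy j (by
    rw [Finset.mem_Icc] at hj ⊢; omega)) _
  have hTA : T * A = C ^ (n - k - 1) := prod_tail_mul n k y hk
  have hDA : D * A = C ^ n * B := prod_all_mul n k hy hk
  have hTp : 0 < T := Finset.prod_pos fun j _ => bigY_pos hy (Nat.sub_le _ _)
  have hDp : 0 < D := Finset.prod_pos fun j _ => bigY_pos hy (Nat.sub_le _ _)
  have hA0 : (A : ℂ) ≠ 0 := by exact_mod_cast hAp.ne'
  have hC0 : (C : ℂ) ≠ 0 := by exact_mod_cast hCp.ne'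
  have hT0 : (T : ℂ) ≠ 0 := by exact_mod_cast hTp.ne'
  have htail : tailProd n (fun a => bigY y (n - a)) k = (T : ℂ)⁻¹ := by
    rw [tailProd, hT, Complex.ofReal_prod, Finset.prod_inv_distrib]
  have h1 : (D : ℂ) ^ s * (A : ℂ) ^ s = (C : ℂ) ^ (n * s) * (B : ℂ) ^ s := by
    rw [← Complex.mul_cpow_ofReal_nonneg hDp.le hAp.le, ← Complex.ofReal_mul, hDA,
      Complex.ofReal_mul, Complex.mul_cpow_ofReal_nonneg (by positivity) hBp.le,
      ofReal_pow_cpow hCp]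
  have h2 : (T : ℂ)⁻¹ = A * (C : ℂ) ^ (-((n : ℂ) - k - 1)) := by
    have h3 : (T : ℂ) * A = (C : ℂ) ^ ((n : ℂ) - k - 1) := by
      rw [← Complex.ofReal_mul, hTA, Complex.ofReal_pow, ← Complex.cpow_natCast,
        Nat.cast_sub (by omega), Nat.cast_sub (by omega), Nat.cast_one]
    rw [Complex.cpow_neg, ← h3]
    field_simp
  have h4 : (A : ℂ) ^ (1 - s) = A * ((A : ℂ) ^ s)⁻¹ := by
    rw [Complex.cpow_sub _ _ hA0, Complex.cpow_one, div_eq_mul_inv]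
  have hAs : (A : ℂ) ^ s ≠ 0 := fun h => hA0 ((Complex.cpow_eq_zero_iff _ _).mp h).1
  rw [powerFun, htail, h2, h4, mul_assoc, ← Complex.cpow_add _ _ hC0,
    show -((n : ℂ) - k - 1) + -(n * s - n + k + 1) = -(n * s) by ring]
  have h5 : (C : ℂ) ^ (n * s) * (C : ℂ) ^ (-(n * s)) = 1 := by
    rw [← Complex.cpow_add _ _ hC0, add_neg_cancel, Complex.cpow_zero]
  rw [eq_comm]
  calc _ = A * ((A : ℂ) ^ s)⁻¹ * ((C : ℂ) ^ (n * s) * (B : ℂ) ^ s) * (C : ℂ) ^ (-(n * s)) := by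
        linear_combination -(A * ((A : ℂ) ^ s)⁻¹ * (B : ℂ) ^ s) * h5
    _ = _ := by
        rw [← h1]
        field_simp

/-! ### Assembling the expansion -/

section Expansion

variable {n : ℕ} {E : Matrix (Fin n) (Fin n) ℝ → ℂ → ℂ} {s : ℂ} {z : Matrix (Fin n) (Fin n) ℝ}
  {x : ℕ → ℕ → ℝ} {c y : ℕ → ℝ}

lemma fourierCoeff_zero_eq_sum (hn : 2 ≤ n) (hE : IsDegenerateEisenstein n E)
    (hs : ∀ j : ℕ, j ≤ n → (n : ℂ) * s ≠ j) (hξ : completedRiemannZeta (n * s) ≠ 0)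
    (hy : ∀ j ∈ Finset.Icc 1 (n - 1), 0 < y j) (hz : z = unip n x * torus n y) :
    fourierCoeff n (fun g => E g s) 0 z = ∑ k ∈ Finset.range n,
      2 * completedRiemannZeta (n * s - n + k + 1) / completedRiemannZeta (n * s) *
        powerFun n k s y := by
  rw [hz, fourierCoeff_zero hn hE hs hξ (coords_unip_mul_torus x hy), Finset.mul_sum]
  refine Finset.sum_congr rfl fun k hk => ?_
  rw [← scale_mul_tailProd hy (Finset.mem_range.mp hk) s, eisScale, constPart]
  ring

lemma fourierCoeff_single_eq_besselK (hn : 2 ≤ n) (hE : IsDegenerateEisenstein n E)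
    (hs : ∀ j : ℕ, j ≤ n → (n : ℂ) * s ≠ j) (hξ : completedRiemannZeta (n * s) ≠ 0)
    (hy : ∀ j ∈ Finset.Icc 1 (n - 1), 0 < y j) (hz : z = unip n x * torus n y) {k : ℕ}
    (hk : k ∈ Finset.Icc 1 (n - 1)) {m : ℤ} (hm : m ≠ 0) :
    fourierCoeff n (fun g => E g s) (single k m) z =
      e (m * x k (k + 1)) * (4 / completedRiemannZeta (n * s)) *
        (m.natAbs : ℂ) ^ ((n * s - (n - k)) / 2) * sigma (-n * s + (n - k)) m.natAbs *
        besselK ((n * s - (n - k)) / 2) (2 * Real.pi * m.natAbs * y (n - k)) *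
        powerFun n k s y * (y (n - k) : ℂ) ^ (-(n * s - (n - k)) / 2) := by
  have hk' := Finset.mem_Icc.mp hk
  rw [hz, fourierCoeff_single hn hE hs hξ (coords_unip_mul_torus x hy) hk hm,
    ← scale_mul_tailProd hy (show k < n by omega) s, eisScale]
  obtain ⟨l, rfl⟩ : ∃ l, k = l + 1 := ⟨k - 1, by omega⟩
  have hlast : n - l = n - (l + 1) + 1 := by omega
  have hC : 0 < bigY y (n - (l + 1)) := bigY_pos hy (Nat.sub_le _ _)
  have hy0 : 0 < y (n - (l + 1)) := hy _ (by rw [Finset.mem_Icc]; omega)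
  have hbig : bigY y (n - l) = bigY y (n - (l + 1)) * y (n - (l + 1)) := by
    rw [hlast, bigY_succ y (by omega)]
  rw [fiberSum_lastVec x (c := fun a => bigY y (n - a)) (bigY_pos hy (Nat.sub_le _ _)) hC _ hm]
  simp only [hbig]
  set C := bigY y (n - (l + 1))
  set t := y (n - (l + 1))
  set ν : ℂ := (n * s - (n - (l + 1 : ℕ))) / 2 with hν
  have hC0 : (C : ℂ) ≠ 0 := by exact_mod_cast hC.ne'
  -- The adjacent scales are `C t` and `C`, so the coefficient carries `C⁻¹ (C² t)^(-ν) = C^(-1-2ν)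
  -- t^(-ν)`. The power of `C` is exactly the one absorbed by `scale_mul_tailProd`, and `t^(-ν)`
  -- remains.
  rw [show (n * s - n + (l + 1 : ℕ)) / 2 = ν by rw [hν]; ring,
    show -(n : ℂ) * s + (n - (l + 1 : ℕ)) = -2 * ν by rw [hν]; ring,
    show -((n : ℂ) * s - (n - (l + 1 : ℕ))) / 2 = -ν by rw [hν]; ring,
    show -((n : ℂ) * s - n + (l + 1 : ℕ) + 1) = -1 + (2 : ℕ) * -ν by rw [hν]; push_cast; ring,
    Complex.cpow_add _ _ hC0, ← ofReal_pow_cpow hC, Complex.cpow_neg_one,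
    show C * t / C = t by field_simp, show C * t * C = C ^ 2 * t by ring,
    Complex.ofReal_mul, Complex.mul_cpow_ofReal_nonneg (by positivity) hy0.le]
  ring

/-- The nonzero vectors of length one. -/
def nzOneEquiv : NZInt ≃ NZ 1 where
  toFun M := ⟨lastVec 1 M.1, fun h => M.2 (by simpa [lastVec] using congrFun h 0)⟩
  invFun v := ⟨v.1 0, fun h => v.2 (funext fun i => by rw [Subsingleton.elim i 0, h]; rfl)⟩
  left_inv M := by simp [lastVec]
  right_inv v := Subtype.ext (funext fun i => by rw [Subsingleton.elim i 0]; simp [lastVec])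

/-- The frequencies of the second column are the nonzero integers, so no cosets are needed; the
constant term fills the place `m = 0`. -/
lemma hasSum_fourierCoeff_first (hn : 2 ≤ n) (hE : IsDegenerateEisenstein n E)
    (hs : ∀ j : ℕ, j ≤ n → (n : ℂ) * s ≠ j) (hξ : completedRiemannZeta (n * s) ≠ 0)
    (h : Coords n z x c) :
    HasSum (fun m : ℤ => fourierCoeff n (fun g => E g s) (single 1 m) z)
      (fourierCoeff n (fun g => E g s) 0 z +
        eisScale n c s * (tailProd n c 1 * besselSum x c 1 ((n * s - n + (1 : ℕ)) / 2))) := by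
  have h1 := nzOneEquiv.hasSum_iff.mpr
    (hasSum_fiberSum x (fun j hj => h.1 j (show j < n by omega)) ((n * s - n + (1 : ℕ)) / 2))
  have h2 : HasSum (fun m : NZInt => fourierCoeff n (fun g => E g s) (single 1 m.1) z)
      (eisScale n c s * (tailProd n c 1 * besselSum x c 1 ((n * s - n + (1 : ℕ)) / 2))) := by
    refine ((h1.mul_left _).mul_left _).congr_fun fun m => ?_
    rw [fourierCoeff_single hn hE hs hξ h (Finset.mem_Icc.mpr ⟨le_rfl, by omega⟩) m.2]
    rfl
  have h3 : fourierCoeff n (fun g => E g s) (single 1 0) z = fourierCoeff n (fun g => E g s) 0 z := by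
    rw [single, Pi.single_zero]
  have h4 := (hasSum_subtype_iff_indicator (s := {m : ℤ | m ≠ 0})
    (f := fun m : ℤ => fourierCoeff n (fun g => E g s) (single 1 m) z)).mp h2
  have h5 := (hasSum_pi_single (0 : ℤ) (fourierCoeff n (fun g => E g s) 0 z)).add h4
  refine h5.congr_fun fun m => ?_
  by_cases hm : m = 0
  · subst hm
    simp [h3]
  · simp [hm]

/-- A pair of a coset and a positive integer is the same as a nonzero frequency. For `i ≥ 2` the
cosets account for signs, as `v` and `-v` are both last rows; hence only positive `m` appear. -/
lemma hasSum_fourierCoeff_cosets (hn : 2 ≤ n) (hE : IsDegenerateEisenstein n E)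
    (hs : ∀ j : ℕ, j ≤ n → (n : ℂ) * s ≠ j) (hξ : completedRiemannZeta (n * s) ≠ 0)
    (h : Coords n z x c) {i : ℕ} (hi : i ∈ Finset.Icc 2 (n - 1))
    {T : Set (Matrix.SpecialLinearGroup (Fin i) ℤ)}
    (hT : Subgroup.IsComplement (P i : Set (Matrix.SpecialLinearGroup (Fin i) ℤ)) T) :
    HasSum (fun p : T × ℕ+ => fourierCoeff n (fun g => E g s) (single i (p.2 : ℕ))
        (block i n p.1 * z))
      (eisScale n c s * (tailProd n c i * besselSum x c i ((n * s - n + i) / 2))) := by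
  have hi' := Finset.mem_Icc.mp hi
  have h1 := (((cosetEquiv hi'.1 hT).prodCongr (Equiv.refl ℕ+)).trans (primEquiv i)).hasSum_iff.mpr
    (hasSum_fiberSum x (fun j hj => h.1 j (show j < n by omega)) ((n * s - n + i) / 2))
  refine ((h1.mul_left _).mul_left _).congr_fun fun p => ?_
  have hp : ((p.2 : ℕ) : ℤ) ≠ 0 := by exact_mod_cast p.2.ne_zero
  rw [fourierCoeff_single_block hn hE hs hξ h (Finset.mem_Icc.mpr ⟨by omega, hi'.2⟩) hp]
  rfl

lemma besselSum_zero (x : ℕ → ℕ → ℝ) (c : ℕ → ℝ) (ν : ℂ) : besselSum x c 0 ν = 0 := by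
  have : IsEmpty (NZ 0) := ⟨fun v => v.2 (Subsingleton.elim _ _)⟩
  rw [besselSum, tsum_empty]

theorem fourier_expansion (hn : 2 ≤ n) (hE : IsDegenerateEisenstein n E)
    (hs : ∀ j : ℕ, j ≤ n → (n : ℂ) * s ≠ j) (hξ : completedRiemannZeta (n * s) ≠ 0)
    (h : Coords n z x c) (T : (i : ℕ) → Set (Matrix.SpecialLinearGroup (Fin i) ℤ))
    (hT : ∀ i ∈ Finset.Icc 2 (n - 1), Subgroup.IsComplement
      (P i : Set (Matrix.SpecialLinearGroup (Fin i) ℤ)) (T i)) :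
    E z s = (∑' m : ℤ, fourierCoeff n (fun g => E g s) (single 1 m) z) +
      ∑ i ∈ Finset.Icc 2 (n - 1), ∑' γ : T i, ∑' m : ℕ+,
        fourierCoeff n (fun g => E g s) (single i (m : ℕ)) (block i n γ * z) := by
  have h1 : ∀ i ∈ Finset.Icc 2 (n - 1), (∑' γ : T i, ∑' m : ℕ+,
      fourierCoeff n (fun g => E g s) (single i (m : ℕ)) (block i n γ * z)) =
        eisScale n c s * (tailProd n c i * besselSum x c i ((n * s - n + i) / 2)) := by
    intro i hi
    have h2 := hasSum_fourierCoeff_cosets hn hE hs hξ h hi (hT i hi)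
    rw [← h2.tsum_eq, h2.summable.tsum_prod]
  -- The index `0` belongs to the first column, which has no entries above the diagonal and an empty
  -- Bessel sum; the index `1` is the sum over `m_1`.
  have hrange : Finset.range n = insert 0 (insert 1 (Finset.Icc 2 (n - 1))) := by
    ext j
    simp only [Finset.mem_range, Finset.mem_insert, Finset.mem_Icc]
    omega
  have h3 : ∑ k ∈ Finset.range n, tailProd n c k * besselSum x c k ((n * s - n + k) / 2) =
      tailProd n c 1 * besselSum x c 1 ((n * s - n + (1 : ℕ)) / 2) +
        ∑ k ∈ Finset.Icc 2 (n - 1), tailProd n c k * besselSum x c k ((n * s - n + k) / 2) := by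
    rw [hrange, Finset.sum_insert (by simp), Finset.sum_insert (by simp), besselSum_zero, mul_zero,
      zero_add]
  rw [Finset.sum_congr rfl h1, (hasSum_fourierCoeff_first hn hE hs hξ h).tsum_eq,
    (hE.eventuallyEq hn hs hξ h).self_of_nhds, eisFun_expansion, fourierCoeff_zero hn hE hs hξ h,
    ← Finset.mul_sum]
  simp only [mul_add, Finset.sum_add_distrib, h3]
  ring

end Expansion

end DegEis

end

theorem theorem3p1 (n : ℕ) (hn : 3 ≤ n) :
    (∃ E, DegEis.IsDegenerateEisenstein n E) ∧
    ∀ E, DegEis.IsDegenerateEisenstein n E →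
    ∀ s : ℂ, (∀ j : ℕ, j ≤ n → (n : ℂ) * s ≠ j) → completedRiemannZeta (n * s) ≠ 0 →
    ∀ (x : ℕ → ℕ → ℝ) (y : ℕ → ℝ), (∀ j ∈ Finset.Icc 1 (n - 1), 0 < y j) →
    ∀ z : Matrix (Fin n) (Fin n) ℝ, z = DegEis.unip n x * DegEis.torus n y →
      -- `E z` is regular at `s` and the integrals defining the coefficients converge
      AnalyticAt ℂ (E z) s ∧
      MeasureTheory.IntegrableOn
        (fun u : DegEis.upperPairs n → ℝ => E (DegEis.unip n (DegEis.ext n u) * z) s)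
        (Set.Icc 0 1) ∧
      -- the non-degenerate coefficients vanish
      (∀ m : ℕ → ℤ, (∃ i ∈ Finset.Icc 1 (n - 1), ∃ j ∈ Finset.Icc 1 (n - 1),
          i ≠ j ∧ m i ≠ 0 ∧ m j ≠ 0) →
        DegEis.fourierCoeff n (fun g => E g s) m z = 0) ∧
      -- the Fourier expansion, for all choices `T i` of representatives of the cosets
      (∀ T : (i : ℕ) → Set (Matrix.SpecialLinearGroup (Fin i) ℤ),
        (∀ i ∈ Finset.Icc 2 (n - 1), Subgroup.IsComplement
          (DegEis.P i : Set (Matrix.SpecialLinearGroup (Fin i) ℤ)) (T i)) →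
        Summable (fun m : ℤ =>
          DegEis.fourierCoeff n (fun g => E g s) (DegEis.single 1 m) z) ∧
        (∀ i ∈ Finset.Icc 2 (n - 1), Summable (fun p : T i × ℕ+ =>
          DegEis.fourierCoeff n (fun g => E g s) (DegEis.single i (p.2 : ℕ))
            (DegEis.block i n p.1 * z))) ∧
        E z s =
          (∑' m : ℤ, DegEis.fourierCoeff n (fun g => E g s) (DegEis.single 1 m) z) +
          ∑ i ∈ Finset.Icc 2 (n - 1), ∑' γ : T i, ∑' m : ℕ+,
            DegEis.fourierCoeff n (fun g => E g s) (DegEis.single i (m : ℕ))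
              (DegEis.block i n γ * z)) ∧
      -- the constant term
      DegEis.fourierCoeff n (fun g => E g s) 0 z =
        ∑ k ∈ Finset.range n,
          2 * completedRiemannZeta (n * s - n + k + 1) / completedRiemannZeta (n * s) *
            DegEis.powerFun n k s y ∧
      -- the degenerate non-constant terms
      (∀ k ∈ Finset.Icc 1 (n - 1), ∀ m : ℤ, m ≠ 0 →
        DegEis.fourierCoeff n (fun g => E g s) (DegEis.single k m) z =
          DegEis.e (m * x k (k + 1)) * (4 / completedRiemannZeta (n * s)) *
            (m.natAbs : ℂ) ^ ((n * s - (n - k)) / 2) *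
            DegEis.sigma (-n * s + (n - k)) m.natAbs *
            DegEis.besselK ((n * s - (n - k)) / 2) (2 * Real.pi * m.natAbs * y (n - k)) *
            DegEis.powerFun n k s y *
            (y (n - k) : ℂ) ^ (-(n * s - (n - k)) / 2)) := by
  refine ⟨DegEis.exists_isDegenerateEisenstein (by omega),
    fun E hE s hs hξ x y hy z hz => ?_⟩
  have hn2 : 2 ≤ n := by omega
  -- In terms of `y` the scale of the column with index `a`, counted from `0`, is `Y_{n-a}`.
  have h : DegEis.Coords n z x (fun a => DegEis.bigY y (n - a)) :=
    hz ▸ DegEis.coords_unip_mul_torus x hy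
  refine ⟨(DegEis.analyticAt_eisFun (by omega) x h.1 hs hξ).congr
      (hE.eventuallyEq hn2 hs hξ h).symm,
    DegEis.integrableOn_eisenstein hn2 hE hs hξ h, ?_, fun T hT => ⟨?_, ?_, ?_⟩, ?_, ?_⟩
  · rintro m ⟨i, hi, j, hj, hij, hmi, hmj⟩
    exact DegEis.fourierCoeff_eq_zero hn2 hE hs hξ h hi hj hij hmi hmj
  · exact (DegEis.hasSum_fourierCoeff_first hn2 hE hs hξ h).summable
  · exact fun i hi => (DegEis.hasSum_fourierCoeff_cosets hn2 hE hs hξ h hi (hT i hi)).summable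
  · exact DegEis.fourier_expansion hn2 hE hs hξ h T hT
  · exact DegEis.fourierCoeff_zero_eq_sum hn2 hE hs hξ hy hz
  · exact fun k hk m hm => DegEis.fourierCoeff_single_eq_besselK hn2 hE hs hξ hy hz hk hm
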